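/- A \emph{convex polyhedron} $P$ is the convex hull of finitely many points of $\mathbb R^3$, of dimension $3$ (non-flat), or of dimension $2$ (flat), in which case it stands for the doubly-covered convex polygon, i.e. two copies of the polygon attached along their boundary. The Gaussian curvature of $P$ at a vertex $v$ is $2\pi$ minus the sum of the angles at $v$ of the faces of $P$ incident to $v$ (a doubly-covered polygon has two faces). We say that $P$ is \emph{glued edge-to-edge from $n$ congruent regular hexagons} if the $6n$ edges of the hexagons are matched in pairs of distinct edges so that, when each edge is glued isometrically to its mate, the glued hexagons can be folded (without stretching, along finitely many creases) onto the surface of $P$, two points of the hexagons being placed at the same point of the surface exactly if they are glued together. Let $P$ be a convex polyhedron glued edge-to-edge from finitely many congruent regular hexagons. Then: (1) At every vertex of $P$ either exactly one hexagon corner is located, and the Gaussian curvature is $4\pi/3$, or exactly two hexagon corners are glued together, and the Gaussian curvature is $2\pi/3$. (2) $P$ has at most $6$ vertices. (3) $P$ is of exactly one of the following $15$ types. If $P$ is flat, its interior angles in cyclic order are (a) $\frac\pi3,\frac\pi3,\frac\pi3$ (equilateral triangle); (b) $\frac\pi3,\frac{2\pi}3,\frac\pi3,\frac{2\pi}3$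 (parallelogram); (c) $\frac\pi3,\frac\pi3,\frac{2\pi}3,\frac{2\pi}3$ (trapezoid); (d) $\frac\pi3,\frac{2\pi}3,\frac{2\pi}3,\frac{2\pi}3,\frac{2\pi}3$ (pentagon); or (e) six times $\frac{2\pi}3$ (hexagon). If $P$ is not flat, its graph (vertices and edges) is isomorphic to one of ten graphs: those of the tetrahedron, the triangular bipyramid, the square pyramid, the octahedron, the other simplicial polyhedron with $6$ vertices (vertex degrees $5,5,4,4,3,3$), the triangular prism, the pentagonal pyramid, the other polyhedron with $6$ vertices and $10$ edges, and the two polyhedra with $6$ vertices and $11$ edges. Moreover, these ten graphs are pairwise non-isomorphic; they are, up to isomorphism, exactly the $3$-connected planar simple graphs with at most $6$ vertices, and exactly the graphs of non-flat convex polyhedra with at most $6$ vertices. -/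

import Mathlib

noncomputable section

namespace HexGlue

/-- Euclidean 3-space. -/
abbrev E3 : Type := EuclideanSpace ℝ (Fin 3)

/-! ### Convex polyhedra, including doubly covered polygons -/

/-- The dimension of (the affine hull of) a set. -/
def dim (P : Set E3) : ℕ := Module.finrank ℝ (vectorSpan ℝ P)

/-- A convex polyhedron: the convex hull of finitely many points, of dimension `3`, or of
dimension `2`, in which case it stands for the doubly covered convex polygon. -/
structure IsConvexPolyhedron (P : Set E3) : Prop where
  polytope : ∃ s : Finset E3, P = convexHull ℝ (s : Set E3)
  dim_eq : dim P = 2 ∨ dim P = 3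

/-- The vertices of `P`. -/
abbrev vertices (P : Set E3) : Set E3 := P.extremePoints ℝ

/-- The 1-skeleton of `P`: two vertices are adjacent if the segment between them is an edge
(a one-dimensional exposed face) of `P`. -/
def skeleton (P : Set E3) : SimpleGraph (vertices P) where
  Adj v w := v ≠ w ∧ IsExposed ℝ P (segment ℝ (v : E3) (w : E3))
  symm := ⟨fun v w h => ⟨h.1.symm, by rw [segment_symm]; exact h.2⟩⟩
  loopless := ⟨fun _ h => h.1 rfl⟩

/-- The set of points of `P` that are extreme in the direction `u`. -/
def face (P : Set E3) (u : E3) : Set E3 := {x ∈ P | ∀ y ∈ P, inner ℝ u y ≤ inner ℝ u x}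

/-- The outward unit normals of the (two-dimensional) faces of `P`. They index the faces: if
`dim P = 3`, each face has exactly one outward unit normal; if `dim P = 2`, there are two of
them, opposite to each other, and both have `face P u = P`: these are the two sheets of the
doubly covered polygon. -/
def faceNormals (P : Set E3) : Set E3 := {u | ‖u‖ = 1 ∧ dim (face P u) = 2}

/-- The interior angle of a convex polygon `F` at its vertex `v`. -/
def faceAngle (F : Set E3) (v : E3) : ℝ :=
  sSup {θ | ∃ x ∈ F, ∃ y ∈ F, x ≠ v ∧ y ≠ v ∧ θ = EuclideanGeometry.angle x v y}

/-- The Gaussian curvature of `P` at `v`: `2π` minus the sum of the angles at `v` of the faces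
incident to `v` (for a doubly covered polygon, both sheets count). -/
def curvature (P : Set E3) (v : E3) : ℝ :=
  2 * Real.pi - ∑ᶠ u ∈ {u | u ∈ faceNormals P ∧ v ∈ face P u}, faceAngle (face P u) v

/-- The points of the faces of `P`, each marked with the normal of a face that carries it. -/
def markedPoints (P : Set E3) : Set (E3 × E3) := {p | p.2 ∈ faceNormals P ∧ p.1 ∈ face P p.2}

/-- Two marked points are the same point of the surface of `P`: faces are attached to each other
along their relative boundaries. (If `dim P = 3`, this just says that `p.1 = q.1`, and the
surface is the boundary of `P`; if `dim P = 2`, it attaches the two sheets along the boundary of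
the polygon.) -/
def SamePoint (P : Set E3) (p q : E3 × E3) : Prop :=
  p.1 = q.1 ∧ (p.2 = q.2 ∨ p.1 ∈ intrinsicFrontier ℝ (face P p.2))

/-! ### Gluing regular hexagons edge-to-edge -/

/-- The corners of the regular hexagon of side length `a`, in cyclic order. -/
def corner (a : ℝ) (k : Fin 6) : ℂ :=
  (a : ℂ) * Complex.exp (((k : ℕ) : ℂ) * (Real.pi / 3) * Complex.I)

/-- The (solid) regular hexagon of side length `a`. -/
def hexagon (a : ℝ) : Set ℂ := convexHull ℝ (Set.range (corner a))

/-- The point with parameter `t` on the `k`-th edge of the hexagon. -/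
def edgePoint (a : ℝ) (k : Fin 6) (t : ℝ) : ℂ :=
  AffineMap.lineMap (corner a k) (corner a (k + 1)) t

/-- An edge-to-edge gluing pattern of `n` hexagons: the `6 n` edges are matched in pairs of
distinct edges, and `flip` tells in which of the two possible directions an edge is glued to its
mate. -/
structure Gluing (n : ℕ) where
  mate : Fin n × Fin 6 → Fin n × Fin 6
  mate_mate : ∀ e, mate (mate e) = e
  mate_ne : ∀ e, mate e ≠ e
  flip : Fin n × Fin 6 → Bool
  flip_mate : ∀ e, flip (mate e) = flip e

/-- The equivalence relation on the disjoint union of the hexagons generated by gluing each edge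
to its mate. -/
def Gluing.Rel {n : ℕ} (G : Gluing n) (a : ℝ) : Fin n × ℂ → Fin n × ℂ → Prop :=
  Relation.EqvGen fun p q => ∃ (e : Fin n × Fin 6) (t : ℝ), t ∈ Set.Icc (0 : ℝ) 1 ∧
    p = (e.1, edgePoint a e.2 t) ∧
    q = ((G.mate e).1, edgePoint a (G.mate e).2 (if G.flip e then 1 - t else t))

/-- A way to obtain the surface of `P` by folding `n` regular hexagons of side length `a` and
gluing them by the pattern `G`. The point `x` of the `i`-th hexagon goes to the point `fold i x`
of the surface (marked by a face that carries it). The hexagons cover the surface, two points of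
the hexagons go to the same point of the surface exactly if they are glued together, and the
hexagons are folded without stretching: each of them is cut by its creases into finitely many
closed pieces, and each piece is placed isometrically into one face of `P`. -/
structure Folding (P : Set E3) {n : ℕ} (G : Gluing n) (a : ℝ) where
  fold : Fin n → ℂ → E3 × E3
  fold_mem : ∀ i, ∀ x ∈ hexagon a, fold i x ∈ markedPoints P
  covers : ∀ p ∈ markedPoints P, ∃ i, ∃ x ∈ hexagon a, SamePoint P (fold i x) p
  glued_iff : ∀ i j, ∀ x ∈ hexagon a, ∀ y ∈ hexagon a,
    SamePoint P (fold i x) (fold j y) ↔ G.Rel a (i, x) (j, y)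
  pieces : ∀ i, ∃ 𝒞 : Set (Set ℂ), 𝒞.Finite ∧ ⋃₀ 𝒞 = hexagon a ∧ ∀ C ∈ 𝒞, IsClosed C ∧
    (∃ u, ∀ x ∈ C, ((fold i x).1, u) ∈ markedPoints P ∧
      SamePoint P (fold i x) ((fold i x).1, u)) ∧
    ∀ x ∈ C, ∀ y ∈ C, dist (fold i x).1 (fold i y).1 = dist x y

/-- The number of hexagons glued together at the point `v`, counted by their corners at `v`. -/
def Folding.cornerCount {P : Set E3} {n : ℕ} {G : Gluing n} {a : ℝ} (F : Folding P G a)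
    (v : E3) : ℕ :=
  Nat.card {c : Fin n × Fin 6 // (F.fold c.1 (corner a c.2)).1 = v}

/-! ### Graphs of convex polyhedra -/

/-- A graph is 3-connected if it has more than three vertices and remains connected after the
removal of any at most two vertices. -/
def IsThreeConnected {V : Type*} (G : SimpleGraph V) : Prop :=
  3 < ENat.card V ∧ ∀ s : Set V, s.encard ≤ 2 → (G.induce sᶜ).Connected

/-- A rotation system of `G`: a permutation of the darts that cyclically permutes the darts
leaving each vertex. -/
def IsRotation {V : Type*} {G : SimpleGraph V} (σ : Equiv.Perm G.Dart) : Prop :=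
  ∀ d d' : G.Dart, σ.SameCycle d d' ↔ d.fst = d'.fst

/-- The number of faces of a rotation system: the orbits of reversing a dart and then rotating. -/
def numFaces {V : Type*} {G : SimpleGraph V} (σ : Equiv.Perm G.Dart) : ℕ :=
  Nat.card (Quotient (Equiv.Perm.SameCycle.setoid
    (σ * SimpleGraph.Dart.symm_involutive.toPerm)))

/-- A finite graph is planar if it has a combinatorial embedding into the sphere, i.e. a rotation
system of genus zero: every connected component with an edge satisfies Euler's formula
`V - E + F = 2`. As `V - E + F ≤ 2` for each of them, and an isolated vertex has `V = 1` and no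
orbit of darts, this can be summed over the components. -/
def IsPlanar {V : Type*} (G : SimpleGraph V) : Prop :=
  ∃ σ : Equiv.Perm G.Dart, IsRotation σ ∧
    Nat.card V + numFaces σ + Nat.card {v : V // ∀ w, ¬ G.Adj v w} =
      Nat.card G.edgeSet + 2 * Nat.card G.ConnectedComponent

/-- `G` is the graph of a (non-flat) convex polyhedron. -/
def IsPolyhedral {V : Type*} (G : SimpleGraph V) : Prop :=
  ∃ P : Set E3, IsConvexPolyhedron P ∧ dim P = 3 ∧ Nonempty (skeleton P ≃g G)

/-- The numbers of vertices of the ten graphs. -/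
def order : Fin 10 → ℕ := ![4, 5, 5, 6, 6, 6, 6, 6, 6, 6]

/-- The edges of the ten graphs: tetrahedron, triangular bipyramid, square pyramid, octahedron,
the other simplicial polyhedron with six vertices, triangular prism, pentagonal pyramid, the
other polyhedron with 6 vertices and 10 edges, the two polyhedra with 6 vertices and 11 edges. -/
def edges : Fin 10 → List (ℕ × ℕ) := ![
  [(0, 1), (0, 2), (0, 3), (1, 2), (1, 3), (2, 3)],
  [(0, 1), (0, 2), (1, 2), (0, 3), (1, 3), (2, 3), (0, 4), (1, 4), (2, 4)],
  [(0, 1), (1, 2), (2, 3), (0, 3), (0, 4), (1, 4), (2, 4), (3, 4)],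
  [(0, 2), (0, 3), (0, 4), (0, 5), (1, 2), (1, 3), (1, 4), (1, 5), (2, 4), (2, 5), (3, 4), (3, 5)],
  [(0, 1), (0, 2), (0, 3), (0, 4), (0, 5), (1, 2), (1, 3), (1, 4), (1, 5), (2, 3), (3, 4), (4, 5)],
  [(0, 1), (1, 2), (0, 2), (3, 4), (4, 5), (3, 5), (0, 3), (1, 4), (2, 5)],
  [(0, 1), (1, 2), (2, 3), (3, 4), (0, 4), (0, 5), (1, 5), (2, 5), (3, 5), (4, 5)],
  [(0, 1), (0, 3), (0, 4), (0, 5), (1, 2), (1, 4), (1, 5), (2, 3), (2, 5), (3, 4)],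
  [(0, 1), (0, 2), (0, 3), (0, 4), (0, 5), (1, 2), (1, 4), (1, 5), (2, 3), (2, 5), (3, 4)],
  [(0, 2), (0, 3), (0, 4), (0, 5), (1, 2), (1, 3), (1, 4), (1, 5), (2, 3), (2, 5), (3, 4)]]

/-- The ten graphs. -/
def polyGraph (k : Fin 10) : SimpleGraph (Fin (order k)) :=
  SimpleGraph.fromRel fun i j => ((i : ℕ), (j : ℕ)) ∈ edges k

/-! ### The fifteen types of shapes -/

/-- The interior angles, in cyclic order, of the five types of flat shapes: equilateral triangle,
parallelogram, trapezoid, pentagon, hexagon. -/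
def flatAngles : Fin 5 → List ℝ := ![
  [Real.pi / 3, Real.pi / 3, Real.pi / 3],
  [Real.pi / 3, 2 * Real.pi / 3, Real.pi / 3, 2 * Real.pi / 3],
  [Real.pi / 3, Real.pi / 3, 2 * Real.pi / 3, 2 * Real.pi / 3],
  [Real.pi / 3, 2 * Real.pi / 3, 2 * Real.pi / 3, 2 * Real.pi / 3, 2 * Real.pi / 3],
  [2 * Real.pi / 3, 2 * Real.pi / 3, 2 * Real.pi / 3, 2 * Real.pi / 3, 2 * Real.pi / 3,
    2 * Real.pi / 3]]

/-- `P` is flat, and `L` lists its interior angles in the cyclic order of its vertices. -/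
def IsFlatWithAngles (P : Set E3) (L : List ℝ) : Prop :=
  dim P = 2 ∧ ∃ v : Fin L.length ≃ vertices P,
    (∀ i, (skeleton P).Adj (v i) (v (finRotate L.length i))) ∧
    ∀ i, faceAngle P (v i) = L.get i

/-- `P` has the flat type `Sum.inl k` or the non-flat type `Sum.inr k`. -/
def HasType (P : Set E3) : Fin 5 ⊕ Fin 10 → Prop
  | Sum.inl k => IsFlatWithAngles P (flatAngles k)
  | Sum.inr k => dim P = 3 ∧ Nonempty (skeleton P ≃g polyGraph k)

end HexGlue

end

noncomputable section

namespace HexGlue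

open Set MeasureTheory

/-! ### Polytopes and their faces -/

/-- `V` is the finite set of vertices of the polytope `P`. -/
structure IsVertexSet (V : Finset E3) (P : Set E3) : Prop where
  coe_eq : (V : Set E3) = vertices P
  hull_eq : P = convexHull ℝ (V : Set E3)

theorem exists_isVertexSet {P : Set E3} (hP : ∃ s : Finset E3, P = convexHull ℝ (s : Set E3)) :
    ∃ V : Finset E3, IsVertexSet V P := by
  obtain ⟨s, rfl⟩ := hP
  have hsub : vertices (convexHull ℝ (s : Set E3)) ⊆ s := extremePoints_convexHull_subset
  have hfin : (vertices (convexHull ℝ (s : Set E3))).Finite := s.finite_toSet.subset hsub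
  refine ⟨hfin.toFinset, by simp, ?_⟩
  have h := closure_convexHull_extremePoints (s.finite_toSet.isCompact_convexHull (𝕜 := ℝ))
    (convex_convexHull ℝ (s : Set E3))
  rw [Finite.coe_toFinset]
  rw [(hfin.isCompact_convexHull (𝕜 := ℝ)).isClosed.closure_eq] at h
  exact h.symm

theorem inner_le_of_mem_convexHull {A : Set E3} {u x : E3} {M : ℝ}
    (h : ∀ p ∈ A, inner ℝ u p ≤ M) (hx : x ∈ convexHull ℝ A) : inner ℝ u x ≤ M := by
  have : convexHull ℝ A ⊆ {y | inner ℝ u y ≤ M} :=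
    convexHull_min h (convex_halfSpace_le (f := fun y => inner ℝ u y)
      (innerₗ E3 u).isLinear M)
  exact this hx

theorem le_inner_of_mem_convexHull {A : Set E3} {u x : E3} {M : ℝ}
    (h : ∀ p ∈ A, M ≤ inner ℝ u p) (hx : x ∈ convexHull ℝ A) : M ≤ inner ℝ u x := by
  have := inner_le_of_mem_convexHull (u := -u) (M := -M) (x := x) (A := A)
    (fun p hp => by simpa using h p hp) hx
  simpa using this

theorem face_convexHull (A : Finset E3) (u : E3) :
    face (convexHull ℝ (A : Set E3)) u =
      convexHull ℝ {p ∈ (A : Set E3) | ∀ q ∈ A, inner ℝ u q ≤ inner ℝ u p} := by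
  classical
  apply Subset.antisymm
  · rintro x ⟨hx, hmax⟩
    obtain ⟨w, hw0, hw1, rfl⟩ := Finset.mem_convexHull'.1 hx
    set x := ∑ y ∈ A, w y • y with hxdef
    have hle : ∀ y ∈ A, inner ℝ u y ≤ inner ℝ u x := fun y hy =>
      hmax y (subset_convexHull ℝ _ hy)
    have hsum : ∑ y ∈ A, w y * (inner ℝ u x - inner ℝ u y) = 0 := by
      have : inner ℝ u x = ∑ y ∈ A, w y * inner ℝ u y := by
        rw [hxdef, inner_sum]; simp [inner_smul_right]
      simp only [mul_sub, Finset.sum_sub_distrib, ← Finset.sum_mul, hw1]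
      rw [← this]; ring
    have hz := (Finset.sum_eq_zero_iff_of_nonneg (fun y hy =>
      mul_nonneg (hw0 y hy) (sub_nonneg.2 (hle y hy)))).1 hsum
    have hset : {p ∈ (A : Set E3) | ∀ q ∈ A, inner ℝ u q ≤ inner ℝ u p} =
        ((A.filter fun p => ∀ q ∈ A, inner ℝ u q ≤ inner ℝ u p : Finset E3) : Set E3) := by
      ext; simp
    rw [hset, Finset.mem_convexHull']
    have hzero : ∀ y ∈ A, ¬ (∀ q ∈ A, inner ℝ u q ≤ inner ℝ u y) → w y = 0 := by
      intro y hy hn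
      rcases mul_eq_zero.1 (hz y hy) with h | h
      · exact h
      · exact absurd (fun q hq => by have := hle q hq; linarith) hn
    refine ⟨w, fun y hy => hw0 y (Finset.mem_filter.1 hy).1, ?_, ?_⟩
    · rw [← hw1]
      exact Finset.sum_filter_of_ne fun y hy hne => by
        by_contra hn; exact hne (hzero y hy hn)
    · exact Finset.sum_filter_of_ne fun y hy hne => by
        by_contra hn; exact hne (by rw [hzero y hy hn, zero_smul])
  · intro x hx
    refine ⟨convexHull_mono (fun p hp => hp.1) hx, fun y hy => ?_⟩
    exact inner_le_of_mem_convexHull (fun q hq =>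
      le_inner_of_mem_convexHull (fun p hp => hp.2 q hq) hx) hy

theorem isExposed_iff_face {P B : Set E3} (hB : B.Nonempty) :
    IsExposed ℝ P B ↔ ∃ u, B = face P u := by
  constructor
  · intro h
    obtain ⟨l, hl⟩ := h hB
    refine ⟨(InnerProductSpace.toDual ℝ E3).symm l, ?_⟩
    simp [face, hl]
  · rintro ⟨u, rfl⟩ _
    exact ⟨innerSL ℝ u, by simp [face]⟩

namespace IsVertexSet

variable {V : Finset E3} {P : Set E3}

theorem mem_iff (hV : IsVertexSet V P) {v : E3} : v ∈ V ↔ v ∈ vertices P := by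
  rw [← hV.coe_eq]; rfl

theorem subset (hV : IsVertexSet V P) {v : E3} (hv : v ∈ V) : v ∈ P :=
  (hV.mem_iff.1 hv).1

theorem mem_face_iff (hV : IsVertexSet V P) {u x : E3} :
    x ∈ face P u ↔ x ∈ P ∧ ∀ p ∈ V, inner ℝ u p ≤ inner ℝ u x := by
  constructor
  · exact fun h => ⟨h.1, fun p hp => h.2 p (hV.subset hp)⟩
  · refine fun h => ⟨h.1, fun y hy => ?_⟩
    rw [hV.hull_eq] at hy
    exact inner_le_of_mem_convexHull h.2 hy

theorem exists_exposing (hV : IsVertexSet V P) {v : E3} (hv : v ∈ V) :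
    ∃ h : E3, ∀ p ∈ V, p ≠ v → inner ℝ h (p - v) < 0 := by
  classical
  have hnot : v ∉ convexHull ℝ ((V.erase v : Finset E3) : Set E3) := by
    intro hmem
    have hsub : convexHull ℝ ((V.erase v : Finset E3) : Set E3) ⊆ P := by
      rw [hV.hull_eq]; exact convexHull_mono (by simp)
    have := extremePoints_convexHull_subset
      (inter_extremePoints_subset_extremePoints_of_subset hsub ⟨hmem, hV.mem_iff.1 hv⟩)
    simp at this
  obtain ⟨l, s, h1, h2⟩ := geometric_hahn_banach_point_closed (convex_convexHull ℝ _)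
    (((V.erase v).finite_toSet.isCompact_convexHull (𝕜 := ℝ)).isClosed) hnot
  refine ⟨-(InnerProductSpace.toDual ℝ E3).symm l, fun p hp hne => ?_⟩
  have := h2 p (subset_convexHull ℝ _ (by simp [hp, hne]))
  simp
  linarith

theorem not_collinear (hV : IsVertexSet V P) {v p q : E3} (hv : v ∈ V) (hp : p ∈ V) (hq : q ∈ V)
    (hpv : p ≠ v) (hqv : q ≠ v) (hpq : p ≠ q) (c : ℝ) : q - v ≠ c • (p - v) := by
  intro h
  obtain ⟨a, ha⟩ := hV.exists_exposing hv
  obtain ⟨b, hb⟩ := hV.exists_exposing hp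
  obtain ⟨d, hd⟩ := hV.exists_exposing hq
  have a1 := ha p hp hpv
  have a2 := ha q hq hqv
  have b1 := hb v hv hpv.symm
  have b2 := hb q hq hpq.symm
  have d1 := hd v hv hqv.symm
  have d2 := hd p hp hpq
  have e : q = v + c • (p - v) := by rw [← h]; abel
  subst e
  have e1 : v + c • (p - v) - p = (1 - c) • (v - p) := by module
  have e2 : v + c • (p - v) - v = c • (p - v) := by module
  have e3 : v - (v + c • (p - v)) = c • (v - p) := by module
  have e4 : p - (v + c • (p - v)) = (c - 1) • (v - p) := by module
  rw [e2, inner_smul_right] at a2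
  rw [e1, inner_smul_right] at b2
  rw [e3, inner_smul_right] at d1
  rw [e4, inner_smul_right] at d2
  have hc : 0 < c := by by_contra! hc; nlinarith
  have hc1 : c < 1 := by by_contra! hc; nlinarith
  nlinarith

theorem nonempty (hV : IsVertexSet V P) (hP : P.Nonempty) : V.Nonempty := by
  rw [hV.hull_eq] at hP
  simpa using hP

theorem face_eq (hV : IsVertexSet V P) (u : E3) :
    face P u = convexHull ℝ {p ∈ (V : Set E3) | ∀ q ∈ V, inner ℝ u q ≤ inner ℝ u p} := by
  conv_lhs => rw [hV.hull_eq]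
  exact face_convexHull V u

theorem adj_iff (hV : IsVertexSet V P) {v w : vertices P} :
    (skeleton P).Adj v w ↔ (v : E3) ≠ w ∧ ∃ u : E3, inner ℝ u (w : E3) = inner ℝ u (v : E3) ∧
      ∀ p ∈ V, p ≠ v → p ≠ w → inner ℝ u p < inner ℝ u (v : E3) := by
  have hvV : (v : E3) ∈ V := hV.mem_iff.2 v.2
  have hwV : (w : E3) ∈ V := hV.mem_iff.2 w.2
  have hne : (segment ℝ (v : E3) w).Nonempty := ⟨v, left_mem_segment ℝ _ _⟩
  change (v ≠ w ∧ IsExposed ℝ P _) ↔ _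
  rw [isExposed_iff_face hne, ← Subtype.coe_ne_coe]
  refine and_congr_right fun hvw => exists_congr fun u => ?_
  constructor
  · intro h
    have hv : (v : E3) ∈ face P u := h ▸ left_mem_segment ℝ _ _
    have hw : (w : E3) ∈ face P u := h ▸ right_mem_segment ℝ _ _
    refine ⟨le_antisymm (hv.2 _ hw.1) (hw.2 _ hv.1), fun p hp hpv hpw => ?_⟩
    refine lt_of_le_of_ne (hv.2 p (hV.subset hp)) fun he => ?_
    have hpf : p ∈ face P u := ⟨hV.subset hp, fun y hy => by rw [he]; exact hv.2 y hy⟩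
    rw [← h] at hpf
    obtain ⟨c, hc, hpe⟩ := (segment_eq_image' ℝ (v : E3) w).subset hpf
    exact hV.not_collinear hvV hwV hp hvw.symm hpv hpw.symm c (by
      rw [← hpe]; simp)
  · rintro ⟨he, hlt⟩
    rw [hV.face_eq, ← convexHull_pair]
    congr 1
    ext p
    simp only [mem_insert_iff, mem_singleton_iff, mem_ofPred_eq, Finset.mem_coe]
    have key : ∀ q ∈ V, inner ℝ u q ≤ inner ℝ u (v : E3) := by
      intro q hq
      by_cases h1 : q = v
      · rw [h1]
      by_cases h2 : q = w
      · rw [h2, he]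
      · exact (hlt q hq h1 h2).le
    constructor
    · rintro (rfl | rfl)
      · exact ⟨hvV, key⟩
      · exact ⟨hwV, fun q hq => by rw [he]; exact key q hq⟩
    · rintro ⟨hp, hmax⟩
      by_contra! hcon
      exact absurd (hlt p hp hcon.1 hcon.2) (not_lt.2 (hmax _ hvV))

end IsVertexSet

/-! ### Generic directions -/

theorem volume_inner_eq_zero {t : E3} (ht : t ≠ 0) : volume {ω : E3 | inner ℝ ω t = 0} = 0 := by
  have h := Measure.addHaar_submodule (volume : Measure E3) (ℝ ∙ t)ᗮ (by
    intro h
    have : t ∈ (ℝ ∙ t)ᗮ := by rw [h]; trivial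
    rw [Submodule.mem_orthogonal_singleton_iff_inner_right] at this
    exact ht (inner_self_eq_zero.1 this))
  convert h using 2
  ext ω
  simp [Submodule.mem_orthogonal_singleton_iff_inner_left]

theorem ae_inner_ne_zero {T : Set E3} (hT : T.Finite) (h0 : ∀ t ∈ T, t ≠ 0) :
    ∀ᵐ ω : E3, ∀ t ∈ T, inner ℝ ω t ≠ (0 : ℝ) := by
  rw [ae_ball_iff hT.countable]
  intro t ht
  have := volume_inner_eq_zero (h0 t ht)
  rw [ae_iff]
  simpa using this

theorem exists_generic {U T : Set E3} (hU : IsOpen U) (hne : U.Nonempty) (hT : T.Finite)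
    (h0 : ∀ t ∈ T, t ≠ 0) : ∃ ω ∈ U, ∀ t ∈ T, inner ℝ ω t ≠ (0 : ℝ) := by
  by_contra! hcon
  have hpos := hU.measure_pos volume hne
  have : U ≤ᵐ[volume] (∅ : Set E3) := by
    filter_upwards [ae_inner_ne_zero hT h0] with ω hω hU
    obtain ⟨t, ht, h⟩ := hcon ω hU
    exact hω t ht h
  exact hpos.ne' (by simpa using measure_mono_ae this)

theorem isOpen_strict_max (V : Finset E3) (v : E3) :
    IsOpen {ω : E3 | ∀ p ∈ V, p ≠ v → inner ℝ ω (p - v) < 0} := by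
  have : {ω : E3 | ∀ p ∈ V, p ≠ v → inner ℝ ω (p - v) < 0} =
      ⋂ p ∈ V, {ω : E3 | p ≠ v → inner ℝ ω (p - v) < 0} := by ext; simp
  rw [this]
  refine isOpen_biInter_finset fun p _ => ?_
  by_cases h : p = v
  · simp [h]
  · simp only [ne_eq, h, not_false_eq_true, true_imp_iff]
    exact isOpen_lt (by fun_prop) continuous_const

/-- A vertex that does not maximise a linear functional has a neighbour at which the functional is
larger. -/
theorem IsVertexSet.exists_adj_lt {V : Finset E3} {P : Set E3} (hV : IsVertexSet V P)
    (v : vertices P) {f q : E3} (hq : q ∈ V) (hqv : 0 < inner ℝ f (q - v)) :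
    ∃ w : vertices P, (skeleton P).Adj v w ∧ 0 < inner ℝ f ((w : E3) - v) := by
  classical
  have hvV : (v : E3) ∈ V := hV.mem_iff.2 v.2
  let T : Set E3 := {t | ∃ p ∈ V, ∃ r ∈ V, p ≠ v ∧ r ≠ v ∧ p ≠ r ∧ inner ℝ f (p - v) ≠ (0 : ℝ) ∧
    t = (inner ℝ f (p - v) : ℝ) • (r - v) - (inner ℝ f (r - v) : ℝ) • (p - v)}
  have hT : T.Finite := by
    refine ((V ×ˢ V).finite_toSet.image fun x : E3 × E3 =>
      (inner ℝ f (x.1 - v) : ℝ) • (x.2 - v) - (inner ℝ f (x.2 - v) : ℝ) • (x.1 - v)).subset ?_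
    rintro t ⟨p, hp, r, hr, -, -, -, -, rfl⟩
    exact ⟨(p, r), by simp [hp, hr], rfl⟩
  have h0 : ∀ t ∈ T, t ≠ 0 := by
    rintro t ⟨p, hp, r, hr, hpv, hrv, hpr, hf, rfl⟩ h
    refine hV.not_collinear hvV hp hr hpv hrv hpr
      ((inner ℝ f (r - v) : ℝ) / (inner ℝ f (p - v) : ℝ)) ?_
    rw [sub_eq_zero] at h
    rw [div_eq_inv_mul, mul_smul, ← h, smul_smul, inv_mul_cancel₀ hf, one_smul]
  obtain ⟨h, hh, hgen⟩ := exists_generic (isOpen_strict_max V v) (hV.exists_exposing hvV) hT h0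
  have hne : (V.erase (v : E3)).Nonempty := ⟨q, by
    rw [Finset.mem_erase]
    refine ⟨fun e => ?_, hq⟩
    simp [e] at hqv⟩
  obtain ⟨w, hw, hmax⟩ := Finset.exists_max_image (V.erase (v : E3))
    (fun p => (inner ℝ f (p - v) : ℝ) / -(inner ℝ h (p - v) : ℝ)) hne
  obtain ⟨hwv, hwV⟩ := Finset.mem_erase.1 hw
  have hqv' : q ≠ v := fun e => by simp [e] at hqv
  set M := (inner ℝ f (w - v) : ℝ) / -(inner ℝ h (w - v) : ℝ) with hM
  have hwneg := hh w hwV hwv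
  have hMw : (inner ℝ f (w - v) : ℝ) = M * -(inner ℝ h (w - v) : ℝ) := by
    rw [hM, div_mul_cancel₀]; linarith
  have hMpos : 0 < M := by
    refine lt_of_lt_of_le ?_ (hmax q (Finset.mem_erase.2 ⟨hqv', hq⟩))
    exact div_pos hqv (by have := hh q hq hqv'; linarith)
  have hfw : 0 < (inner ℝ f (w - v) : ℝ) := by
    rw [hMw]; exact mul_pos hMpos (by linarith)
  refine ⟨⟨w, hV.mem_iff.1 hwV⟩, ?_, hfw⟩
  rw [hV.adj_iff]
  refine ⟨hwv.symm, f + M • h, ?_, fun p hp hpv hpw => ?_⟩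
  · have : (inner ℝ (f + M • h) (w - v) : ℝ) = 0 := by
      rw [inner_add_left, inner_smul_left, hMw]; simp
    rw [inner_sub_right] at this
    exact sub_eq_zero.1 this
  · have hpneg := hh p hp hpv
    have hle : (inner ℝ f (p - v) : ℝ) ≤ M * -(inner ℝ h (p - v) : ℝ) := by
      have := hmax p (Finset.mem_erase.2 ⟨hpv, hp⟩)
      rwa [div_le_iff₀ (by linarith)] at this
    have hlt : (inner ℝ f (p - v) : ℝ) ≠ M * -(inner ℝ h (p - v) : ℝ) := by
      intro he
      refine hgen _ ⟨w, hwV, p, hp, hwv, hpv, Ne.symm hpw, hfw.ne', rfl⟩ ?_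
      rw [inner_sub_right, inner_smul_right, inner_smul_right, hMw, he]
      ring
    have h3 : (inner ℝ (f + M • h) (p - v) : ℝ) < 0 := by
      rw [inner_add_left, inner_smul_left]
      have := lt_of_le_of_ne hle hlt
      simp
      linarith
    rw [inner_sub_right] at h3
    exact sub_neg.1 h3

end HexGlue

end

noncomputable section

namespace HexGlue

open Set MeasureTheory

/-- The combinatorial properties of graphs of convex polyhedra that single out the ten graphs among
the graphs with at most six vertices: every vertex has three neighbours, there are no separating
pairs that leave two pairs of vertices, and neither `K₅` nor `K₃,₃` occurs. -/
structure Admissible {V : Type*} (G : SimpleGraph V) : Prop where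
  nonempty : Nonempty V
  deg : ∀ v a b : V, ∃ w, G.Adj v w ∧ w ≠ a ∧ w ≠ b
  not_complete : Nat.card V = 5 → ∃ a b, a ≠ b ∧ ¬ G.Adj a b
  no_cut : Nat.card V = 6 → ∀ a b c d : V, a ≠ b → c ≠ d → a ≠ c → a ≠ d → b ≠ c → b ≠ d →
    G.Adj a c ∨ G.Adj a d ∨ G.Adj b c ∨ G.Adj b d
  no_bipartite : Nat.card V = 6 → ∀ e : Fin 6 ≃ V, ∃ i j : Fin 3,
    ¬ G.Adj (e (Fin.castAdd 3 i)) (e (Fin.natAdd 3 j))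

theorem exists_ne_zero_orthogonal (x y : E3) :
    ∃ f : E3, f ≠ 0 ∧ inner ℝ f x = (0 : ℝ) ∧ inner ℝ f y = (0 : ℝ) := by
  classical
  have hlt : Module.finrank ℝ (Submodule.span ℝ ({x, y} : Set E3)) < 3 := by
    have := finrank_span_finset_le_card (R := ℝ) ({x, y} : Finset E3)
    have h2 : ({x, y} : Finset E3).card ≤ 2 := Finset.card_le_two
    simp only [Finset.coe_pair] at this
    change (Set.finrank ℝ ({x, y} : Set E3)) < 3
    omega
  have hne : (Submodule.span ℝ ({x, y} : Set E3))ᗮ ≠ ⊥ := by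
    intro h
    rw [Submodule.orthogonal_eq_bot_iff] at h
    rw [h, finrank_top] at hlt
    simp at hlt
  obtain ⟨f, hf, hf0⟩ := Submodule.exists_mem_ne_zero_of_ne_bot hne
  refine ⟨f, hf0, ?_, ?_⟩
  · exact Submodule.inner_left_of_mem_orthogonal (Submodule.subset_span (by simp)) hf
  · exact Submodule.inner_left_of_mem_orthogonal (Submodule.subset_span (by simp)) hf

namespace IsVertexSet

variable {V : Finset E3} {P : Set E3}

theorem vectorSpan_eq (hV : IsVertexSet V P) {v : E3} (hv : v ∈ V) :
    vectorSpan ℝ P = Submodule.span ℝ ((fun p => p - v) '' (V : Set E3)) := by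
  rw [hV.hull_eq, ← direction_affineSpan, affineSpan_convexHull, direction_affineSpan,
    vectorSpan_eq_span_vsub_set_right ℝ (Finset.mem_coe.2 hv)]
  simp

theorem exists_inner_ne (hV : IsVertexSet V P) (hd : dim P = 3) {v : E3} (hv : v ∈ V) {u : E3}
    (hu : u ≠ 0) : ∃ p ∈ V, inner ℝ u (p - v) ≠ (0 : ℝ) := by
  by_contra! hcon
  have htop : vectorSpan ℝ P = ⊤ := Submodule.eq_top_of_finrank_eq (by
    rw [show Module.finrank ℝ (vectorSpan ℝ P) = 3 from hd]; simp)
  have hle : vectorSpan ℝ P ≤ (ℝ ∙ u)ᗮ := by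
    rw [hV.vectorSpan_eq hv, Submodule.span_le]
    rintro _ ⟨p, hp, rfl⟩
    exact Submodule.mem_orthogonal_singleton_iff_inner_right.2 (hcon p hp)
  rw [htop, top_le_iff] at hle
  have : u ∈ (ℝ ∙ u)ᗮ := by rw [hle]; trivial
  rw [Submodule.mem_orthogonal_singleton_iff_inner_right] at this
  exact hu (inner_self_eq_zero.1 this)

/-- The functional can be chosen, up to sign, to increase along some edge at `v`. -/
theorem exists_adj_pos (hV : IsVertexSet V P) (hd : dim P = 3) (v : vertices P) {f : E3}
    (hf : f ≠ 0) : ∃ f' : E3, (f' = f ∨ f' = -f) ∧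
      ∃ w : vertices P, (skeleton P).Adj v w ∧ 0 < inner ℝ f' ((w : E3) - v) := by
  obtain ⟨p, hp, hne⟩ := hV.exists_inner_ne hd (hV.mem_iff.2 v.2) hf
  rcases lt_or_gt_of_ne hne with h | h
  · exact ⟨-f, Or.inr rfl, hV.exists_adj_lt v hp (by rw [inner_neg_left]; linarith)⟩
  · exact ⟨f, Or.inl rfl, hV.exists_adj_lt v hp h⟩

theorem exists_three_adj (hV : IsVertexSet V P) (hd : dim P = 3) (v a b : vertices P) :
    ∃ w, (skeleton P).Adj v w ∧ w ≠ a ∧ w ≠ b := by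
  obtain ⟨f, hf, h1, h2⟩ := exists_ne_zero_orthogonal ((a : E3) - v) ((b : E3) - v)
  obtain ⟨f', hf', w, hw, hpos⟩ := hV.exists_adj_pos hd v hf
  refine ⟨w, hw, ?_, ?_⟩ <;> rintro rfl <;> rcases hf' with rfl | rfl <;> simp_all

/-- An affine dependency between the vertices is positive at some vertex off any given edge. -/
theorem exists_dependency_pos (hV : IsVertexSet V P) {v w : vertices P}
    (hvw : (skeleton P).Adj v w) {c : E3 → ℝ} (h0 : ∑ p ∈ V, c p = 0)
    (h1 : ∑ p ∈ V, c p • p = 0) (hne : ∃ p ∈ V, c p ≠ 0) :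
    ∃ p ∈ V, p ≠ v ∧ p ≠ w ∧ 0 < c p := by
  classical
  by_contra! hcon
  obtain ⟨hvw', u, hu, hlt⟩ := hV.adj_iff.1 hvw
  have hvV : (v : E3) ∈ V := hV.mem_iff.2 v.2
  have hwV : (w : E3) ∈ V := hV.mem_iff.2 w.2
  have hsum : ∑ p ∈ V, c p * (inner ℝ u p - inner ℝ u (v : E3)) = 0 := by
    have : (inner ℝ u (∑ p ∈ V, c p • p) : ℝ) = ∑ p ∈ V, c p * inner ℝ u p := by
      rw [inner_sum]; simp [inner_smul_right]
    simp only [mul_sub, Finset.sum_sub_distrib, ← Finset.sum_mul, h0]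
    rw [← this, h1]; simp
  have hnn : ∀ p ∈ V, 0 ≤ c p * (inner ℝ u p - inner ℝ u (v : E3)) := by
    intro p hp
    by_cases hpv : p = v
    · simp [hpv]
    by_cases hpw : p = w
    · simp [hpw, hu]
    · exact mul_nonneg_of_nonpos_of_nonpos (hcon p hp hpv hpw) (by linarith [hlt p hp hpv hpw])
  have hz := (Finset.sum_eq_zero_iff_of_nonneg hnn).1 hsum
  have hzero : ∀ p ∈ V, p ≠ v → p ≠ w → c p = 0 := by
    intro p hp hpv hpw
    rcases mul_eq_zero.1 (hz p hp) with h | h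
    · exact h
    · linarith [hlt p hp hpv hpw]
  have hpair : ({(v : E3), (w : E3)} : Finset E3) ⊆ V := by
    intro x hx; simp at hx; rcases hx with rfl | rfl <;> assumption
  have s0 := Finset.sum_subset hpair (f := c) (fun p hp hn => by
    simp at hn; exact hzero p hp hn.1 hn.2)
  have s1 := Finset.sum_subset hpair (f := fun p => c p • p) (fun p hp hn => by
    simp only [Finset.mem_insert, Finset.mem_singleton, not_or] at hn
    simp [hzero p hp hn.1 hn.2])
  rw [h0, Finset.sum_pair hvw'] at s0
  rw [h1, Finset.sum_pair hvw'] at s1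
  have hcw : c w = - c v := by linarith
  rw [hcw] at s1
  have h4 : c v • ((v : E3) - w) = 0 := by rw [← s1]; module
  have hcv : c v = 0 := by
    rcases smul_eq_zero.1 h4 with h | h
    · exact h
    · exact absurd (sub_eq_zero.1 h) hvw'
  obtain ⟨p, hp, hpne⟩ := hne
  by_cases hpv : p = v
  · exact hpne (hpv ▸ hcv)
  by_cases hpw : p = w
  · exact hpne (by rw [hpw, hcw, hcv, neg_zero])
  · exact hpne (hzero p hp hpv hpw)

theorem exists_dependency_neg (hV : IsVertexSet V P) {v w : vertices P}
    (hvw : (skeleton P).Adj v w) {c : E3 → ℝ} (h0 : ∑ p ∈ V, c p = 0)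
    (h1 : ∑ p ∈ V, c p • p = 0) (hne : ∃ p ∈ V, c p ≠ 0) :
    ∃ p ∈ V, p ≠ v ∧ p ≠ w ∧ c p < 0 := by
  obtain ⟨p, hp, h, h', hlt⟩ := hV.exists_dependency_pos hvw (c := fun p => -c p)
    (by simp [h0]) (by simp [h1]) (by simpa using hne)
  exact ⟨p, hp, h, h', by linarith⟩

theorem exists_dependency (A : Finset E3) (hA : 4 < A.card) :
    ∃ c : E3 → ℝ, ∑ p ∈ A, c p = 0 ∧ ∑ p ∈ A, c p • p = 0 ∧ ∃ p ∈ A, c p ≠ 0 := by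
  obtain ⟨c, h1, h0, h⟩ := Module.exists_nontrivial_relation_sum_zero_of_finrank_succ_lt_card
    (R := ℝ) (t := A) (by simpa using hA)
  exact ⟨c, h0, h1, h⟩

theorem not_complete (hV : IsVertexSet V P) (hc : V.card = 5) :
    ∃ a b : vertices P, a ≠ b ∧ ¬ (skeleton P).Adj a b := by
  classical
  by_contra! hcon
  obtain ⟨c, h0, h1, hne⟩ := exists_dependency V (by omega)
  have pos : ∀ a b : vertices P, a ≠ b → ∃ p : vertices P, p ≠ a ∧ p ≠ b ∧ 0 < c p := by
    intro a b hab
    obtain ⟨p, hp, ha, hb, h⟩ := hV.exists_dependency_pos (hcon a b hab) h0 h1 hne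
    exact ⟨⟨p, hV.mem_iff.1 hp⟩, fun e => ha (e ▸ rfl), fun e => hb (e ▸ rfl), h⟩
  have neg : ∀ a b : vertices P, a ≠ b → ∃ p : vertices P, p ≠ a ∧ p ≠ b ∧ c p < 0 := by
    intro a b hab
    obtain ⟨p, hp, ha, hb, h⟩ := hV.exists_dependency_neg (hcon a b hab) h0 h1 hne
    exact ⟨⟨p, hV.mem_iff.1 hp⟩, fun e => ha (e ▸ rfl), fun e => hb (e ▸ rfl), h⟩
  obtain ⟨x, hx, y, hy, hxy⟩ := Finset.one_lt_card.1 (show 1 < V.card by omega)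
  let x' : vertices P := ⟨x, hV.mem_iff.1 hx⟩
  let y' : vertices P := ⟨y, hV.mem_iff.1 hy⟩
  have hxy' : x' ≠ y' := fun e => hxy (congrArg Subtype.val e)
  obtain ⟨p1, -, hp1y, p1pos⟩ := pos x' y' hxy'
  obtain ⟨p2, hp21, -, p2pos⟩ := pos p1 y' hp1y
  obtain ⟨p3, hp31, hp32, p3pos⟩ := pos p1 p2 hp21.symm
  obtain ⟨n1, -, hn1y, n1neg⟩ := neg x' y' hxy'
  obtain ⟨n2, hn21, -, n2neg⟩ := neg n1 y' hn1y
  obtain ⟨n3, hn31, hn32, n3neg⟩ := neg n1 n2 hn21.symm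
  have hpn : ∀ p n : vertices P, 0 < c p → c n < 0 → (p : E3) ≠ n := by
    intro p n hp hn e; rw [e] at hp; linarith
  have hsub : ({(p1 : E3), (p2 : E3), (p3 : E3), (n1 : E3), (n2 : E3), (n3 : E3)} : Finset E3)
      ⊆ V := by
    intro x hx
    simp only [Finset.mem_insert, Finset.mem_singleton] at hx
    rcases hx with rfl | rfl | rfl | rfl | rfl | rfl <;> exact hV.mem_iff.2 (Subtype.prop _)
  have hcard := Finset.card_le_card hsub
  have ne (a b : vertices P) (h : a ≠ b) : (a : E3) ≠ b := fun e => h (Subtype.ext e)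
  rw [Finset.card_insert_of_notMem (by simp [ne _ _ hp21.symm, ne _ _ hp31.symm, *]),
    Finset.card_insert_of_notMem (by simp [ne _ _ hp32.symm, *]),
    Finset.card_insert_of_notMem (by simp [*]),
    Finset.card_insert_of_notMem (by simp [ne _ _ hn21.symm, ne _ _ hn31.symm]),
    Finset.card_insert_of_notMem (by simp [ne _ _ hn32.symm]), Finset.card_singleton, hc] at hcard
  omega

theorem no_bipartite (hV : IsVertexSet V P) (e : Fin 6 ≃ vertices P) :
    ∃ i j : Fin 3, ¬ (skeleton P).Adj (e (Fin.castAdd 3 i)) (e (Fin.natAdd 3 j)) := by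
  classical
  by_contra! hadj
  have memV : ∀ i, (e i : E3) ∈ V := fun i => hV.mem_iff.2 (e i).2
  have cover : ∀ p ∈ V, ∃ i, p = e i := fun p hp =>
    ⟨e.symm ⟨p, hV.mem_iff.1 hp⟩, by simp⟩
  have inj : ∀ i j, (e i : E3) = e j → i = j := fun i j h => e.injective (Subtype.ext h)
  have hcard : V.card = 6 := by
    have h1 : V = Finset.univ.image fun i => (e i : E3) := by
      ext p
      constructor
      · intro hp
        obtain ⟨i, rfl⟩ := cover p hp
        simp
      · intro hp
        simp only [Finset.mem_image, Finset.mem_univ, true_and] at hp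
        obtain ⟨i, rfl⟩ := hp
        exact memV i
    rw [h1, Finset.card_image_of_injective _ fun i j h => inj i j h]
    simp
  have pos : ∀ c : E3 → ℝ, ∑ p ∈ V, c p = 0 → ∑ p ∈ V, c p • p = 0 → (∃ p ∈ V, c p ≠ 0) →
      ∀ i j : Fin 3, ∃ k : Fin 6, k ≠ Fin.castAdd 3 i ∧ k ≠ Fin.natAdd 3 j ∧ 0 < c (e k) := by
    intro c h0 h1 hne i j
    obtain ⟨p, hp, ha, hb, h⟩ := hV.exists_dependency_pos (hadj i j) h0 h1 hne
    obtain ⟨k, rfl⟩ := cover p hp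
    exact ⟨k, fun h => ha (by rw [h]), fun h => hb (by rw [h]), h⟩
  -- if a dependency vanishes at one vertex of the second class, it has the same sign at the others
  have key : ∀ c : E3 → ℝ, ∑ p ∈ V, c p = 0 → ∑ p ∈ V, c p • p = 0 → (∃ p ∈ V, c p ≠ 0) →
      ∀ j₁ j₂ j₃ : Fin 3, j₁ ≠ j₂ → j₁ ≠ j₃ → j₂ ≠ j₃ → c (e (Fin.natAdd 3 j₁)) = 0 →
      c (e (Fin.natAdd 3 j₂)) ≤ 0 → 0 ≤ c (e (Fin.natAdd 3 j₃)) → False := by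
    intro c h0 h1 hne j₁ j₂ j₃ h12 h13 h23 hz hle hge
    have two : ∀ c : E3 → ℝ, ∑ p ∈ V, c p = 0 → ∑ p ∈ V, c p • p = 0 → (∃ p ∈ V, c p ≠ 0) →
        ∀ j₁ j₂ j₃ : Fin 3, j₁ ≠ j₂ → j₁ ≠ j₃ → j₂ ≠ j₃ → c (e (Fin.natAdd 3 j₁)) = 0 →
        c (e (Fin.natAdd 3 j₂)) ≤ 0 →
        ∀ i : Fin 3, ∃ k : Fin 3, k ≠ i ∧ 0 < c (e (Fin.castAdd 3 k)) := by
      intro c h0 h1 hne j₁ j₂ j₃ h12 h13 h23 hz hle i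
      obtain ⟨k, hk1, hk2, hk⟩ := pos c h0 h1 hne i j₃
      induction k using Fin.addCases (m := 3) (n := 3) with
      | left k => exact ⟨k, fun h => hk1 (by rw [h]), hk⟩
      | right k =>
        have : k = j₁ ∨ k = j₂ ∨ k = j₃ := by omega
        rcases this with rfl | rfl | rfl
        · linarith
        · linarith
        · exact absurd rfl hk2
    have P := two c h0 h1 hne j₁ j₂ j₃ h12 h13 h23 hz hle
    have N := two (fun p => -c p) (by simp [h0]) (by simp [h1]) (by simpa using hne) j₁ j₃ j₂
      h13 h12 h23.symm (neg_eq_zero.2 hz) (neg_nonpos.2 hge)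
    obtain ⟨a, -, ha⟩ := P 0
    obtain ⟨b, hba, hb⟩ := P a
    obtain ⟨a', -, ha'⟩ := N 0
    obtain ⟨b', hba', hb'⟩ := N a'
    have n1 : a ≠ a' := by rintro rfl; linarith
    have n2 : a ≠ b' := by rintro rfl; linarith
    have n3 : b ≠ a' := by rintro rfl; linarith
    have n4 : b ≠ b' := by rintro rfl; linarith
    omega
  -- dependencies that vanish at one vertex of the second class
  have ex : ∀ j₁ j₂ j₃ : Fin 3, j₁ ≠ j₂ → j₁ ≠ j₃ → j₂ ≠ j₃ →
      ∃ c : E3 → ℝ, ∑ p ∈ V, c p = 0 ∧ ∑ p ∈ V, c p • p = 0 ∧ c (e (Fin.natAdd 3 j₁)) = 0 ∧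
        0 < c (e (Fin.natAdd 3 j₂)) ∧ 0 < c (e (Fin.natAdd 3 j₃)) := by
    intro j₁ j₂ j₃ h12 h13 h23
    obtain ⟨c, h0, h1, q, hq, hcq⟩ := exists_dependency (V.erase (e (Fin.natAdd 3 j₁)))
      (by rw [Finset.card_erase_of_mem (memV _), hcard]; norm_num)
    set b := (e (Fin.natAdd 3 j₁) : E3) with hb
    let c' : E3 → ℝ := fun p => if p = b then 0 else c p
    have s0 : ∑ p ∈ V, c' p = 0 := by
      rw [← Finset.add_sum_erase V _ (memV (Fin.natAdd 3 j₁)), ← hb]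
      simp only [c', if_true, zero_add]
      rw [← h0]
      exact Finset.sum_congr rfl fun p hp => by simp [Finset.ne_of_mem_erase hp]
    have s1 : ∑ p ∈ V, c' p • p = 0 := by
      rw [← Finset.add_sum_erase V _ (memV (Fin.natAdd 3 j₁)), ← hb]
      simp only [c', if_true, zero_add, zero_smul]
      rw [← h1]
      exact Finset.sum_congr rfl fun p hp => by simp [Finset.ne_of_mem_erase hp]
    have hne : ∃ p ∈ V, c' p ≠ 0 := ⟨q, Finset.mem_of_mem_erase hq, by
      simpa [c', Finset.ne_of_mem_erase hq] using hcq⟩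
    have hz : c' b = 0 := by simp [c']
    rcases lt_or_ge 0 (c' (e (Fin.natAdd 3 j₂))) with h2 | h2
    · refine ⟨c', s0, s1, hz, h2, ?_⟩
      by_contra! h3
      exact key c' s0 s1 hne j₁ j₃ j₂ h13 h12 h23.symm hz h3 h2.le
    · have h3 : c' (e (Fin.natAdd 3 j₃)) < 0 := by
        by_contra! h3
        exact key c' s0 s1 hne j₁ j₂ j₃ h12 h13 h23 hz h2 h3
      have h2' : c' (e (Fin.natAdd 3 j₂)) < 0 := by
        by_contra! h2'
        exact key c' s0 s1 hne j₁ j₃ j₂ h13 h12 h23.symm hz h3.le h2'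
      exact ⟨fun p => -c' p, by simp [s0], by simp [s1], neg_eq_zero.2 hz, by linarith, by linarith⟩
  obtain ⟨c₀, a0, a1, az, ap, aq⟩ := ex 0 1 2 (by decide) (by decide) (by decide)
  obtain ⟨c₁, b0, b1, bz, bp, bq⟩ := ex 1 0 2 (by decide) (by decide) (by decide)
  obtain ⟨c₂, d0, d1, dz, dp, dq⟩ := ex 2 0 1 (by decide) (by decide) (by decide)
  set p0 := (e (Fin.natAdd 3 (0 : Fin 3)) : E3)
  set p1 := (e (Fin.natAdd 3 (1 : Fin 3)) : E3)
  set p2 := (e (Fin.natAdd 3 (2 : Fin 3)) : E3)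
  let c : E3 → ℝ := fun p => c₂ p + (-(c₂ p1 / c₀ p1)) * c₀ p + (-(c₂ p0 / c₁ p0)) * c₁ p
  have z0 : c p0 = 0 := by simp only [c, az]; field_simp; ring
  have z1 : c p1 = 0 := by simp only [c, bz]; field_simp; ring
  have z2 : c p2 < 0 := by
    simp only [c, dz]
    have := mul_pos (div_pos dq ap) aq
    have := mul_pos (div_pos dp bp) bq
    linarith
  refine key c ?_ ?_ ⟨p2, memV _, z2.ne⟩ 0 1 2 (by decide) (by decide) (by decide) z0 z1.le ?_
  · simp only [c, Finset.sum_add_distrib, ← Finset.mul_sum, a0, b0, d0]; simp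
  · simp only [c, add_smul, mul_smul, Finset.sum_add_distrib, ← Finset.smul_sum, a1, b1, d1]; simp
  · by_contra! h
    exact key c (by simp only [c, Finset.sum_add_distrib, ← Finset.mul_sum, a0, b0, d0]; simp)
      (by simp only [c, add_smul, mul_smul, Finset.sum_add_distrib, ← Finset.smul_sum, a1, b1, d1];
          simp) ⟨p2, memV _, z2.ne⟩ 0 2 1 (by decide) (by decide) (by decide) z0 h.le z1.ge

/-- A generic functional that refines the order given by `f`. -/
theorem exists_generic_refinement (V : Finset E3) (f : E3) :
    ∃ g : E3, (∀ p ∈ V, ∀ q ∈ V, inner ℝ f (q - p) < 0 → inner ℝ g (q - p) < 0) ∧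
      ∀ p ∈ V, ∀ q ∈ V, p ≠ q → inner ℝ g (q - p) ≠ (0 : ℝ) := by
  let U : Set E3 := ⋂ p ∈ V, ⋂ q ∈ V, {g | inner ℝ f (q - p) < 0 → inner ℝ g (q - p) < 0}
  have hU : IsOpen U := by
    refine isOpen_biInter_finset fun p _ => isOpen_biInter_finset fun q _ => ?_
    by_cases h : (inner ℝ f (q - p) : ℝ) < 0
    · simp only [h, true_imp_iff]
      exact isOpen_lt (by fun_prop) continuous_const
    · simp [h]
  let T : Set E3 := {t | ∃ p ∈ V, ∃ q ∈ V, p ≠ q ∧ t = q - p}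
  have hT : T.Finite := by
    refine ((V ×ˢ V).finite_toSet.image fun x : E3 × E3 => x.2 - x.1).subset ?_
    rintro t ⟨p, hp, q, hq, -, rfl⟩
    exact ⟨(p, q), by simp [hp, hq], rfl⟩
  obtain ⟨g, hg, hgT⟩ := exists_generic (T := T) hU ⟨f, by simp [U]⟩ hT (by
    rintro t ⟨p, hp, q, hq, hpq, rfl⟩ h
    exact hpq (sub_eq_zero.1 h).symm)
  refine ⟨g, fun p hp q hq => ?_, fun p hp q hq hpq => hgT _ ⟨p, hp, q, hq, hpq, rfl⟩⟩
  simp only [U, mem_iInter] at hg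
  exact hg p hp q hq

theorem no_cut (hV : IsVertexSet V P) (hd : dim P = 3) (hc : V.card = 6) (a b c d : vertices P)
    (hab : a ≠ b) (hcd : c ≠ d) (hac : a ≠ c) (had : a ≠ d) (hbc : b ≠ c) (hbd : b ≠ d) :
    (skeleton P).Adj a c ∨ (skeleton P).Adj a d ∨ (skeleton P).Adj b c ∨
      (skeleton P).Adj b d := by
  classical
  by_contra! hcon
  obtain ⟨nac, nad, nbc, nbd⟩ := hcon
  have memV : ∀ x : vertices P, (x : E3) ∈ V := fun x => hV.mem_iff.2 x.2
  have ne {x y : vertices P} (h : x ≠ y) : (x : E3) ≠ y := fun e => h (Subtype.ext e)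
  obtain ⟨s, t, hst⟩ : ∃ s t : vertices P, ∀ x : vertices P,
      x = a ∨ x = b ∨ x = c ∨ x = d ∨ x = s ∨ x = t := by
    set R := V \ {(a : E3), (b : E3), (c : E3), (d : E3)} with hR
    have h4 : ({(a : E3), (b : E3), (c : E3), (d : E3)} : Finset E3).card = 4 := by
      rw [Finset.card_insert_of_notMem (by simp [ne hab, ne hac, ne had]),
        Finset.card_insert_of_notMem (by simp [ne hbc, ne hbd]),
        Finset.card_insert_of_notMem (by simp [ne hcd]), Finset.card_singleton]
    have hsub : ({(a : E3), (b : E3), (c : E3), (d : E3)} : Finset E3) ⊆ V := by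
      intro x hx
      simp only [Finset.mem_insert, Finset.mem_singleton] at hx
      rcases hx with rfl | rfl | rfl | rfl <;> exact memV _
    have hRc : R.card = 2 := by rw [hR, Finset.card_sdiff_of_subset hsub, hc, h4]
    obtain ⟨s, t, -, hst⟩ := Finset.card_eq_two.1 hRc
    have hs : s ∈ V := (Finset.mem_sdiff.1 (hR ▸ hst ▸ (by simp : s ∈ ({s, t} : Finset E3)))).1
    have ht : t ∈ V := (Finset.mem_sdiff.1 (hR ▸ hst ▸ (by simp : t ∈ ({s, t} : Finset E3)))).1
    refine ⟨⟨s, hV.mem_iff.1 hs⟩, ⟨t, hV.mem_iff.1 ht⟩, fun x => ?_⟩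
    by_contra! hx
    obtain ⟨h1, h2, h3, h4, h5, h6⟩ := hx
    have : (x : E3) ∈ R := by
      rw [hR, Finset.mem_sdiff]
      refine ⟨memV x, ?_⟩
      simp [ne h1, ne h2, ne h3, ne h4]
    rw [hst] at this
    simp only [Finset.mem_insert, Finset.mem_singleton] at this
    rcases this with h | h
    · exact h5 (Subtype.ext h)
    · exact h6 (Subtype.ext h)
  obtain ⟨f₀, hf₀, hs₀, ht₀⟩ := exists_ne_zero_orthogonal ((s : E3) - a) ((t : E3) - a)
  obtain ⟨f, hf, w, hw, hpos⟩ := hV.exists_adj_pos hd a hf₀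
  have hs : (inner ℝ f ((s : E3) - a) : ℝ) = 0 := by rcases hf with rfl | rfl <;> simp [hs₀]
  have ht : (inner ℝ f ((t : E3) - a) : ℝ) = 0 := by rcases hf with rfl | rfl <;> simp [ht₀]
  let F : vertices P → ℝ := fun x => inner ℝ f ((x : E3) - a)
  have hFa : F a = 0 := by simp [F]
  have hF : ∀ x y : vertices P, (inner ℝ f ((x : E3) - y) : ℝ) = F x - F y := by
    intro x y; simp only [F, ← inner_sub_right]; congr 1; abel
  have up : ∀ x y : vertices P, F x < F y → ∃ w, (skeleton P).Adj x w ∧ F x < F w := by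
    intro x y hxy
    obtain ⟨w, h1, h2⟩ := hV.exists_adj_lt x (f := f) (memV y) (by rw [hF]; linarith)
    exact ⟨w, h1, by rw [hF] at h2; linarith⟩
  have hb : 0 < F b := by
    rcases hst w with rfl | rfl | rfl | rfl | rfl | rfl
    · exact absurd hw (SimpleGraph.irrefl _)
    · exact hpos
    · exact absurd hw nac
    · exact absurd hw nad
    · linarith
    · linarith
  -- neither `c` nor `d` is below the plane
  have down : ∀ x, 0 ≤ F x := by
    intro x
    by_contra! hx
    obtain ⟨w, hw, hlt⟩ := hV.exists_adj_lt a (f := -f) (memV x) (by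
      rw [inner_neg_left, hF, hFa]; linarith)
    rw [inner_neg_left, hF, hFa] at hlt
    rcases hst w with rfl | rfl | rfl | rfl | rfl | rfl
    · exact absurd hw (SimpleGraph.irrefl _)
    · linarith
    · exact absurd hw nac
    · exact absurd hw nad
    · have : F w = 0 := hs
      linarith
    · have : F w = 0 := ht
      linarith
  obtain ⟨g, hg1, hg2⟩ := exists_generic_refinement V f
  let K : vertices P → ℝ := fun x => inner ℝ g ((x : E3) - a)
  have hK : ∀ x y : vertices P, (inner ℝ g ((x : E3) - y) : ℝ) = K x - K y := by
    intro x y; simp only [K, ← inner_sub_right]; congr 1; abel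
  have mono : ∀ x y, F x < F y → K x < K y := by
    intro x y hxy
    have := hg1 y (memV y) x (memV x) (by rw [hF]; linarith)
    rw [hK] at this; linarith
  have inj : ∀ x y, x ≠ y → K x ≠ K y := by
    intro x y hxy h
    exact hg2 y (memV y) x (memV x) (ne hxy.symm) (by rw [hK]; linarith)
  have upK : ∀ x y, K x < K y → ∃ w, (skeleton P).Adj x w ∧ K x < K w ∧ F x ≤ F w := by
    intro x y hxy
    obtain ⟨w, h1, h2⟩ := hV.exists_adj_lt x (f := g) (memV y) (by rw [hK]; linarith)
    rw [hK] at h2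
    refine ⟨w, h1, by linarith, ?_⟩
    by_contra! h
    linarith [mono _ _ h]
  have posOnly : ∀ w, 0 < F w → w = b ∨ w = c ∨ w = d := by
    intro w hw
    rcases hst w with rfl | rfl | rfl | rfl | rfl | rfl
    · linarith
    · exact Or.inl rfl
    · exact Or.inr (Or.inl rfl)
    · exact Or.inr (Or.inr rfl)
    · have : F w = 0 := hs
      linarith
    · have : F w = 0 := ht
      linarith
  -- `b` is the highest vertex
  have bc : K c < K b := by
    rcases lt_or_gt_of_ne (inj b c hbc) with h | h
    · obtain ⟨w, hw, h1, h2⟩ := upK b c h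
      rcases posOnly w (by linarith) with rfl | rfl | rfl
      · exact absurd hw (SimpleGraph.irrefl _)
      · exact absurd hw nbc
      · exact absurd hw nbd
    · exact h
  have bd : K d < K b := by
    rcases lt_or_gt_of_ne (inj b d hbd) with h | h
    · obtain ⟨w, hw, h1, h2⟩ := upK b d h
      rcases posOnly w (by linarith) with rfl | rfl | rfl
      · exact absurd hw (SimpleGraph.irrefl _)
      · exact absurd hw nbc
      · exact absurd hw nbd
    · exact h
  have main : ∀ x y : vertices P, K x < K y → K y < K b → (x = c ∧ y = d ∨ x = d ∧ y = c) →
      F y ≤ 0 := by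
    intro x y hxy hyb hcase
    by_contra! hy
    obtain ⟨w, hw, h1, h2⟩ := upK y b hyb
    rcases hcase with ⟨rfl, rfl⟩ | ⟨rfl, rfl⟩ <;>
    rcases posOnly w (by linarith) with rfl | rfl | rfl
    · exact nbd hw.symm
    · linarith
    · exact absurd hw (SimpleGraph.irrefl _)
    · exact nbc hw.symm
    · exact absurd hw (SimpleGraph.irrefl _)
    · linarith
  have zero : F c = 0 ∧ F d = 0 := by
    rcases lt_or_gt_of_ne (inj c d hcd) with h | h
    · have h1 := main c d h bd (Or.inl ⟨rfl, rfl⟩)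
      have h2 : F c ≤ 0 := by
        by_contra! h2
        linarith [mono d c (by linarith)]
      exact ⟨le_antisymm h2 (down c), le_antisymm h1 (down d)⟩
    · have h1 := main d c h bc (Or.inr ⟨rfl, rfl⟩)
      have h2 : F d ≤ 0 := by
        by_contra! h2
        linarith [mono c d (by linarith)]
      exact ⟨le_antisymm h1 (down c), le_antisymm h2 (down d)⟩
  obtain ⟨w, hw, h⟩ := up c b (by linarith [zero.1])
  rcases posOnly w (by linarith [zero.1]) with rfl | rfl | rfl
  · exact nbc hw.symm
  · exact absurd hw (SimpleGraph.irrefl _)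
  · linarith [zero.2, zero.1]

theorem card_eq (hV : IsVertexSet V P) : Nat.card (vertices P) = V.card := by
  rw [← hV.coe_eq]; simp

theorem admissible (hV : IsVertexSet V P) (hd : dim P = 3) : Admissible (skeleton P) where
  nonempty := by
    have hP : P.Nonempty := by
      by_contra h
      rw [not_nonempty_iff_eq_empty] at h
      rw [dim, h, vectorSpan_empty] at hd
      simp at hd
    obtain ⟨v, hv⟩ := hV.nonempty hP
    exact ⟨⟨v, hV.mem_iff.1 hv⟩⟩
  deg := hV.exists_three_adj hd
  not_complete h := hV.not_complete (by rw [← hV.card_eq, h])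
  no_cut h := hV.no_cut hd (by rw [← hV.card_eq, h])
  no_bipartite _ := hV.no_bipartite

end IsVertexSet

end HexGlue

end

noncomputable section

namespace HexGlue

/-! ### Classification of the admissible graphs -/

/-- Adjacency in the `k`-th graph, as a computable function on natural numbers. -/
def edgeTable (k : Fin 10) (i j : ℕ) : Bool :=
  i ≠ j && ((i, j) ∈ edges k || (j, i) ∈ edges k)

theorem polyGraph_adj {k : Fin 10} {i j : Fin (order k)} :
    (polyGraph k).Adj i j ↔ edgeTable k i j = true := by
  simp [polyGraph, edgeTable, Fin.ext_iff]

theorem nonempty_iso_of_table {m : ℕ} {G : SimpleGraph (Fin m)} {k : Fin 10} (hk : order k = m)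
    {p : Fin m → Fin m} (hp : Function.Injective p)
    (h : ∀ i j, G.Adj (p i) (p j) ↔ edgeTable k i j = true) :
    Nonempty (G ≃g polyGraph k) := by
  subst hk
  exact ⟨(⟨Equiv.ofBijective p (Finite.injective_iff_bijective.1 hp), by
    intro a b; rw [polyGraph_adj]; exact h a b⟩ : polyGraph k ≃g G).symm⟩

theorem Admissible.of_iso {V W : Type*} {G : SimpleGraph V} {H : SimpleGraph W} (φ : G ≃g H)
    (hG : Admissible G) : Admissible H where
  nonempty := hG.nonempty.map φ
  deg v a b := by
    obtain ⟨w, h1, h2, h3⟩ := hG.deg (φ.symm v) (φ.symm a) (φ.symm b)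
    refine ⟨φ w, ?_, ?_, ?_⟩
    · simpa using φ.map_adj_iff.2 h1
    · rintro rfl; simp at h2
    · rintro rfl; simp at h3
  not_complete h := by
    obtain ⟨a, b, h1, h2⟩ := hG.not_complete (by rw [Nat.card_congr φ.toEquiv, h])
    exact ⟨φ a, φ b, fun e => h1 (φ.injective e), fun e => h2 (φ.map_adj_iff.1 e)⟩
  no_cut h a b c d h1 h2 h3 h4 h5 h6 := by
    have inj {x y : W} (hxy : x ≠ y) : φ.symm x ≠ φ.symm y := fun e => hxy (φ.symm.injective e)
    have := hG.no_cut (by rw [Nat.card_congr φ.toEquiv, h]) (φ.symm a) (φ.symm b) (φ.symm c)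
      (φ.symm d) (inj h1) (inj h2) (inj h3) (inj h4) (inj h5) (inj h6)
    simpa [φ.symm.map_adj_iff] using this
  no_bipartite h e := by
    obtain ⟨i, j, hij⟩ := hG.no_bipartite (by rw [Nat.card_congr φ.toEquiv, h])
      (e.trans φ.symm.toEquiv)
    exact ⟨i, j, fun hn => hij (by simpa [φ.symm.map_adj_iff] using hn)⟩

theorem Admissible.comap_perm {m : ℕ} {G : SimpleGraph (Fin m)} (hG : Admissible G)
    (σ : Equiv.Perm (Fin m)) : Admissible (G.comap σ) :=
  hG.of_iso (SimpleGraph.Iso.comap σ G).symm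

theorem exists_iso_of_comap {m : ℕ} {G : SimpleGraph (Fin m)} (σ : Equiv.Perm (Fin m))
    (h : ∃ k, Nonempty (G.comap σ ≃g polyGraph k)) : ∃ k, Nonempty (G ≃g polyGraph k) := by
  obtain ⟨k, ⟨φ⟩⟩ := h
  exact ⟨k, ⟨(SimpleGraph.Iso.comap σ G).symm.trans φ⟩⟩

theorem exists_perm_eq {m n : ℕ} (x y : Fin n ↪ Fin m) :
    ∃ σ : Equiv.Perm (Fin m), ∀ i, σ (x i) = y i := by
  obtain ⟨g, hg⟩ := (Equiv.Perm.isMultiplyPretransitive (Fin m) n).exists_smul_eq x y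
  exact ⟨g, fun i => by rw [← hg]; rfl⟩

namespace Admissible

theorem adj_of_four {G : SimpleGraph (Fin 4)} (hG : Admissible G) {a b : Fin 4} (hab : a ≠ b) :
    G.Adj a b := by
  obtain ⟨c, d, h⟩ : ∃ c d : Fin 4, ∀ w, w ≠ a → w ≠ b → w = c ∨ w = d := by
    revert a b; decide
  obtain ⟨w, hw, h1, h2⟩ := hG.deg a c d
  by_cases hwb : w = b
  · exact hwb ▸ hw
  · rcases h w hw.ne' hwb with h | h <;> contradiction

theorem adj_of_five {G : SimpleGraph (Fin 5)} (hG : Admissible G) {v a b : Fin 5} (ha : v ≠ a)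
    (hb : v ≠ b) (hab : a ≠ b) : G.Adj v a ∨ G.Adj v b := by
  obtain ⟨c, d, h⟩ : ∃ c d : Fin 5, ∀ w, w ≠ v → w ≠ a → w ≠ b → w = c ∨ w = d := by
    revert v a b; decide
  obtain ⟨w, hw, h1, h2⟩ := hG.deg v c d
  by_cases hwa : w = a
  · exact Or.inl (hwa ▸ hw)
  by_cases hwb : w = b
  · exact Or.inr (hwb ▸ hw)
  · rcases h w hw.ne' hwa hwb with h | h <;> contradiction

theorem adj_of_six {G : SimpleGraph (Fin 6)} (hG : Admissible G) {v a b c : Fin 6} (ha : v ≠ a)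
    (hb : v ≠ b) (hc : v ≠ c) (hab : a ≠ b) (hac : a ≠ c) (hbc : b ≠ c) :
    G.Adj v a ∨ G.Adj v b ∨ G.Adj v c := by
  obtain ⟨x, y, h⟩ : ∃ x y : Fin 6, ∀ w, w ≠ v → w ≠ a → w ≠ b → w ≠ c → w = x ∨ w = y := by
    revert v a b c; decide +kernel
  obtain ⟨w, hw, h1, h2⟩ := hG.deg v x y
  by_cases hwa : w = a
  · exact Or.inl (hwa ▸ hw)
  by_cases hwb : w = b
  · exact Or.inr (Or.inl (hwb ▸ hw))
  by_cases hwc : w = c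
  · exact Or.inr (Or.inr (hwc ▸ hw))
  · rcases h w hw.ne' hwa hwb hwc with h | h <;> contradiction

/-- The graphs with five vertices in which `0` and `1` are the only non-adjacent pair that meets
`{0, 1}`. -/
def fiveTable (x y z : Bool) (i j : Fin 5) : Bool :=
  ![![false, false, true, true, true], ![false, false, true, true, true],
    ![true, true, false, x, y], ![true, true, x, false, z], ![true, true, y, z, false]] i j

theorem exists_fiveTable : ∀ x y z : Bool, (x || y) → (x || z) → (y || z) →
    ∃ c ∈ ([(2, ![0, 2, 1, 3, 4]), (2, ![0, 2, 1, 4, 3]), (2, ![0, 3, 1, 4, 2]),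
      (1, ![2, 3, 4, 0, 1])] : List (Fin 10 × (Fin 5 → Fin 5))),
      order c.1 = 5 ∧ Function.Injective c.2 ∧
      ∀ i j, fiveTable x y z (c.2 i) (c.2 j) = edgeTable c.1 i j := by
  decide +kernel

/-- The graphs with six vertices whose complement contains the path `0, 1, 2, 3`, whose inner
vertices have no other neighbours in the complement. -/
def pathTable (x y z w t : Bool) (i j : Fin 6) : Bool :=
  ![![false, false, true, true, x, y], ![false, false, false, true, true, true],
    ![true, false, false, false, true, true], ![true, true, false, false, z, w],
    ![x, true, true, z, false, t], ![y, true, true, w, t, false]] i j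

theorem exists_pathTable : ∀ x y z w t : Bool, (x || y) → (z || w) → (x || z || t) →
    (y || w || t) →
    ∃ c ∈ ([(6, ![0, 2, 4, 1, 3, 5]), (5, ![0, 2, 5, 3, 4, 1]), (7, ![4, 5, 0, 3, 1, 2]),
      (7, ![3, 5, 2, 4, 1, 0]), (8, ![5, 3, 4, 2, 0, 1]), (5, ![0, 2, 4, 3, 5, 1]),
      (7, ![4, 5, 3, 0, 2, 1]), (6, ![0, 2, 5, 1, 3, 4]), (7, ![3, 4, 2, 5, 1, 0]),
      (8, ![4, 3, 5, 2, 0, 1]), (7, ![0, 5, 1, 4, 2, 3]), (8, ![5, 0, 4, 1, 3, 2]),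
      (7, ![0, 4, 1, 5, 2, 3]), (8, ![4, 0, 5, 1, 3, 2]), (9, ![4, 5, 0, 3, 1, 2]),
      (4, ![4, 5, 1, 3, 0, 2])] : List (Fin 10 × (Fin 6 → Fin 6))),
      order c.1 = 6 ∧ Function.Injective c.2 ∧
      ∀ i j, pathTable x y z w t (c.2 i) (c.2 j) = edgeTable c.1 i j := by
  decide +kernel

theorem exists_iso_four {G : SimpleGraph (Fin 4)} (hG : Admissible G) :
    ∃ k, Nonempty (G ≃g polyGraph k) := by
  refine ⟨0, nonempty_iso_of_table rfl Function.injective_id fun i j => ?_⟩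
  have h1 : ∀ i j : Fin 4, edgeTable 0 i j = true ↔ i ≠ j := by decide
  rw [h1]
  exact ⟨fun h => h.ne, fun h => hG.adj_of_four h⟩

theorem exists_iso_five {G : SimpleGraph (Fin 5)} (hG : Admissible G) :
    ∃ k, Nonempty (G ≃g polyGraph k) := by
  classical
  obtain ⟨a, b, hab, hn⟩ := hG.not_complete (by simp)
  obtain ⟨σ, hσ⟩ := exists_perm_eq (m := 5) ⟨![0, 1], by decide⟩
    ⟨![a, b], by intro i j; fin_cases i <;> fin_cases j <;> simp [hab, hab.symm]⟩
  have h0 : σ 0 = a := hσ 0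
  have h1 : σ 1 = b := hσ 1
  apply exists_iso_of_comap σ
  have hG := hG.comap_perm σ
  have hn : ¬ (G.comap σ).Adj 0 1 := by simpa [h0, h1] using hn
  generalize G.comap σ = G at hG hn
  have a02 := (hG.adj_of_five (v := 0) (a := 1) (b := 2) (by decide) (by decide)
    (by decide)).resolve_left hn
  have a03 := (hG.adj_of_five (v := 0) (a := 1) (b := 3) (by decide) (by decide)
    (by decide)).resolve_left hn
  have a04 := (hG.adj_of_five (v := 0) (a := 1) (b := 4) (by decide) (by decide)
    (by decide)).resolve_left hn
  rw [SimpleGraph.adj_comm] at hn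
  have a12 := (hG.adj_of_five (v := 1) (a := 0) (b := 2) (by decide) (by decide)
    (by decide)).resolve_left hn
  have a13 := (hG.adj_of_five (v := 1) (a := 0) (b := 3) (by decide) (by decide)
    (by decide)).resolve_left hn
  have a14 := (hG.adj_of_five (v := 1) (a := 0) (b := 4) (by decide) (by decide)
    (by decide)).resolve_left hn
  have c1 := hG.adj_of_five (v := 2) (a := 3) (b := 4) (by decide) (by decide) (by decide)
  have c2 := hG.adj_of_five (v := 3) (a := 2) (b := 4) (by decide) (by decide) (by decide)
  have c3 := hG.adj_of_five (v := 4) (a := 2) (b := 3) (by decide) (by decide) (by decide)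
  obtain ⟨c, -, hc, hinj, htab⟩ := exists_fiveTable (decide (G.Adj 2 3)) (decide (G.Adj 2 4))
    (decide (G.Adj 3 4)) (by simpa using c1) (by simpa [G.adj_comm] using c2)
    (by simpa [G.adj_comm] using c3)
  refine ⟨c.1, nonempty_iso_of_table hc hinj fun i j => ?_⟩
  rw [← htab]
  generalize c.2 i = i
  generalize c.2 j = j
  fin_cases i <;> fin_cases j <;>
    simp [fiveTable, a02, a02.symm, a03, a03.symm, a04, a04.symm, a12, a12.symm, a13, a13.symm,
      a14, a14.symm, hn, mt SimpleGraph.Adj.symm hn] <;>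
    exact G.adj_comm _ _

/-- The case in which the complement contains the path `0, 1, 2, 3`. -/
theorem exists_iso_six_of_path {G : SimpleGraph (Fin 6)} (hG : Admissible G)
    (n01 : ¬ G.Adj 0 1) (n12 : ¬ G.Adj 1 2) (n23 : ¬ G.Adj 2 3) :
    ∃ k, Nonempty (G ≃g polyGraph k) := by
  classical
  have n10 := mt SimpleGraph.Adj.symm n01
  have n21 := mt SimpleGraph.Adj.symm n12
  have n32 := mt SimpleGraph.Adj.symm n23
  have inner (v a b c : Fin 6) (ha : ¬ G.Adj v a) (hb : ¬ G.Adj v b)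
      (hd : v ≠ a ∧ v ≠ b ∧ v ≠ c ∧ a ≠ b ∧ a ≠ c ∧ b ≠ c) : G.Adj v c :=
    ((hG.adj_of_six hd.1 hd.2.1 hd.2.2.1 hd.2.2.2.1 hd.2.2.2.2.1 hd.2.2.2.2.2).resolve_left
      ha).resolve_left hb
  have a13 := inner 1 0 2 3 n10 n12 (by decide)
  have a14 := inner 1 0 2 4 n10 n12 (by decide)
  have a15 := inner 1 0 2 5 n10 n12 (by decide)
  have a20 := inner 2 1 3 0 n21 n23 (by decide)
  have a24 := inner 2 1 3 4 n21 n23 (by decide)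
  have a25 := inner 2 1 3 5 n21 n23 (by decide)
  have a03 : G.Adj 0 3 := by
    by_contra n03
    rcases hG.no_cut (by simp) 0 2 1 3 (by decide) (by decide) (by decide) (by decide)
      (by decide) (by decide) with h | h | h | h <;> contradiction
  have c1 : G.Adj 0 4 ∨ G.Adj 0 5 := (hG.adj_of_six (v := 0) (a := 1) (b := 4) (c := 5)
    (by decide) (by decide) (by decide) (by decide) (by decide) (by decide)).resolve_left n01
  have c2 : G.Adj 3 4 ∨ G.Adj 3 5 := (hG.adj_of_six (v := 3) (a := 2) (b := 4) (c := 5)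
    (by decide) (by decide) (by decide) (by decide) (by decide) (by decide)).resolve_left n32
  have c3 := hG.adj_of_six (v := 4) (a := 0) (b := 3) (c := 5)
    (by decide) (by decide) (by decide) (by decide) (by decide) (by decide)
  have c4 := hG.adj_of_six (v := 5) (a := 0) (b := 3) (c := 4)
    (by decide) (by decide) (by decide) (by decide) (by decide) (by decide)
  obtain ⟨c, -, hc, hinj, htab⟩ := exists_pathTable (decide (G.Adj 0 4)) (decide (G.Adj 0 5))
    (decide (G.Adj 3 4)) (decide (G.Adj 3 5)) (decide (G.Adj 4 5)) (by simpa using c1)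
    (by simpa using c2)
    (by simpa [G.adj_comm, or_assoc] using c3) (by simpa [G.adj_comm, or_assoc] using c4)
  refine ⟨c.1, nonempty_iso_of_table hc hinj fun i j => ?_⟩
  rw [← htab]
  generalize c.2 i = i
  generalize c.2 j = j
  fin_cases i <;> fin_cases j <;>
    simp [pathTable, a13, a13.symm, a14, a14.symm, a15, a15.symm, a20, a20.symm, a24, a24.symm,
      a25, a25.symm, a03, a03.symm, n01, n12, n23, n10, n21, n32] <;>
    exact G.adj_comm _ _

/-- The case in which the complement contains the path `0, 1, 2`. -/
theorem exists_iso_six_of_path_two {G : SimpleGraph (Fin 6)} (hG : Admissible G)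
    (n01 : ¬ G.Adj 0 1) (n12 : ¬ G.Adj 1 2) : ∃ k, Nonempty (G ≃g polyGraph k) := by
  obtain ⟨i, j, hij⟩ := hG.no_bipartite (by simp) (Equiv.refl _)
  simp only [Equiv.refl_apply] at hij
  have hj : ∀ j : Fin 3, Fin.natAdd 3 j ≠ (0 : Fin 6) ∧ Fin.natAdd 3 j ≠ (1 : Fin 6) ∧
      Fin.natAdd 3 j ≠ (2 : Fin 6) := by decide
  obtain ⟨hj0, hj1, hj2⟩ := hj j
  generalize (Fin.natAdd 3 j : Fin 6) = x at *
  have hi : (Fin.castAdd 3 i : Fin 6) = 0 ∨ (Fin.castAdd 3 i : Fin 6) = 1 ∨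
    (Fin.castAdd 3 i : Fin 6) = 2 := by clear hij; revert i; decide
  rcases hi with h | h | h <;> rw [h] at hij
  · obtain ⟨σ, hσ⟩ := exists_perm_eq (m := 6) ⟨![0, 1, 2, 3], by decide⟩
      ⟨![x, 0, 1, 2], by
        intro i j; fin_cases i <;> fin_cases j <;> simp [*, Ne.symm hj0, Ne.symm hj1, Ne.symm hj2]⟩
    have h0 : σ 0 = x := hσ 0
    have h1 : σ 1 = 0 := hσ 1
    have h2 : σ 2 = 1 := hσ 2
    have h3 : σ 3 = 2 := hσ 3
    exact exists_iso_of_comap σ (exists_iso_six_of_path (hG.comap_perm σ)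
      (by simpa [h0, h1, G.adj_comm] using hij) (by simpa [h1, h2] using n01)
      (by simpa [h2, h3] using n12))
  · rcases hG.adj_of_six (v := 1) (a := 0) (b := 2) (c := x) (by decide) (by decide)
      (Ne.symm hj1) (by decide) (Ne.symm hj0) (Ne.symm hj2) with h | h | h
    · exact absurd h.symm n01
    · exact absurd h n12
    · exact absurd h hij
  · obtain ⟨σ, hσ⟩ := exists_perm_eq (m := 6) ⟨![0, 1, 2, 3], by decide⟩
      ⟨![0, 1, 2, x], by
        intro i j; fin_cases i <;> fin_cases j <;> simp [*, Ne.symm hj0, Ne.symm hj1, Ne.symm hj2]⟩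
    have h0 : σ 0 = 0 := hσ 0
    have h1 : σ 1 = 1 := hσ 1
    have h2 : σ 2 = 2 := hσ 2
    have h3 : σ 3 = x := hσ 3
    exact exists_iso_of_comap σ (exists_iso_six_of_path (hG.comap_perm σ)
      (by simpa [h0, h1] using n01) (by simpa [h1, h2] using n12)
      (by simpa [h2, h3] using hij))

theorem exists_iso_six {G : SimpleGraph (Fin 6)} (hG : Admissible G) :
    ∃ k, Nonempty (G ≃g polyGraph k) := by
  by_cases hpath : ∃ a b c, a ≠ b ∧ a ≠ c ∧ b ≠ c ∧ ¬ G.Adj a b ∧ ¬ G.Adj b c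
  · obtain ⟨a, b, c, hab, hac, hbc, n1, n2⟩ := hpath
    obtain ⟨σ, hσ⟩ := exists_perm_eq (m := 6) ⟨![0, 1, 2], by decide⟩
      ⟨![a, b, c], by
        intro i j; fin_cases i <;> fin_cases j <;> simp [*, hab.symm, hac.symm, hbc.symm]⟩
    have h0 : σ 0 = a := hσ 0
    have h1 : σ 1 = b := hσ 1
    have h2 : σ 2 = c := hσ 2
    exact exists_iso_of_comap σ (exists_iso_six_of_path_two (hG.comap_perm σ)
      (by simpa [h0, h1] using n1) (by simpa [h1, h2] using n2))
  push Not at hpath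
  -- the complement is a matching
  have cross : ∀ i j : Fin 3, (Fin.castAdd 3 i : Fin 6) ≠ Fin.natAdd 3 j := by decide
  obtain ⟨i, j, hij⟩ := hG.no_bipartite (by simp) (Equiv.refl _)
  have hcross := cross i j
  simp only [Equiv.refl_apply] at hij
  generalize (Fin.castAdd 3 i : Fin 6) = a at *
  generalize (Fin.natAdd 3 j : Fin 6) = b at *
  obtain ⟨σ, hσ⟩ := exists_perm_eq (m := 6) ⟨![0, 1], by decide⟩
    ⟨![a, b], by
      intro x y; fin_cases x <;> fin_cases y <;> simp [hcross, hcross.symm]⟩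
  apply exists_iso_of_comap σ
  have hG := hG.comap_perm σ
  have n01 : ¬ (G.comap σ).Adj 0 1 := by
    have h0 : σ 0 = a := hσ 0
    have h1 : σ 1 = b := hσ 1
    simpa [h0, h1] using hij
  have hpath : ∀ a b c, a ≠ b → a ≠ c → b ≠ c → ¬ (G.comap σ).Adj a b → (G.comap σ).Adj b c :=
    fun a b c h1 h2 h3 => hpath _ _ _ (σ.injective.ne h1) (σ.injective.ne h2) (σ.injective.ne h3)
  generalize G.comap σ = G at hG n01 hpath
  have n10 := mt SimpleGraph.Adj.symm n01
  obtain ⟨i, j, hij⟩ := hG.no_bipartite (by simp) (Equiv.refl _)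
  have hj : ∀ j : Fin 3, Fin.natAdd 3 j ≠ (0 : Fin 6) ∧ Fin.natAdd 3 j ≠ (1 : Fin 6) ∧
      Fin.natAdd 3 j ≠ (2 : Fin 6) := by decide
  obtain ⟨hj0, hj1, hj2⟩ := hj j
  simp only [Equiv.refl_apply] at hij
  generalize (Fin.natAdd 3 j : Fin 6) = x at *
  have hi : (Fin.castAdd 3 i : Fin 6) = 2 := by
    have : (Fin.castAdd 3 i : Fin 6) = 0 ∨ (Fin.castAdd 3 i : Fin 6) = 1 ∨
      (Fin.castAdd 3 i : Fin 6) = 2 := by clear hij; revert i; decide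
    rcases this with h | h | h
    · rw [h] at hij
      exact absurd (hpath 1 0 x (by decide) (Ne.symm hj1) (Ne.symm hj0) n10) hij
    · rw [h] at hij
      exact absurd (hpath 0 1 x (by decide) (Ne.symm hj0) (Ne.symm hj1) n01) hij
    · exact h
  rw [hi] at hij
  obtain ⟨σ, hσ⟩ := exists_perm_eq (m := 6) ⟨![0, 1, 2, 3], by decide⟩
    ⟨![0, 1, 2, x], by
      intro i j; fin_cases i <;> fin_cases j <;> simp [*, Ne.symm hj0, Ne.symm hj1, Ne.symm hj2]⟩
  have h0 : σ 0 = 0 := hσ 0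
  have h1 : σ 1 = 1 := hσ 1
  have h2 : σ 2 = 2 := hσ 2
  have h3 : σ 3 = x := hσ 3
  apply exists_iso_of_comap σ
  have hG := hG.comap_perm σ
  have n01 : ¬ (G.comap σ).Adj 0 1 := by simpa [h0, h1] using n01
  have n23 : ¬ (G.comap σ).Adj 2 3 := by simpa [h2, h3] using hij
  have hpath : ∀ a b c, a ≠ b → a ≠ c → b ≠ c → ¬ (G.comap σ).Adj a b → (G.comap σ).Adj b c :=
    fun a b c h1 h2 h3 => hpath _ _ _ (σ.injective.ne h1) (σ.injective.ne h2) (σ.injective.ne h3)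
  generalize G.comap σ = G at hG n01 n23 hpath
  have n10 := mt SimpleGraph.Adj.symm n01
  have n32 := mt SimpleGraph.Adj.symm n23
  have far (a b : Fin 6) (hn : ¬ G.Adj a b) (hab : a ≠ b) (c : Fin 6) (hc : a ≠ c ∧ b ≠ c) :
      G.Adj b c := hpath a b c hab hc.1 hc.2 hn
  have n45 : ¬ G.Adj 4 5 := by
    obtain ⟨i, j, hij⟩ := hG.no_bipartite (by simp)
      (Equiv.ofBijective ![0, 1, 4, 2, 3, 5] (by decide))
    intro h45
    fin_cases i <;> fin_cases j <;> simp at hij <;>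
      first
      | exact hij (far 1 0 n10 (by decide) _ (by decide))
      | exact hij (far 0 1 n01 (by decide) _ (by decide))
      | exact hij (far 3 2 n32 (by decide) _ (by decide)).symm
      | exact hij (far 2 3 n23 (by decide) _ (by decide)).symm
      | exact hij h45
  have n54 := mt SimpleGraph.Adj.symm n45
  refine ⟨3, nonempty_iso_of_table rfl Function.injective_id fun i j => ?_⟩
  simp only [id]
  have hne : ∀ i j : Fin 6, edgeTable 3 i j = true ∨ i = j ∨ (i = 0 ∧ j = 1) ∨ (i = 1 ∧ j = 0) ∨
      (i = 2 ∧ j = 3) ∨ (i = 3 ∧ j = 2) ∨ (i = 4 ∧ j = 5) ∨ (i = 5 ∧ j = 4) := by decide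
  constructor
  · intro h
    rcases hne i j with h' | rfl | ⟨rfl, rfl⟩ | ⟨rfl, rfl⟩ | ⟨rfl, rfl⟩ | ⟨rfl, rfl⟩ | ⟨rfl, rfl⟩ |
      ⟨rfl, rfl⟩
    · exact h'
    · exact absurd h (SimpleGraph.irrefl _)
    all_goals contradiction
  · have hpair : ∀ i j : Fin 6, edgeTable 3 i j = true → ∃ a ∈ [((0 : Fin 6), (1 : Fin 6)), (1, 0),
        (2, 3), (3, 2), (4, 5), (5, 4)], a.2 = i ∧ a.1 ≠ a.2 ∧ a.1 ≠ j ∧ a.2 ≠ j := by decide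
    intro h
    obtain ⟨⟨a, b⟩, ha, rfl, h1, h2, h3⟩ := hpair i j h
    refine far a b ?_ h1 j ⟨h2, h3⟩
    simp only [List.mem_cons, Prod.mk.injEq, List.not_mem_nil, or_false] at ha
    rcases ha with ⟨rfl, rfl⟩ | ⟨rfl, rfl⟩ | ⟨rfl, rfl⟩ | ⟨rfl, rfl⟩ | ⟨rfl, rfl⟩ | ⟨rfl, rfl⟩ <;>
      assumption

theorem exists_iso {V : Type*} [Finite V] {G : SimpleGraph V} (hG : Admissible G)
    (hcard : Nat.card V ≤ 6) : ∃ k, Nonempty (G ≃g polyGraph k) := by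
  obtain ⟨m, ⟨e⟩⟩ := Finite.exists_equiv_fin V
  rw [Nat.card_congr e, Nat.card_fin] at hcard
  let φ : G ≃g G.comap e.symm := (SimpleGraph.Iso.comap e.symm G).symm
  have hH := hG.of_iso φ
  have key : ∃ k, Nonempty (G.comap e.symm ≃g polyGraph k) := by
    generalize G.comap e.symm = H at hH
    clear φ
    have h4 : 4 ≤ m := by
      obtain ⟨v⟩ := hH.nonempty
      obtain ⟨a, ha, -, -⟩ := hH.deg v v v
      obtain ⟨b, hb, hba, -⟩ := hH.deg v a a
      obtain ⟨c, hc, hca, hcb⟩ := hH.deg v a b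
      have := Finset.card_le_univ ({v, a, b, c} : Finset (Fin m))
      rw [Finset.card_insert_of_notMem (by simp [ha.ne, hb.ne, hc.ne]),
        Finset.card_insert_of_notMem (by simp [hba.symm, hca.symm]),
        Finset.card_insert_of_notMem (by simp [hcb.symm])] at this
      simpa using this
    obtain rfl | rfl | rfl : m = 4 ∨ m = 5 ∨ m = 6 := by omega
    · exact hH.exists_iso_four
    · exact hH.exists_iso_five
    · exact hH.exists_iso_six
  obtain ⟨k, ⟨ψ⟩⟩ := key
  exact ⟨k, ⟨φ.trans ψ⟩⟩

end Admissible

end HexGlue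

end

noncomputable section

namespace HexGlue

/-! ### Planar 3-connected graphs are admissible -/

section Planar

variable {V : Type*} {G : SimpleGraph V} {σ : Equiv.Perm G.Dart}

/-- The permutation whose orbits are the faces of a rotation system. -/
def facePerm (σ : Equiv.Perm G.Dart) : Equiv.Perm G.Dart :=
  σ * SimpleGraph.Dart.symm_involutive.toPerm

theorem facePerm_apply (d : G.Dart) : facePerm σ d = σ d.symm := rfl

theorem IsRotation.fst_apply (hσ : IsRotation σ) (d : G.Dart) : (σ d).fst = d.fst :=
  (hσ (σ d) d).1 (Equiv.Perm.sameCycle_apply_left.2 (Equiv.Perm.SameCycle.refl _ _))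

theorem IsRotation.fst_facePerm (hσ : IsRotation σ) (d : G.Dart) :
    (facePerm σ d).fst = d.snd := by
  rw [facePerm_apply, hσ.fst_apply]; rfl

theorem IsRotation.facePerm_ne (hσ : IsRotation σ) (d : G.Dart) : facePerm σ d ≠ d := by
  intro h
  have := hσ.fst_facePerm d
  rw [h] at this
  exact d.adj.ne this

theorem IsRotation.facePerm_facePerm_ne (hσ : IsRotation σ) (hdeg : ∀ v a, ∃ w, G.Adj v w ∧ w ≠ a)
    (d : G.Dart) : facePerm σ (facePerm σ d) ≠ d := by
  intro h
  have h1 := hσ.fst_facePerm d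
  have h2 := hσ.fst_facePerm (facePerm σ d)
  rw [h] at h2
  have h3 : facePerm σ d = d.symm := by
    ext
    · exact h1
    · exact h2.symm
  rw [facePerm_apply] at h3
  obtain ⟨w, hw, hne⟩ := hdeg d.snd d.fst
  have h4 := (hσ d.symm ⟨(d.snd, w), hw⟩).2 rfl
  exact hne (congrArg (fun d => d.snd) (h4.eq_of_left h3)).symm

/-- If every face carries at least the weight `c`, the number of faces is bounded by the total
weight. -/
theorem mul_numFaces_le [Fintype G.Dart] (w : G.Dart → ℕ) (c : ℕ)
    (h : ∀ d, ∃ s : Finset G.Dart, (∀ x ∈ s, (facePerm σ).SameCycle d x) ∧ c ≤ ∑ x ∈ s, w x) :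
    c * numFaces σ ≤ ∑ d, w d := by
  classical
  let Q := Quotient (Equiv.Perm.SameCycle.setoid (facePerm σ))
  have : Fintype Q := Fintype.ofFinite _
  have hQ : numFaces σ = Fintype.card Q := @Nat.card_eq_fintype_card Q this
  rw [hQ, ← Finset.sum_fiberwise Finset.univ (fun d => (Quotient.mk _ d : Q)) w, mul_comm]
  refine Finset.card_nsmul_le_sum Finset.univ _ _ fun q _ => ?_
  induction q using Quotient.inductionOn with
  | h d =>
    obtain ⟨s, hs, hc⟩ := h d
    refine hc.trans (Finset.sum_le_sum_of_subset fun x hx => ?_)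
    simp only [Finset.mem_filter, Finset.mem_univ, true_and]
    exact Quotient.sound (hs x hx).symm

theorem IsThreeConnected.connected (h : IsThreeConnected G) : G.Connected := by
  have := h.2 ∅ (by simp)
  rw [Set.compl_empty] at this
  exact (SimpleGraph.induceUnivIso G).connected_iff.1 this

theorem encard_pair_le (a b : V) : ({a, b} : Set V).encard ≤ 2 := by
  refine (Set.encard_insert_le _ _).trans ?_
  rw [Set.encard_singleton]
  norm_num

theorem IsThreeConnected.exists_adj (h : IsThreeConnected G) (v a b : V) :
    ∃ w, G.Adj v w ∧ w ≠ a ∧ w ≠ b := by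
  have hs : (({a, b} : Set V) \ {v}).encard ≤ 2 :=
    (Set.encard_le_encard Set.sdiff_subset).trans (encard_pair_le a b)
  have hex : ∃ u, u ∉ (({a, b, v} : Set V)) := by
    by_contra! hcon
    have huniv : ({a, b, v} : Set V) = Set.univ := Set.eq_univ_of_forall hcon
    have h1 : ({a, b, v} : Set V).encard ≤ 3 := by
      refine (Set.encard_insert_le _ _).trans ?_
      calc _ ≤ (2 : ℕ∞) + 1 := by gcongr; exact encard_pair_le b v
        _ = 3 := by norm_num
    rw [huniv, Set.encard_univ] at h1
    exact absurd h.1 (not_lt.2 h1)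
  obtain ⟨u, hu⟩ := hex
  simp only [Set.mem_insert_iff, Set.mem_singleton_iff, not_or] at hu
  have hv : v ∈ (({a, b} : Set V) \ {v})ᶜ := by simp
  have hu' : u ∈ (({a, b} : Set V) \ {v})ᶜ := by simp [hu.1, hu.2.1]
  obtain ⟨p⟩ := (h.2 _ hs).preconnected ⟨v, hv⟩ ⟨u, hu'⟩
  cases p with
  | nil => exact absurd rfl hu.2.2
  | @cons _ w _ hadj _ =>
    refine ⟨w, hadj, ?_, ?_⟩
    · intro e
      exact w.2 ⟨by simp [e], fun hwv => hadj.ne (Subtype.ext (Set.mem_singleton_iff.1 hwv).symm)⟩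
    · intro e
      exact w.2 ⟨by simp [e], fun hwv => hadj.ne (Subtype.ext (Set.mem_singleton_iff.1 hwv).symm)⟩

theorem IsThreeConnected.euler [Finite V] (h : IsThreeConnected G) (hp : IsPlanar G) :
    ∃ σ : Equiv.Perm G.Dart, IsRotation σ ∧ Nat.card V + numFaces σ = Nat.card G.edgeSet + 2 := by
  obtain ⟨σ, hσ, he⟩ := hp
  refine ⟨σ, hσ, ?_⟩
  have h1 : Nat.card {v : V // ∀ w, ¬ G.Adj v w} = 0 := by
    have : IsEmpty {v : V // ∀ w, ¬ G.Adj v w} := ⟨fun ⟨v, hv⟩ => by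
      obtain ⟨w, hw, -⟩ := h.exists_adj v v v
      exact hv w hw⟩
    exact Nat.card_of_isEmpty
  have h2 : Nat.card G.ConnectedComponent = 1 := by
    have := h.connected.preconnected.subsingleton_connectedComponent
    have : Nonempty G.ConnectedComponent :=
      h.connected.nonempty.map G.connectedComponentMk
    exact Nat.card_eq_one_iff_unique.2 ⟨inferInstance, inferInstance⟩
  omega

theorem card_dart [Fintype V] [Fintype G.Dart] : Fintype.card G.Dart = 2 * Nat.card G.edgeSet := by
  classical
  have h := G.dart_card_eq_twice_card_edges
  rw [Nat.card_eq_fintype_card, ← SimpleGraph.edgeFinset_card]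
  convert h

theorem IsThreeConnected.card_edges_lt [Finite V] (h : IsThreeConnected G) (hp : IsPlanar G) :
    Nat.card G.edgeSet + 6 ≤ 3 * Nat.card V := by
  classical
  have := Fintype.ofFinite V
  obtain ⟨σ, hσ, he⟩ := h.euler hp
  have hdeg : ∀ v a, ∃ w, G.Adj v w ∧ w ≠ a := fun v a => by
    obtain ⟨w, h1, h2, -⟩ := h.exists_adj v a a
    exact ⟨w, h1, h2⟩
  have hle := mul_numFaces_le (σ := σ) (fun _ => 1) 3 fun d => by
    refine ⟨{d, facePerm σ d, facePerm σ (facePerm σ d)}, ?_, ?_⟩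
    · simp [Equiv.Perm.sameCycle_apply_right, Equiv.Perm.SameCycle.refl]
    · rw [← Finset.card_eq_sum_ones, Finset.card_insert_of_notMem (by
        simp [(hσ.facePerm_ne d).symm, (hσ.facePerm_facePerm_ne hdeg d).symm]),
        Finset.card_insert_of_notMem (by simp [(hσ.facePerm_ne _).symm])]
      simp
  rw [← Finset.card_eq_sum_ones, Finset.card_univ, card_dart] at hle
  omega

theorem IsThreeConnected.no_bipartite [Finite V] (h : IsThreeConnected G) (hp : IsPlanar G)
    (e : Fin 6 ≃ V) : ∃ i j : Fin 3, ¬ G.Adj (e (Fin.castAdd 3 i)) (e (Fin.natAdd 3 j)) := by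
  classical
  by_contra! hadj
  have := Fintype.ofFinite V
  obtain ⟨σ, hσ, he⟩ := h.euler hp
  have hdeg : ∀ v a, ∃ w, G.Adj v w ∧ w ≠ a := fun v a => by
    obtain ⟨w, h1, h2, -⟩ := h.exists_adj v a a
    exact ⟨w, h1, h2⟩
  let side : V → Bool := fun v => decide ((e.symm v : ℕ) < 3)
  let w : G.Dart → ℕ := fun d => if side d.fst = side d.snd then 2 else 1
  have w_pos : ∀ d, 1 ≤ w d := fun d => by simp only [w]; split_ifs <;> norm_num
  have hle := mul_numFaces_le (σ := σ) w 4 fun d => by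
    have n1 := hσ.facePerm_ne d
    have n2 := hσ.facePerm_facePerm_ne hdeg d
    have n3 := hσ.facePerm_ne (facePerm σ d)
    have n4 := hσ.facePerm_facePerm_ne hdeg (facePerm σ d)
    have n5 := hσ.facePerm_ne (facePerm σ (facePerm σ d))
    have f1 := hσ.fst_facePerm d
    have f2 := hσ.fst_facePerm (facePerm σ d)
    have f3 := hσ.fst_facePerm (facePerm σ (facePerm σ d))
    set d1 := facePerm σ d with hd1
    set d2 := facePerm σ d1 with hd2
    set d3 := facePerm σ d2 with hd3
    have s1 : (facePerm σ).SameCycle d d1 := Equiv.Perm.sameCycle_apply_right.2 (.refl _ _)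
    have s2 : (facePerm σ).SameCycle d d2 := Equiv.Perm.sameCycle_apply_right.2 s1
    have s3 : (facePerm σ).SameCycle d d3 := Equiv.Perm.sameCycle_apply_right.2 s2
    by_cases h3 : d3 = d
    · refine ⟨{d, d1, d2}, by simp [s1, s2, Equiv.Perm.SameCycle.refl], ?_⟩
      rw [Finset.sum_insert (by simp [n1.symm, n2.symm]),
        Finset.sum_insert (by simp [n3.symm]), Finset.sum_singleton]
      rw [h3] at f3
      have h0 : w d = if side d.fst = side d.snd then 2 else 1 := rfl
      have h1 : w d1 = if side d.snd = side d1.snd then 2 else 1 := by simp only [w, f1]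
      have h2 : w d2 = if side d1.snd = side d.fst then 2 else 1 := by simp only [w, f2, ← f3]
      rw [h0, h1, h2]
      cases side d.fst <;> cases side d.snd <;> cases side d1.snd <;> simp
    · refine ⟨{d, d1, d2, d3}, by simp [s1, s2, s3, Equiv.Perm.SameCycle.refl], ?_⟩
      rw [Finset.sum_insert (by simp [n1.symm, n2.symm, Ne.symm h3]),
        Finset.sum_insert (by simp [n3.symm, n4.symm]),
        Finset.sum_insert (by simp [n5.symm]), Finset.sum_singleton]
      have := w_pos d
      have := w_pos d1
      have := w_pos d2
      have := w_pos d3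
      omega
  have hsum : ∑ d, w d + 18 ≤ 2 * Fintype.card G.Dart := by
    let f : (Fin 3 × Fin 3) ⊕ (Fin 3 × Fin 3) → G.Dart := Sum.elim
      (fun x => ⟨(e (Fin.castAdd 3 x.1), e (Fin.natAdd 3 x.2)), hadj x.1 x.2⟩)
      (fun x => ⟨(e (Fin.natAdd 3 x.2), e (Fin.castAdd 3 x.1)), (hadj x.1 x.2).symm⟩)
    have hf : Function.Injective f := by
      have hcr : ∀ i j : Fin 3, (Fin.castAdd 3 i : Fin 6) ≠ Fin.natAdd 3 j := by decide
      have i1 : ∀ i j : Fin 3, (Fin.castAdd 3 i : Fin 6) = Fin.castAdd 3 j → i = j := by decide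
      have i2 : ∀ i j : Fin 3, (Fin.natAdd 3 i : Fin 6) = Fin.natAdd 3 j → i = j := by decide
      rintro (⟨a, b⟩ | ⟨a, b⟩) (⟨c, d⟩ | ⟨c, d⟩) hxy
      · have h1 := e.injective (congrArg (fun d => d.fst) hxy)
        have h2 := e.injective (congrArg (fun d => d.snd) hxy)
        have e1 : a = c := i1 _ _ h1
        have e2 : b = d := i2 _ _ h2
        rw [e1, e2]
      · exact absurd (e.injective (congrArg (fun d => d.fst) hxy)) (hcr _ _)
      · exact absurd (e.injective (congrArg (fun d => d.fst) hxy)).symm (hcr _ _)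
      · have h1 := e.injective (congrArg (fun d => d.fst) hxy)
        have h2 := e.injective (congrArg (fun d => d.snd) hxy)
        have e1 : a = c := i1 _ _ h2
        have e2 : b = d := i2 _ _ h1
        rw [e1, e2]
    have hcross : ∀ x, w (f x) = 1 := by
      have : ∀ i j : Fin 3, decide (((Fin.castAdd 3 i : Fin 6) : ℕ) < 3) = true ∧
          decide (((Fin.natAdd 3 j : Fin 6) : ℕ) < 3) = false := by decide
      rintro (⟨a, b⟩ | ⟨a, b⟩) <;> simp [w, f, side]
    have h18 : 18 ≤ (Finset.univ.filter fun d => w d = 1).card := by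
      have := Finset.card_le_card_of_injOn (s := Finset.univ)
        (t := Finset.univ.filter fun d => w d = 1) f (by simp [hcross]) hf.injOn
      simpa using this
    have hw2 : ∀ d, w d + (if w d = 1 then 1 else 0) = 2 := fun d => by
      simp only [w]; split_ifs <;> simp_all
    calc ∑ d, w d + 18 ≤ ∑ d, w d + (Finset.univ.filter fun d => w d = 1).card := by gcongr
      _ = ∑ d, (w d + (if w d = 1 then 1 else 0)) := by
        rw [Finset.sum_add_distrib, Finset.card_filter]
      _ = 2 * Fintype.card G.Dart := by simp [hw2, mul_comm]
  rw [card_dart] at hsum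
  have hc : Nat.card V = 6 := by rw [← Nat.card_congr e]; simp
  omega

theorem IsThreeConnected.admissible [Finite V] (h : IsThreeConnected G) (hp : IsPlanar G) :
    Admissible G where
  nonempty := h.connected.nonempty
  deg := h.exists_adj
  not_complete h5 := by
    classical
    by_contra! hcon
    have := Fintype.ofFinite V
    have hE := h.card_edges_lt hp
    have htop : G = ⊤ := by
      ext a b
      exact ⟨fun h => h.ne, fun h => hcon a b h⟩
    have h10 : Nat.card (⊤ : SimpleGraph V).edgeSet = 10 := by
      rw [Nat.card_eq_fintype_card, ← SimpleGraph.edgeFinset_card,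
        SimpleGraph.card_edgeFinset_top_eq_card_choose_two, ← Nat.card_eq_fintype_card, h5]
      rfl
    rw [h5, htop, h10] at hE
    omega
  no_cut h6 a b c d hab hcd hac had hbc hbd := by
    classical
    by_contra! hcon
    have := Fintype.ofFinite V
    have h4 : ({a, b, c, d} : Finset V).card = 4 := by
      rw [Finset.card_insert_of_notMem (by simp [hab, hac, had]),
        Finset.card_insert_of_notMem (by simp [hbc, hbd]),
        Finset.card_insert_of_notMem (by simp [hcd]), Finset.card_singleton]
    have hs : ((({a, b, c, d} : Finset V)ᶜ : Finset V) : Set V).encard ≤ 2 := by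
      rw [Set.encard_coe_eq_coe_finsetCard, Finset.card_compl, h4, ← Nat.card_eq_fintype_card, h6]
      norm_num
    have hmem : ∀ x ∈ ({a, b, c, d} : Finset V),
        x ∈ ((({a, b, c, d} : Finset V)ᶜ : Finset V) : Set V)ᶜ := fun x hx => by
      rw [Finset.coe_compl, compl_compl]; exact hx
    obtain ⟨p⟩ := (h.2 _ hs).preconnected ⟨a, hmem a (by simp)⟩ ⟨c, hmem c (by simp)⟩
    obtain ⟨x, -, hx1, hx2⟩ := p.exists_boundary_dart {y | (y : V) = a ∨ (y : V) = b}
      (Or.inl rfl) (by simp [hac.symm, hbc.symm])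
    have hadj : G.Adj x.fst x.snd := x.adj
    have hsnd : (x.snd : V) ∈ ({a, b, c, d} : Finset V) := by
      have hback : ∀ y ∈ ((({a, b, c, d} : Finset V)ᶜ : Finset V) : Set V)ᶜ,
          y ∈ ({a, b, c, d} : Finset V) := fun y hy => by
        rw [Finset.coe_compl, compl_compl] at hy; exact hy
      exact hback _ x.snd.2
    simp only [Finset.mem_insert, Finset.mem_singleton] at hsnd
    simp only [Set.mem_ofPred_eq, not_or] at hx1 hx2
    rcases hsnd with e | e | e | e
    · exact hx2.1 e
    · exact hx2.2 e
    · rcases hx1 with e' | e' <;> rw [e, e'] at hadj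
      · exact hcon.1 hadj
      · exact hcon.2.2.1 hadj
    · rcases hx1 with e' | e' <;> rw [e, e'] at hadj
      · exact hcon.2.1 hadj
      · exact hcon.2.2.2 hadj
  no_bipartite _ := h.no_bipartite hp

end Planar

end HexGlue

end

noncomputable section

namespace HexGlue

/-! ### The ten graphs are planar, 3-connected and pairwise non-isomorphic -/

/-- The successor of `w` in the cyclic list `l`. -/
def cyclicNext (l : List ℕ) (w : ℕ) : ℕ := l.getD ((l.idxOf w + 1) % l.length) 0

/-- Rotation systems of the ten graphs. -/
def rotations : Fin 10 → List (List ℕ) := ![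
  [[1, 2, 3], [0, 3, 2], [0, 1, 3], [0, 2, 1]],
  [[1, 3, 2, 4], [0, 4, 2, 3], [0, 3, 1, 4], [0, 1, 2], [0, 2, 1]],
  [[1, 3, 4], [0, 4, 2], [1, 4, 3], [2, 4, 0], [0, 3, 2, 1]],
  [[2, 4, 3, 5], [2, 5, 3, 4], [0, 5, 1, 4], [0, 4, 1, 5], [0, 2, 1, 3], [0, 3, 1, 2]],
  [[1, 2, 3, 4, 5], [0, 5, 4, 3, 2], [0, 1, 3], [0, 2, 1, 4], [0, 3, 1, 5], [0, 4, 1]],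
  [[1, 2, 3], [0, 4, 2], [1, 5, 0], [4, 0, 5], [3, 5, 1], [4, 3, 2]],
  [[1, 4, 5], [0, 5, 2], [1, 5, 3], [2, 5, 4], [3, 5, 0], [0, 4, 3, 2, 1]],
  [[1, 4, 3, 5], [0, 5, 2, 4], [1, 5, 3], [0, 4, 2], [0, 1, 3], [0, 2, 1]],
  [[1, 4, 3, 2, 5], [0, 5, 2, 4], [0, 3, 1, 5], [0, 4, 2], [0, 1, 3], [0, 2, 1]],
  [[2, 3, 4, 5], [2, 5, 4, 3], [0, 5, 1, 3], [0, 2, 1, 4], [0, 3, 1], [0, 1, 2]]]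

/-- The faces of these rotation systems. -/
def faceLists : Fin 10 → List (List ℕ) := ![
  [[0, 1, 3], [0, 2, 1], [0, 3, 2], [1, 2, 3]],
  [[0, 1, 4], [0, 2, 3], [0, 3, 1], [0, 4, 2], [1, 2, 4], [1, 3, 2]],
  [[0, 1, 4], [0, 3, 2, 1], [0, 4, 3], [1, 2, 4], [2, 3, 4]],
  [[0, 2, 5], [0, 3, 4], [0, 4, 2], [0, 5, 3], [1, 2, 4], [1, 3, 5], [1, 4, 3], [1, 5, 2]],
  [[0, 1, 5], [0, 2, 1], [0, 3, 2], [0, 4, 3], [0, 5, 4], [1, 2, 3], [1, 3, 4], [1, 4, 5]],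
  [[0, 1, 4, 3], [0, 2, 1], [0, 3, 5, 2], [1, 2, 5, 4], [3, 4, 5]],
  [[0, 1, 5], [0, 4, 3, 2, 1], [0, 5, 4], [1, 2, 5], [2, 3, 5], [3, 4, 5]],
  [[0, 1, 5], [0, 3, 4], [0, 4, 1], [0, 5, 2, 3], [1, 2, 5], [1, 4, 3, 2]],
  [[0, 1, 5], [0, 2, 3], [0, 3, 4], [0, 4, 1], [0, 5, 2], [1, 2, 5], [1, 4, 3, 2]],
  [[0, 2, 5], [0, 3, 2], [0, 4, 3], [0, 5, 1, 4], [1, 2, 3], [1, 3, 4], [1, 5, 2]]]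

/-- The neighbour of `v` that follows `w` in the rotation system. -/
def nextNeighbour (k : Fin 10) (v w : ℕ) : ℕ := cyclicNext ((rotations k).getD v []) w

/-- The index of the face to the side of the dart from `v` to `w`. -/
def faceIndex (k : Fin 10) (v w : ℕ) : ℕ :=
  (faceLists k).findIdx fun l => v ∈ l && cyclicNext l v == w

section Tables

variable {m : ℕ} {G : SimpleGraph (Fin m)} {T : ℕ → ℕ → Bool} {nxt lab : ℕ → ℕ → ℕ}

/-- Rotate a dart by means of a table. -/
def rotateDart (hT : ∀ i j : Fin m, G.Adj i j ↔ T i j = true)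
    (h1 : ∀ v < m, ∀ w < m, T v w → nxt v w < m ∧ T v (nxt v w)) (d : G.Dart) : G.Dart :=
  ⟨(d.fst, ⟨nxt d.fst d.snd, (h1 _ d.fst.2 _ d.snd.2 ((hT _ _).1 d.adj)).1⟩),
    (hT _ _).2 (h1 _ d.fst.2 _ d.snd.2 ((hT _ _).1 d.adj)).2⟩

theorem rotateDart_iterate (hT : ∀ i j : Fin m, G.Adj i j ↔ T i j = true)
    (h1 : ∀ v < m, ∀ w < m, T v w → nxt v w < m ∧ T v (nxt v w)) (d : G.Dart) (i : ℕ) :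
    ((rotateDart hT h1)^[i] d).fst = d.fst ∧
      (((rotateDart hT h1)^[i] d).snd : ℕ) = (nxt d.fst)^[i] d.snd := by
  induction i with
  | zero => simp
  | succ i ih =>
    rw [Function.iterate_succ_apply', Function.iterate_succ_apply']
    refine ⟨ih.1, ?_⟩
    change nxt _ _ = _
    rw [ih.1, ih.2]

theorem isPlanar_of_tables (hT : ∀ i j : Fin m, G.Adj i j ↔ T i j = true)
    (hconn : IsThreeConnected G) {F E : ℕ} (hE : Nat.card G.edgeSet = E) (hF : m + F = E + 2)
    (h1 : ∀ v < m, ∀ w < m, T v w → nxt v w < m ∧ T v (nxt v w))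
    (h2 : ∀ v < m, ∀ w < m, ∀ w' < m, T v w → T v w' → ∃ i < 6, (nxt v)^[i] w = w')
    (h3 : ∀ v < m, ∀ w < m, T v w → lab v w < F ∧ lab w (nxt w v) = lab v w)
    (h4 : ∀ v < m, ∀ w < m, ∀ v' < m, ∀ w' < m, T v w → T v' w' → lab v w = lab v' w' →
      ∃ i < 6, (fun d : ℕ × ℕ => (d.2, nxt d.2 d.1))^[i] (v, w) = (v', w'))
    (h5 : ∀ f < F, ∃ v < m, ∃ w < m, T v w ∧ lab v w = f) : IsPlanar G := by
  classical
  set f := rotateDart hT h1 with hf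
  have reach : ∀ d d' : G.Dart, d.fst = d'.fst → ∃ i, f^[i] d = d' := by
    intro d d' hdd
    obtain ⟨i, -, hi⟩ := h2 d.fst d.fst.2 d.snd d.snd.2 d'.snd d'.snd.2 ((hT _ _).1 d.adj)
      (by rw [hdd]; exact (hT _ _).1 d'.adj)
    obtain ⟨e1, e2⟩ := rotateDart_iterate hT h1 d i
    refine ⟨i, ?_⟩
    ext
    · rw [e1, hdd]
    · rw [e2, hi]
  have hsurj : Function.Surjective f := by
    intro d
    obtain ⟨i, hi⟩ := reach (f d) d rfl
    refine ⟨f^[i] d, ?_⟩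
    rw [← Function.iterate_succ_apply' f, Function.iterate_succ_apply, hi]
  let σ : Equiv.Perm G.Dart := Equiv.ofBijective f (Finite.injective_iff_bijective.1
    (Finite.injective_iff_surjective.2 hsurj))
  have hσ : ∀ d, σ d = f d := fun d => rfl
  have hpow : ∀ (τ : Equiv.Perm G.Dart) (i : ℕ) (d : G.Dart), τ.SameCycle d (τ^[i] d) :=
    fun τ i d => ⟨i, by rw [Equiv.Perm.iterate_eq_pow]; simp⟩
  have hinv : ∀ (τ : Equiv.Perm G.Dart) {α : Type} (g : G.Dart → α), (∀ d, g (τ d) = g d) →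
      ∀ d d', τ.SameCycle d d' → g d = g d' := by
    intro τ α g hg d d' h
    obtain ⟨i, hi⟩ := h.exists_nat_pow_eq
    rw [← hi, ← Equiv.Perm.iterate_eq_pow]
    clear hi
    induction i with
    | zero => rfl
    | succ i ih => rw [Function.iterate_succ_apply', hg, ih]
  have hrot : IsRotation σ := by
    intro d d'
    refine ⟨hinv σ (fun d => d.fst) (fun d => rfl) d d', fun h => ?_⟩
    obtain ⟨i, hi⟩ := reach d d' h
    rw [← hi]
    exact hpow σ i d
  let L : G.Dart → Fin F := fun d =>
    ⟨lab d.fst d.snd, (h3 _ d.fst.2 _ d.snd.2 ((hT _ _).1 d.adj)).1⟩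
  have hL : ∀ d, L (facePerm σ d) = L d := fun d =>
    Fin.ext (h3 _ d.fst.2 _ d.snd.2 ((hT _ _).1 d.adj)).2
  have hiter : ∀ (d : G.Dart) (i : ℕ),
      (fun d : ℕ × ℕ => (d.2, nxt d.2 d.1))^[i] ((d.fst : ℕ), (d.snd : ℕ)) =
        ((((facePerm σ)^[i] d).fst : ℕ), (((facePerm σ)^[i] d).snd : ℕ)) := by
    intro d i
    induction i with
    | zero => rfl
    | succ i ih =>
      rw [Function.iterate_succ_apply', ih, Function.iterate_succ_apply']
      rfl
  have hLcyc : ∀ d d', L d = L d' → (facePerm σ).SameCycle d d' := by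
    intro d d' h
    obtain ⟨i, -, hi⟩ := h4 _ d.fst.2 _ d.snd.2 _ d'.fst.2 _ d'.snd.2 ((hT _ _).1 d.adj)
      ((hT _ _).1 d'.adj) (congrArg Fin.val h)
    rw [hiter] at hi
    have : (facePerm σ)^[i] d = d' := by
      ext
      · exact congrArg Prod.fst hi
      · exact congrArg Prod.snd hi
    rw [← this]
    exact hpow _ i d
  have hfaces : numFaces σ = F := by
    let g : Quotient (Equiv.Perm.SameCycle.setoid (facePerm σ)) → Fin F :=
      Quotient.lift L fun d d' h => hinv _ L hL d d' h
    have hg : Function.Bijective g := by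
      constructor
      · intro x y
        induction x using Quotient.inductionOn
        induction y using Quotient.inductionOn
        exact fun h => Quotient.sound (hLcyc _ _ h)
      · intro j
        obtain ⟨v, hv, w, hw, hvw, hl⟩ := h5 j j.2
        exact ⟨Quotient.mk _ ⟨(⟨v, hv⟩, ⟨w, hw⟩), (hT _ _).2 hvw⟩, Fin.ext hl⟩
    have := Nat.card_congr (Equiv.ofBijective g hg)
    rw [Nat.card_fin] at this
    exact this
  refine ⟨σ, hrot, ?_⟩
  have c1 : Nat.card {v : Fin m // ∀ w, ¬ G.Adj v w} = 0 := by
    have : IsEmpty {v : Fin m // ∀ w, ¬ G.Adj v w} := ⟨fun ⟨v, hv⟩ => by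
      obtain ⟨w, hw, -⟩ := hconn.exists_adj v v v
      exact hv w hw⟩
    exact Nat.card_of_isEmpty
  have c2 : Nat.card G.ConnectedComponent = 1 := by
    have := hconn.connected.preconnected.subsingleton_connectedComponent
    have : Nonempty G.ConnectedComponent :=
      hconn.connected.nonempty.map G.connectedComponentMk
    exact Nat.card_eq_one_iff_unique.2 ⟨inferInstance, inferInstance⟩
  rw [Nat.card_fin, hfaces, c1, c2, hE]
  omega

/-- There is a path of length one, two or three from `x` to `y` that avoids `a` and `b`. -/
def shortPath (T : ℕ → ℕ → Bool) (m a b x y : ℕ) : Bool :=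
  (List.range m).any fun z => z ≠ a && z ≠ b && (x = z || T x z) &&
    (List.range m).any fun t => t ≠ a && t ≠ b && T z t && (t = y || T t y)

theorem shortPath_iff {T : ℕ → ℕ → Bool} {m a b x y : ℕ} : shortPath T m a b x y = true ↔
    ∃ z < m, (z ≠ a ∧ z ≠ b ∧ (x = z ∨ T x z)) ∧ ∃ t < m, t ≠ a ∧ t ≠ b ∧ T z t ∧
        (t = y ∨ T t y) := by
  simp [shortPath, and_assoc]

theorem isThreeConnected_of_table (hT : ∀ i j : Fin m, G.Adj i j ↔ T i j = true) (hm : 3 < m)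
    (h : ∀ a < m + 1, ∀ b < m + 1, ∀ x < m, ∀ y < m, x ≠ a ∧ x ≠ b ∧ y ≠ a ∧ y ≠ b → x = y ∨
      shortPath T m a b x y = true) : IsThreeConnected G := by
  refine ⟨by simpa using hm, fun s hs => ?_⟩
  obtain ⟨a, ha, b, hb, hab⟩ : ∃ a ≤ m, ∃ b ≤ m, ∀ v : Fin m, v ∈ s ↔ ((v : ℕ) = a ∨ (v : ℕ) = b) := by
    rcases Set.eq_empty_or_nonempty s with rfl | ⟨v, hv⟩
    · exact ⟨m, le_rfl, m, le_rfl, fun v => by simp [v.2.ne]⟩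
    · by_cases h1 : ∃ w ∈ s, w ≠ v
      · obtain ⟨w, hw, hwv⟩ := h1
        refine ⟨v, v.2.le, w, w.2.le, fun x => ⟨fun hx => ?_, ?_⟩⟩
        · by_contra! hcon
          have h3 : ({x, v, w} : Set (Fin m)).encard = 3 := by
            rw [Set.encard_insert_of_notMem, Set.encard_pair hwv.symm]
            · norm_num
            · simp [Fin.ext_iff, hcon.1, hcon.2]
          have h4 : ({x, v, w} : Set (Fin m)).encard ≤ s.encard := Set.encard_le_encard (by
            rintro y (rfl | rfl | rfl) <;> assumption)
          rw [h3] at h4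
          exact absurd (h4.trans hs) (by norm_num)
        · rintro (h | h)
          · rw [Fin.ext h]; exact hv
          · rw [Fin.ext h]; exact hw
      · push Not at h1
        exact ⟨v, v.2.le, v, v.2.le, fun x => ⟨fun hx => Or.inl (by rw [h1 x hx]),
          fun hx => by rw [Fin.ext (or_self_iff.1 hx)]; exact hv⟩⟩
  have hne : Nonempty ↥(sᶜ) := by
    by_contra hemp
    rw [not_nonempty_iff, Set.isEmpty_coe_sort, Set.compl_empty_iff] at hemp
    rw [hemp, Set.encard_univ] at hs
    simp only [ENat.card_eq_coe_fintype_card, Fintype.card_fin] at hs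
    have : m ≤ 2 := by exact_mod_cast hs
    omega
  refine SimpleGraph.Connected.mk ?_
  rintro ⟨x, hx⟩ ⟨y, hy⟩
  have hx' : (x : ℕ) ≠ a ∧ (x : ℕ) ≠ b :=
    ⟨fun h => hx ((hab x).2 (Or.inl h)), fun h => hx ((hab x).2 (Or.inr h))⟩
  have hy' : (y : ℕ) ≠ a ∧ (y : ℕ) ≠ b :=
    ⟨fun h => hy ((hab y).2 (Or.inl h)), fun h => hy ((hab y).2 (Or.inr h))⟩
  simp only [shortPath_iff] at h
  rcases h a (by omega) b (by omega) x x.2 y y.2 ⟨hx'.1, hx'.2, hy'⟩ with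
    e | ⟨z, hz, ⟨hza, hzb, hxz⟩, t, ht, hta,
    htb, hzt, hty⟩
  · have : x = y := Fin.ext e
    subst this
    exact SimpleGraph.Reachable.refl _
  have hzs : (⟨z, hz⟩ : Fin m) ∈ sᶜ := fun h => by
    rcases (hab _).1 h with h | h
    · exact hza h
    · exact hzb h
  have hts : (⟨t, ht⟩ : Fin m) ∈ sᶜ := fun h => by
    rcases (hab _).1 h with h | h
    · exact hta h
    · exact htb h
  have step : ∀ u v : ↥(sᶜ), G.Adj u v → (G.induce sᶜ).Reachable u v := fun u v h =>
    SimpleGraph.Adj.reachable (G := G.induce sᶜ) h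
  refine SimpleGraph.Reachable.trans (v := ⟨⟨z, hz⟩, hzs⟩) ?_
    (SimpleGraph.Reachable.trans (v := ⟨⟨t, ht⟩, hts⟩) (step _ _ ((hT _ _).2 hzt)) ?_)
  · rcases hxz with e | h
    · have : x = ⟨z, hz⟩ := Fin.ext e
      subst this
      exact SimpleGraph.Reachable.refl _
    · exact step _ _ ((hT _ _).2 h)
  · rcases hty with e | h
    · have : y = ⟨t, ht⟩ := Fin.ext e.symm
      subst this
      exact SimpleGraph.Reachable.refl _
    · exact step _ _ ((hT _ _).2 h)

theorem card_edges_of_table (hT : ∀ i j : Fin m, G.Adj i j ↔ T i j = true) {E : ℕ}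
    (hE : ((Finset.range m ×ˢ Finset.range m).filter fun p => T p.1 p.2 = true).card = 2 * E) :
    Nat.card G.edgeSet = E := by
  classical
  have h := card_dart (G := G)
  have h2 : Fintype.card G.Dart =
      ((Finset.range m ×ˢ Finset.range m).filter fun p => T p.1 p.2 = true).card := by
    rw [← Finset.card_univ]
    refine Finset.card_bij (fun d _ => ((d.fst : ℕ), (d.snd : ℕ))) ?_ ?_ ?_
    · intro d _
      simpa using (hT _ _).1 d.adj
    · intro d _ d' _ h
      ext
      · exact congrArg Prod.fst h
      · exact congrArg Prod.snd h
    · rintro ⟨v, w⟩ h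
      simp only [Finset.mem_filter, Finset.mem_product, Finset.mem_range] at h
      exact ⟨⟨(⟨v, h.1.1⟩, ⟨w, h.1.2⟩), (hT _ _).2 h.2⟩, Finset.mem_univ _, rfl⟩
  omega

end Tables

theorem card_edges_polyGraph (k : Fin 10) :
    Nat.card (polyGraph k).edgeSet = (edges k).length := by
  refine card_edges_of_table (T := edgeTable k) (fun i j => polyGraph_adj) ?_
  revert k
  decide +kernel

set_option synthInstance.maxSize 1000 in
set_option synthInstance.maxHeartbeats 200000 in
theorem isThreeConnected_polyGraph (k : Fin 10) : IsThreeConnected (polyGraph k) := by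
  refine isThreeConnected_of_table (T := edgeTable k) (fun i j => polyGraph_adj) ?_ ?_
  · revert k; decide
  · revert k; decide +kernel

set_option synthInstance.maxSize 1000 in
set_option synthInstance.maxHeartbeats 200000 in
theorem isPlanar_polyGraph (k : Fin 10) : IsPlanar (polyGraph k) := by
  refine isPlanar_of_tables (T := edgeTable k) (nxt := nextNeighbour k) (lab := faceIndex k)
    (F := (faceLists k).length) (fun i j => polyGraph_adj) (isThreeConnected_polyGraph k)
    (card_edges_polyGraph k) ?_ ?_ ?_ ?_ ?_ ?_
  · revert k; decide
  · revert k; decide +kernel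
  · revert k; decide +kernel
  · revert k; decide +kernel
  · revert k; decide +kernel
  · revert k; decide +kernel

theorem polyGraph_injective {j k : Fin 10} (φ : polyGraph j ≃g polyGraph k) : j = k := by
  have h1 : order j = order k := by
    have := Fintype.card_congr φ.toEquiv
    simpa using this
  have h2 : (edges j).length = (edges k).length := by
    rw [← card_edges_polyGraph, ← card_edges_polyGraph]
    exact Nat.card_congr φ.mapEdgeSet
  have apex : ∀ i : Fin 10, (∃ v : Fin (order i), ∀ w, w ≠ v → (polyGraph i).Adj v w) ↔
      ∃ v < order i, ∀ w < order i, w ≠ v → edgeTable i v w = true := by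
    intro i
    constructor
    · rintro ⟨v, hv⟩
      exact ⟨v, v.2, fun w hw hne => polyGraph_adj.1 (hv ⟨w, hw⟩ fun e => hne (congrArg Fin.val e))⟩
    · rintro ⟨v, hv, h⟩
      exact ⟨⟨v, hv⟩, fun w hw => polyGraph_adj.2 (h w w.2 fun e => hw (Fin.ext e))⟩
  have h3 : (∃ v < order j, ∀ w < order j, w ≠ v → edgeTable j v w = true) ↔
      ∃ v < order k, ∀ w < order k, w ≠ v → edgeTable k v w = true := by
    rw [← apex, ← apex]
    constructor
    · rintro ⟨v, hv⟩
      refine ⟨φ v, fun w hw => ?_⟩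
      have := φ.map_adj_iff.2 (hv (φ.symm w) fun e => hw (by rw [← e]; simp))
      simpa using this
    · rintro ⟨v, hv⟩
      refine ⟨φ.symm v, fun w hw => ?_⟩
      have := φ.symm.map_adj_iff.2 (hv (φ w) fun e => hw (by rw [← e]; simp))
      simpa using this
  clear φ apex
  revert j k
  decide +kernel

theorem IsThreeConnected.of_iso {V W : Type*} {G : SimpleGraph V} {H : SimpleGraph W}
    (φ : G ≃g H) (h : IsThreeConnected G) : IsThreeConnected H := by
  refine ⟨by rw [← ENat.card_congr φ.toEquiv]; exact h.1, fun s hs => ?_⟩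
  have h1 := h.2 (φ ⁻¹' s) (by
    rw [Set.encard_preimage_of_bijective φ.bijective]
    exact hs)
  have ψ : G.induce (φ ⁻¹' s)ᶜ ≃g H.induce sᶜ :=
    ⟨φ.toEquiv.subtypeEquiv fun a => Iff.rfl, fun {a b} => φ.map_adj_iff⟩
  exact ψ.connected_iff.1 h1

theorem IsPlanar.of_iso {V W : Type*} {G : SimpleGraph V} {H : SimpleGraph W}
    (φ : G ≃g H) (h : IsPlanar G) : IsPlanar H := by
  obtain ⟨σ, hσ, he⟩ := h
  let D : G.Dart ≃ H.Dart :=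
    { toFun := φ.toHom.mapDart
      invFun := φ.symm.toHom.mapDart
      left_inv := fun d => by ext <;> simp [SimpleGraph.Hom.mapDart]
      right_inv := fun d => by ext <;> simp [SimpleGraph.Hom.mapDart] }
  have hfst : ∀ d, (D.symm d).fst = φ.symm d.fst := fun d => rfl
  have hcyc : ∀ (τ : Equiv.Perm G.Dart) (d d' : H.Dart),
      (D.permCongr τ).SameCycle d d' ↔ τ.SameCycle (D.symm d) (D.symm d') := by
    intro τ d d'
    have hz : ∀ i : ℤ, (D.permCongr τ ^ i) = D.permCongr (τ ^ i) := fun i => by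
      have := map_zpow D.permCongrHom τ i
      exact this.symm
    simp only [Equiv.Perm.SameCycle, hz, Equiv.permCongr_apply]
    exact exists_congr fun i => by rw [← Equiv.eq_symm_apply]
  refine ⟨D.permCongr σ, fun d d' => ?_, ?_⟩
  · rw [hcyc, hσ, hfst, hfst, φ.symm.injective.eq_iff]
  · have e1 : Nat.card W = Nat.card V := (Nat.card_congr φ.toEquiv).symm
    have e2 : Nat.card H.edgeSet = Nat.card G.edgeSet := (Nat.card_congr φ.mapEdgeSet).symm
    have e3 : Nat.card H.ConnectedComponent = Nat.card G.ConnectedComponent :=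
      (Nat.card_congr φ.connectedComponentEquiv).symm
    have e4 : Nat.card {v : W // ∀ w, ¬ H.Adj v w} = Nat.card {v : V // ∀ w, ¬ G.Adj v w} := by
      refine (Nat.card_congr (φ.toEquiv.subtypeEquiv fun a => ?_)).symm
      constructor
      · intro h w hw
        refine h (φ.symm w) (φ.map_adj_iff.1 ?_)
        simpa using hw
      · intro h w hw
        exact h (φ w) (φ.map_adj_iff.2 hw)
    have e5 : numFaces (D.permCongr σ) = numFaces σ := by
      have hconj : facePerm (D.permCongr σ) = D.permCongr (facePerm σ) := by
        ext d : 1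
        rfl
      refine (Nat.card_congr (Quotient.congr D fun a b => ?_)).symm
      change (facePerm σ).SameCycle a b ↔ (facePerm (D.permCongr σ)).SameCycle (D a) (D b)
      rw [hconj, hcyc]
      simp
    rw [e1, e2, e3, e4, e5, he]

theorem threeConnected_planar_iff {m : ℕ} (hm : m ≤ 6) (G : SimpleGraph (Fin m)) :
    (IsThreeConnected G ∧ IsPlanar G) ↔ ∃ k, Nonempty (G ≃g polyGraph k) := by
  constructor
  · rintro ⟨h1, h2⟩
    exact (h1.admissible h2).exists_iso (by simpa using hm)
  · rintro ⟨k, ⟨φ⟩⟩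
    exact ⟨(isThreeConnected_polyGraph k).of_iso φ.symm, (isPlanar_polyGraph k).of_iso φ.symm⟩

end HexGlue

end

noncomputable section

namespace HexGlue

/-! ### Realisations of the ten graphs as convex polyhedra -/

/-- The vertices of polyhedra that realise the ten graphs. -/
def points : Fin 10 → List (List ℤ) := ![
  [[-1, 0, 0], [1, -1, -1], [1, 1, 0], [1, 1, -1]],
    [[1, 0, -1], [-1, 1, 0], [0, -1, 1], [0, -1, -1], [0, 0, 1]],
    [[0, 1, 0], [0, -1, 0], [1, 0, -1], [1, 1, -1], [-1, -1, -1]],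
    [[-1, 1, 1], [1, 0, -1], [0, 1, -1], [1, -1, 1], [0, 0, 0], [1, 0, 1]],
    [[1, -1, 0], [-1, 0, -1], [-1, -1, 1], [-1, 0, 1], [0, 1, 0], [1, 0, -1]],
    [[0, 0, -1], [-1, 1, 0], [1, 1, 1], [0, -1, -1], [-1, 0, 0], [1, 0, 1]],
    [[1, 0, 1], [1, 1, 0], [1, 0, -1], [1, -1, -1], [1, -1, 0], [-1, 1, -1]],
    [[-1, -1, 1], [0, 0, 0], [-1, 1, -1], [-1, -1, -1], [0, -1, 0], [-1, 1, 0]],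
    [[1, -1, 1], [-1, -1, 1], [-1, 1, 0], [-1, 0, -1], [-1, -1, -1], [0, 0, 1]],
    [[1, 0, -1], [0, -1, 1], [0, 1, 1], [-1, 1, -1], [0, -1, -1], [1, 0, 1]]]

/-- The outward normals of the faces of these polyhedra. -/
def normals : Fin 10 → List (List ℤ) := ![
    [[1, -2, 4], [-1, 0, -2], [-1, 2, 0], [1, 0, 0]],
    [[-1, 1, -3], [2, 3, 1], [1, -1, 0], [2, 0, 1], [-2, -1, 0], [-1, 0, 1]],
    [[1, 0, 1], [-1, 0, 1], [-1, 1, -1], [1, -2, -1], [0, 0, -1]],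
    [[-2, -1, -1], [2, 4, 1], [-1, -1, 0], [0, 0, 1], [-1, -1, -1], [1, 1, 0], [-1, -2, -1], [1,
    0, 0]],
    [[-1, -4, -2], [0, -1, -1], [1, 0, 2], [2, 1, 3], [2, 1, 1], [-1, 0, 0], [-1, 1, 0], [0, 1,
    -1]],
    [[1, 3, -2], [-1, 0, -1], [2, 0, -1], [-1, 0, 2], [-1, -3, 2]],
    [[1, 0, 0], [-1, 2, 2], [-3, -2, 2], [1, 2, -2], [0, 0, -1], [-1, -1, 0]],
    [[1, 0, 1], [1, 1, 2], [-1, 0, 0], [0, -1, 0], [1, 0, -1], [1, 1, 0]],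
    [[0, -1, 0], [0, 0, 1], [3, 2, -2], [1, 1, 0], [1, 0, -1], [-1, 0, 0], [-1, 1, 2]],
    [[1, -1, 0], [2, 4, -1], [1, 1, 0], [0, 0, -1], [-2, 0, 1], [0, 0, 1], [-2, -1, 0]]]

/-- Affine dependencies between the vertices, which show that certain segments are no edges. -/
def dependencies : Fin 10 → List (List ℤ) := ![
    [],
    [[-2, -2, -5, 3, 6]],
    [[1, -1, 2, -2, 0], [-1, 1, -2, 2, 0]],
    [[1, 2, -2, -1, 0, 0], [-1, -2, 2, 1, 0, 0], [-1, -1, 0, -1, 2, 1]],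
    [[0, 0, 2, -3, 2, -1], [-2, -1, 2, -1, 0, 2], [0, 0, -2, 3, -2, 1]],
    [[1, -1, 0, -1, 1, 0], [1, 0, -1, -1, 0, 1], [-1, 1, 0, 1, -1, 0], [0, 1, -1, 0, -1, 1], [-1,
    0, 1, 1, 0, -1], [0, -1, 1, 0, 1, -1]],
    [[1, -1, 1, 0, -1, 0], [1, 0, -1, 2, -2, 0], [0, 1, -2, 2, -1, 0], [-1, 1, -1, 0, 1, 0], [0,
    -1, 2, -2, 1, 0]],
    [[1, 0, 2, -1, 0, -2], [0, 2, -1, 1, -2, 0], [0, -2, 1, -1, 2, 0], [-1, 0, -2, 1, 0, 2], [-1,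
    -2, -1, 0, 2, 2]],
    [[0, 1, -2, 4, -3, 0], [0, -1, 2, -4, 3, 0], [-1, 0, -2, 2, -1, 2], [-1, -1, 0, -2, 2, 2]],
    [[1, 1, 0, 0, -1, -1], [0, -1, 3, -2, 2, -2], [-1, 0, -3, 2, -1, 3], [-1, -1, 0, 0, 1, 1]]]

/-- The inner product of integer vectors given as lists. -/
def listDot (a b : List ℤ) : ℤ :=
  a.getD 0 0 * b.getD 0 0 + a.getD 1 0 * b.getD 1 0 + a.getD 2 0 * b.getD 2 0

/-- The `i`-th vertex of the `k`-th polyhedron. -/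
def intPoint (k : Fin 10) (i : ℕ) : List ℤ := (points k).getD i []

/-- The sum of the normals of the faces that contain the `i`-th and the `j`-th vertex. -/
def edgeNormal (k : Fin 10) (i j : ℕ) : List ℤ :=
  let l := (normals k).filter fun n => (points k).all fun q =>
    listDot n q ≤ listDot n (intPoint k i) && listDot n q ≤ listDot n (intPoint k j)
  [(l.map fun n => n.getD 0 0).sum, (l.map fun n => n.getD 1 0).sum,
    (l.map fun n => n.getD 2 0).sum]

/-- The point of space with the given integer coordinates. -/
def toE3 (a : List ℤ) : E3 := !₂[(a.getD 0 0 : ℝ), (a.getD 1 0 : ℝ), (a.getD 2 0 : ℝ)]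

theorem inner_toE3 (a b : List ℤ) : inner ℝ (toE3 a) (toE3 b) = (listDot a b : ℝ) := by
  simp [toE3, listDot, PiLp.inner_apply, Fin.sum_univ_three]
  ring

theorem strict_vertexNormal : ∀ k : Fin 10, ∀ i < order k, ∀ l < order k, l ≠ i →
    listDot (edgeNormal k i i) (intPoint k l) < listDot (edgeNormal k i i) (intPoint k i) := by
  decide +kernel

set_option synthInstance.maxSize 1000 in
set_option synthInstance.maxHeartbeats 200000 in
theorem strict_edgeNormal : ∀ k : Fin 10, ∀ i < order k, ∀ j < order k, edgeTable k i j = true →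
    listDot (edgeNormal k i j) (intPoint k j) = listDot (edgeNormal k i j) (intPoint k i) ∧
    ∀ l < order k, l ≠ i → l ≠ j →
      listDot (edgeNormal k i j) (intPoint k l) < listDot (edgeNormal k i j) (intPoint k i) := by
  decide +kernel

set_option synthInstance.maxSize 1000 in
set_option synthInstance.maxHeartbeats 200000 in
theorem exists_mem_dependencies : ∀ k : Fin 10, ∀ i < order k, ∀ j < order k,
    edgeTable k i j = false → i ≠ j → ∃ c ∈ dependencies k,
      (∀ l < order k, l ≠ i → l ≠ j → c.getD l 0 ≤ 0) ∧
      (∑ l ∈ Finset.range (order k), c.getD l 0 = 0) ∧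
      (∀ x < 3, ∑ l ∈ Finset.range (order k), c.getD l 0 * (intPoint k l).getD x 0 = 0) ∧
      ∃ l < order k, c.getD l 0 ≠ 0 := by
  decide +kernel

/-- The determinant of three integer vectors. -/
def listDet (a b c : List ℤ) : ℤ :=
  a.getD 0 0 * (b.getD 1 0 * c.getD 2 0 - b.getD 2 0 * c.getD 1 0) -
  a.getD 1 0 * (b.getD 0 0 * c.getD 2 0 - b.getD 2 0 * c.getD 0 0) +
  a.getD 2 0 * (b.getD 0 0 * c.getD 1 0 - b.getD 1 0 * c.getD 0 0)

/-- The difference of two vertices. -/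
def edgeVector (k : Fin 10) (i : ℕ) : List ℤ :=
  [(intPoint k i).getD 0 0 - (intPoint k 0).getD 0 0,
    (intPoint k i).getD 1 0 - (intPoint k 0).getD 1 0,
    (intPoint k i).getD 2 0 - (intPoint k 0).getD 2 0]

theorem listDet_ne_zero : ∀ k : Fin 10,
    listDet (edgeVector k 1) (edgeVector k 2) (edgeVector k (order k - 1)) ≠ 0 := by
  decide +kernel

theorem order_ge : ∀ k : Fin 10, 4 ≤ order k := by decide

theorem toE3_edgeVector (k : Fin 10) (i : ℕ) :
    toE3 (edgeVector k i) = toE3 (intPoint k i) - toE3 (intPoint k 0) := by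
  ext x
  fin_cases x <;> simp [toE3, edgeVector]

theorem eq_zero_of_listDet {a b c : List ℤ} (h : listDet a b c ≠ 0) {u : E3}
    (ha : inner ℝ (toE3 a) u = (0 : ℝ)) (hb : inner ℝ (toE3 b) u = (0 : ℝ))
    (hc : inner ℝ (toE3 c) u = (0 : ℝ)) : u = 0 := by
  simp only [toE3, PiLp.inner_apply, Fin.sum_univ_three, RCLike.inner_apply, conj_trivial] at ha hb hc
  simp [-List.getD_eq_getElem?_getD] at ha hb hc
  have hd : (listDet a b c : ℝ) ≠ 0 := by exact_mod_cast h
  simp only [listDet] at hd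
  push_cast at hd
  ext x
  apply (mul_eq_zero.1 (?_ : _ * u x = 0)).resolve_left hd
  generalize ((a.getD 0 0 : ℤ) : ℝ) = a0 at *
  generalize ((a.getD 1 0 : ℤ) : ℝ) = a1 at *
  generalize ((a.getD 2 0 : ℤ) : ℝ) = a2 at *
  generalize ((b.getD 0 0 : ℤ) : ℝ) = b0 at *
  generalize ((b.getD 1 0 : ℤ) : ℝ) = b1 at *
  generalize ((b.getD 2 0 : ℤ) : ℝ) = b2 at *
  generalize ((c.getD 0 0 : ℤ) : ℝ) = c0 at *
  generalize ((c.getD 1 0 : ℤ) : ℝ) = c1 at *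
  generalize ((c.getD 2 0 : ℤ) : ℝ) = c2 at *
  fin_cases x <;> simp [-mul_eq_zero]
  · linear_combination (b1 * c2 - b2 * c1) * ha + (c1 * a2 - c2 * a1) * hb +
      (a1 * b2 - a2 * b1) * hc
  · linear_combination (b2 * c0 - b0 * c2) * ha + (c2 * a0 - c0 * a2) * hb +
      (a2 * b0 - a0 * b2) * hc
  · linear_combination (b0 * c1 - b1 * c0) * ha + (c0 * a1 - c1 * a0) * hb +
      (a0 * b1 - a1 * b0) * hc

theorem isPolyhedral_polyGraph (k : Fin 10) : IsPolyhedral (polyGraph k) := by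
  classical
  let p : Fin (order k) → E3 := fun i => toE3 (intPoint k i)
  have hlt : ∀ u : List ℤ, ∀ i j, listDot u (intPoint k i) < listDot u (intPoint k j) →
      (inner ℝ (toE3 u) (toE3 (intPoint k i)) : ℝ) < inner ℝ (toE3 u) (toE3 (intPoint k j)) := by
    intro u i j h
    rw [inner_toE3, inner_toE3]
    exact_mod_cast h
  have hinj : Function.Injective p := by
    intro i j hij
    by_contra hne
    have := hlt _ _ _ (strict_vertexNormal k i i.2 j j.2 fun e => hne (Fin.ext e.symm))
    change (inner ℝ _ (p j) : ℝ) < inner ℝ _ (p i) at this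
    rw [hij] at this
    exact lt_irrefl _ this
  let V : Finset E3 := Finset.univ.image p
  let P : Set E3 := convexHull ℝ (V : Set E3)
  have memV : ∀ x, x ∈ V ↔ ∃ i, p i = x := fun x => by simp [V]
  have hV : IsVertexSet V P := by
    refine ⟨Set.Subset.antisymm (fun x hx => ?_) extremePoints_convexHull_subset, rfl⟩
    obtain ⟨i, rfl⟩ := (memV x).1 hx
    rw [← isExtreme_singleton]
    refine IsExposed.isExtreme ((isExposed_iff_face (Set.singleton_nonempty _)).2
      ⟨toE3 (edgeNormal k i i), ?_⟩)
    rw [face_convexHull]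
    have hmax : ∀ q ∈ V, q ≠ p i → (inner ℝ (toE3 (edgeNormal k i i)) q : ℝ) <
        inner ℝ (toE3 (edgeNormal k i i)) (p i) := by
      intro q hq hne
      obtain ⟨j, rfl⟩ := (memV q).1 hq
      exact hlt _ _ _ (strict_vertexNormal k i i.2 j j.2 fun e => hne (by rw [Fin.ext e]))
    have : {q ∈ (V : Set E3) | ∀ r ∈ V, (inner ℝ (toE3 (edgeNormal k i i)) r : ℝ) ≤
        inner ℝ (toE3 (edgeNormal k i i)) q} = {p i} := by
      ext q
      simp only [Set.mem_ofPred_eq, Set.mem_singleton_iff, Finset.mem_coe]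
      constructor
      · rintro ⟨hq, hr⟩
        by_contra hne
        exact absurd (hr _ hx) (not_le.2 (hmax q hq hne))
      · rintro rfl
        refine ⟨hx, fun r hr => ?_⟩
        by_cases h : r = p i
        · rw [h]
        · exact (hmax r hr h).le
    rw [this, convexHull_singleton]
  have h4 := order_ge k
  have hdim : dim P = 3 := by
    have : vectorSpan ℝ P = ⊤ := by
      rw [← Submodule.orthogonal_eq_bot_iff, Submodule.eq_bot_iff]
      intro u hu
      have h0 : p ⟨0, by omega⟩ ∈ V := (memV _).2 ⟨_, rfl⟩
      rw [hV.vectorSpan_eq h0] at hu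
      have key : ∀ i < order k, (inner ℝ (toE3 (edgeVector k i)) u : ℝ) = 0 := by
        intro i hi
        rw [toE3_edgeVector]
        have hmem : toE3 (intPoint k i) - toE3 (intPoint k 0) ∈
            (fun q => q - p ⟨0, by omega⟩) '' (V : Set E3) :=
          ⟨p ⟨i, hi⟩, Finset.mem_coe.2 ((memV _).2 ⟨_, rfl⟩), rfl⟩
        exact Submodule.inner_right_of_mem_orthogonal (Submodule.subset_span hmem) hu
      exact eq_zero_of_listDet (listDet_ne_zero k) (key 1 (by omega)) (key 2 (by omega))
        (key _ (by omega))
    rw [dim, this, finrank_top]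
    simp
  refine ⟨P, ⟨⟨V, rfl⟩, Or.inr hdim⟩, hdim, ⟨?_⟩⟩
  let e : Fin (order k) ≃ vertices P := Equiv.ofBijective
    (fun i => ⟨p i, hV.mem_iff.1 ((memV _).2 ⟨i, rfl⟩)⟩)
    ⟨fun i j h => hinj (congrArg Subtype.val h), fun x => by
      obtain ⟨i, hi⟩ := (memV x).1 (hV.mem_iff.2 x.2)
      exact ⟨i, Subtype.ext hi⟩⟩
  suffices h : ∀ i j, (skeleton P).Adj (e i) (e j) ↔ (polyGraph k).Adj i j from
    (⟨e, fun {i j} => h i j⟩ : polyGraph k ≃g skeleton P).symm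
  intro i j
  rw [polyGraph_adj]
  constructor
  · intro hadj
    by_contra hn
    rw [Bool.not_eq_true] at hn
    have hij : (i : ℕ) ≠ j := fun e => hadj.ne (by rw [Fin.ext e])
    obtain ⟨c, -, hc1, hc2, hc3, l, hl, hcl⟩ := exists_mem_dependencies k i i.2 j j.2 hn hij
    let g : E3 → ℝ := fun x => ∑ t : Fin (order k), if p t = x then (c.getD t 0 : ℝ) else 0
    have hg : ∀ t, g (p t) = c.getD t 0 := by
      intro t
      simp only [g, hinj.eq_iff]
      simp
    have hsum : ∀ {M : Type} [AddCommMonoid M] (f : E3 → M), ∑ x ∈ V, f x = ∑ t, f (p t) :=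
      fun f => Finset.sum_image fun x _ y _ h => hinj h
    obtain ⟨x, hx, hx1, hx2, hpos⟩ := hV.exists_dependency_pos hadj (c := g) (by
        rw [hsum]
        simp only [hg]
        rw [← Finset.sum_range (fun t => (c.getD t 0 : ℝ))]
        exact_mod_cast hc2) (by
        rw [hsum]
        simp only [hg]
        ext x
        have := hc3 x x.2
        rw [← @Int.cast_inj ℝ] at this
        push_cast at this
        rw [Finset.sum_range (fun t => (c.getD t 0 : ℝ) * ((intPoint k t).getD x 0 : ℝ))] at this
        simp only [WithLp.ofLp_sum, WithLp.ofLp_smul, Finset.sum_apply, Pi.smul_apply, smul_eq_mul]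
        refine Eq.trans ?_ (this.trans (by simp))
        refine Finset.sum_congr rfl fun t _ => ?_
        fin_cases x <;> simp [p, toE3]) ⟨p ⟨l, hl⟩, (memV _).2 ⟨_, rfl⟩, by
          rw [hg]; exact_mod_cast hcl⟩
    obtain ⟨t, rfl⟩ := (memV x).1 hx
    rw [hg] at hpos
    have := hc1 t t.2 (fun h => hx1 (by rw [Fin.ext h]; rfl)) (fun h => hx2 (by rw [Fin.ext h]; rfl))
    have h2 : (0 : ℤ) < c.getD t 0 := by exact_mod_cast hpos
    omega
  · intro hT
    obtain ⟨h1, h2⟩ := strict_edgeNormal k i i.2 j j.2 hT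
    rw [hV.adj_iff]
    refine ⟨fun h => ?_, toE3 (edgeNormal k i j), ?_, fun q hq hqi hqj => ?_⟩
    · have : i = j := hinj h
      subst this
      simp [edgeTable] at hT
    · change (inner ℝ _ (toE3 _) : ℝ) = inner ℝ _ (toE3 _)
      rw [inner_toE3, inner_toE3]
      exact_mod_cast h1
    · obtain ⟨l, rfl⟩ := (memV q).1 hq
      exact hlt _ _ _ (h2 l l.2 (fun h => hqi (by rw [Fin.ext h]; rfl))
        (fun h => hqj (by rw [Fin.ext h]; rfl)))

theorem polyhedral_iff {m : ℕ} (hm : m ≤ 6) (G : SimpleGraph (Fin m)) :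
    IsPolyhedral G ↔ ∃ k, Nonempty (G ≃g polyGraph k) := by
  constructor
  · rintro ⟨P, hP, hd, ⟨φ⟩⟩
    obtain ⟨V, hV⟩ := exists_isVertexSet hP.polytope
    exact ((hV.admissible hd).of_iso φ).exists_iso (by simpa using hm)
  · rintro ⟨k, ⟨φ⟩⟩
    obtain ⟨P, hP, hd, ⟨ψ⟩⟩ := isPolyhedral_polyGraph k
    exact ⟨P, hP, hd, ⟨ψ.trans φ.symm⟩⟩

end HexGlue

end

noncomputable section

namespace HexGlue

open Set MeasureTheory Real

/-! ### Areas of sectors and volumes of lunes -/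

theorem lintegral_ofReal_Ioo {r : ℝ} (hr : 0 ≤ r) :
    ∫⁻ x in Ioo 0 r, ENNReal.ofReal x = ENNReal.ofReal (r ^ 2 / 2) := by
  have h : ∫ x in Ioo 0 r, x = r ^ 2 / 2 := by
    rw [← integral_Ioc_eq_integral_Ioo, ← intervalIntegral.integral_of_le hr, integral_id]
    ring
  rw [← h, ofReal_integral_eq_lintegral_ofReal]
  · exact (intervalIntegrable_iff_integrableOn_Ioo_of_le hr).1 intervalIntegral.intervalIntegrable_id
  · filter_upwards [ae_restrict_mem measurableSet_Ioo] with x hx using hx.1.le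

/-- The area of a sector. -/
theorem volume_sector {r α β : ℝ} (hr : 0 ≤ r) (hα : -π ≤ α) (hβ : β ≤ π) :
    volume {z : ℂ | ‖z‖ < r ∧ α ≤ z.arg ∧ z.arg ≤ β} =
      ENNReal.ofReal (r ^ 2 / 2) * ENNReal.ofReal (β - α) := by
  set S : Set ℂ := {z : ℂ | ‖z‖ < r ∧ α ≤ z.arg ∧ z.arg ≤ β} with hS
  have hmeas : MeasurableSet S :=
    (measurableSet_lt measurable_norm measurable_const).inter
      ((measurableSet_le measurable_const Complex.measurable_arg).inter
        (measurableSet_le Complex.measurable_arg measurable_const))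
  rw [← lintegral_indicator_one hmeas, ← Complex.lintegral_comp_polarCoord_symm]
  set R : Set (ℝ × ℝ) := Ioo 0 r ×ˢ (Icc α β ∩ Ioo (-π) π) with hR
  have hRm : MeasurableSet R :=
    measurableSet_Ioo.prod (measurableSet_Icc.inter measurableSet_Ioo)
  have hsub : R ⊆ polarCoord.target := by
    rintro ⟨x, y⟩ ⟨⟨h1, h2⟩, -, h3⟩
    exact ⟨h1, h3⟩
  have hcongr : ∀ p ∈ polarCoord.target,
      ENNReal.ofReal p.1 • (S.indicator 1 (Complex.polarCoord.symm p) : ENNReal) =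
      R.indicator (fun p => ENNReal.ofReal p.1) p := by
    rintro ⟨ρ, φ⟩ ⟨h1, h2⟩
    have h1' : 0 < ρ := h1
    have harg : (Complex.polarCoord.symm (ρ, φ)).arg = φ := by
      rw [Complex.polarCoord_symm_apply]
      push_cast
      exact Complex.arg_mul_cos_add_sin_mul_I h1' ⟨h2.1, h2.2.le⟩
    have hnorm : ‖Complex.polarCoord.symm (ρ, φ)‖ = ρ := by
      rw [Complex.norm_polarCoord_symm]; exact abs_of_pos h1'
    have hiff : Complex.polarCoord.symm (ρ, φ) ∈ S ↔ ρ < r ∧ α ≤ φ ∧ φ ≤ β := by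
      rw [hS, mem_ofPred_eq, harg, hnorm]
    by_cases h : ρ < r ∧ α ≤ φ ∧ φ ≤ β
    · rw [indicator_of_mem (hiff.2 h),
        indicator_of_mem (show (ρ, φ) ∈ R from ⟨⟨h1', h.1⟩, h.2, h2⟩)]
      simp
    · rw [indicator_of_notMem (fun hc => h (hiff.1 hc)),
        indicator_of_notMem (show (ρ, φ) ∉ R from fun hc => h ⟨hc.1.2, hc.2.1⟩)]
      simp
  have hang : volume (Icc α β ∩ Ioo (-π) π) = ENNReal.ofReal (β - α) := by
    refine le_antisymm ((measure_mono inter_subset_left).trans_eq Real.volume_Icc) ?_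
    rw [← Real.volume_Ioo]
    exact measure_mono fun t ht => ⟨⟨ht.1.le, ht.2.le⟩, hα.trans_lt ht.1, ht.2.trans_le hβ⟩
  rw [setLIntegral_congr_fun polarCoord.open_target.measurableSet hcongr,
    setLIntegral_indicator hRm, inter_eq_self_of_subset_left hsub, Measure.volume_eq_prod, hR,
    ← Measure.prod_restrict]
  have := lintegral_prod_mul (μ := volume.restrict (Ioo 0 r))
    (ν := volume.restrict (Icc α β ∩ Ioo (-π) π))
    (f := fun x : ℝ => ENNReal.ofReal x) (g := fun _ => 1) (by fun_prop) (by fun_prop)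
  simp only [mul_one] at this
  rw [this, lintegral_ofReal_Ioo hr]
  simp [hang]

/-- The area of a double sector. -/
theorem volume_lune_normal {r θ : ℝ} (hr : 0 ≤ r) (h0 : 0 ≤ θ) (hπ : θ ≤ π) :
    volume {z : ℂ | ‖z‖ < r ∧ z.re * (cos θ * z.re + sin θ * z.im) < 0} =
      ENNReal.ofReal (θ / π) * volume (Metric.ball (0 : ℂ) r) := by
  let S : Set ℂ := {z : ℂ | ‖z‖ < r ∧ 0 < z.re ∧ cos θ * z.re + sin θ * z.im < 0}
  have hmeas : MeasurableSet S := by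
    have h1 : IsOpen {z : ℂ | ‖z‖ < r} := isOpen_lt (by fun_prop) (by fun_prop)
    have h2 : IsOpen {z : ℂ | 0 < z.re} := isOpen_lt (by fun_prop) (by fun_prop)
    have h3 : IsOpen {z : ℂ | cos θ * z.re + sin θ * z.im < 0} :=
      isOpen_lt (by fun_prop) (by fun_prop)
    exact (h1.and (h2.and h3)).measurableSet
  have hvol : volume S = ENNReal.ofReal (r ^ 2 / 2) * ENNReal.ofReal θ := by
    have key : ∀ z : ℂ, z ≠ 0 → (0 < z.re ↔ 0 < cos z.arg) ∧
        (cos θ * z.re + sin θ * z.im < 0 ↔ cos (z.arg - θ) < 0) := by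
      intro z hz
      have hn : 0 < ‖z‖ := norm_pos_iff.2 hz
      have hre : ‖z‖ * cos z.arg = z.re := Complex.norm_mul_cos_arg z
      have him : ‖z‖ * sin z.arg = z.im := Complex.norm_mul_sin_arg z
      have h1 : cos θ * z.re + sin θ * z.im = ‖z‖ * cos (z.arg - θ) := by
        rw [cos_sub, ← hre, ← him]; ring
      rw [h1, ← hre]
      exact ⟨mul_pos_iff_of_pos_left hn, by rw [mul_neg_iff]; constructor <;> intro h <;>
        [(rcases h with h | h <;> [exact h.2; linarith [h.1]]); exact Or.inl ⟨hn, h⟩]⟩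
    rw [show θ = (θ - π / 2) - (-(π / 2)) by ring,
      ← volume_sector hr (by linarith [pi_pos]) (by linarith)]
    refine le_antisymm (measure_mono ?_) ?_
    · rintro z ⟨hzr, h2, h3⟩
      have hz : z ≠ 0 := by rintro rfl; simp at h2
      have h2 := (key z hz).1.1 h2
      have h3 := (key z hz).2.1 h3
      have hp := Complex.neg_pi_lt_arg z
      have hp' := Complex.arg_le_pi z
      refine ⟨hzr, ?_⟩
      generalize z.arg = φ at *
      have h4 : -(π / 2) < φ := by
        by_contra! hc
        have := cos_nonpos_of_pi_div_two_le_of_le (x := -φ) (by linarith) (by linarith)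
        rw [cos_neg] at this
        linarith
      refine ⟨h4.le, ?_⟩
      by_contra! hc
      have h5 : φ < π / 2 := by
        by_contra! hc
        have := cos_nonpos_of_pi_div_two_le_of_le (x := φ) (by linarith) (by linarith)
        linarith
      have := cos_nonneg_of_neg_pi_div_two_le_of_le (x := φ - θ) (by linarith) (by linarith)
      linarith
    · have hnull : volume ({z : ℂ | z.re = 0} ∪ {z : ℂ | cos θ * z.re + sin θ * z.im = 0}) = 0 := by
        have hline : ∀ a b : ℝ, a ≠ 0 ∨ b ≠ 0 →
            volume {z : ℂ | a * z.re + b * z.im = 0} = 0 := by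
          intro a b hab
          let f : ℂ →ₗ[ℝ] ℝ := a • Complex.reLm + b • Complex.imLm
          have : {z : ℂ | a * z.re + b * z.im = 0} = (LinearMap.ker f : Set ℂ) := by
            ext z; simp [f]
          rw [this]
          refine Measure.addHaar_submodule volume _ fun htop => ?_
          have hf : f = 0 := LinearMap.ker_eq_top.1 htop
          have h1 := congrArg (fun g : ℂ →ₗ[ℝ] ℝ => g 1) hf
          have h2 := congrArg (fun g : ℂ →ₗ[ℝ] ℝ => g Complex.I) hf
          simp [f] at h1 h2
          rcases hab with h | h
          · exact h h1
          · exact h h2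
        refine measure_union_null ?_ (hline _ _ ?_)
        · simpa using hline 1 0 (by simp)
        · by_contra! hc
          have := sin_sq_add_cos_sq θ
          rw [hc.1, hc.2] at this
          norm_num at this
      refine (measure_mono fun z hz => ?_).trans
        ((measure_union_le S _).trans (by rw [hnull, add_zero]))
      obtain ⟨hzr, h2, h3⟩ := hz
      by_cases hb : z ∈ {z : ℂ | z.re = 0} ∪ {z : ℂ | cos θ * z.re + sin θ * z.im = 0}
      · exact Or.inr hb
      refine Or.inl ⟨hzr, ?_⟩
      simp only [mem_union, mem_ofPred_eq, not_or] at hb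
      have hz : z ≠ 0 := by rintro rfl; simp at hb
      refine ⟨lt_of_le_of_ne ?_ (Ne.symm hb.1), lt_of_le_of_ne ?_ hb.2⟩
      · rw [← Complex.norm_mul_cos_arg z]
        exact mul_nonneg (norm_nonneg _)
          (cos_nonneg_of_neg_pi_div_two_le_of_le h2 (by linarith))
      · by_contra! hc
        have h4 : 0 < ‖z‖ * cos (z.arg - θ) := by
          rw [cos_sub, mul_add]
          have hre := Complex.norm_mul_cos_arg z
          have him := Complex.norm_mul_sin_arg z
          calc 0 < _ := hc
            _ = _ := by rw [← hre, ← him]; ring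
        have h5 : 0 ≤ cos (z.arg - θ + π) := by
          by_cases hq : -(π / 2) ≤ z.arg - θ + π
          · exact cos_nonneg_of_neg_pi_div_two_le_of_le hq (by linarith)
          · linarith
        rw [cos_add_pi] at h5
        have h6 : 0 ≤ ‖z‖ := norm_nonneg z
        nlinarith
  have hunion : {z : ℂ | ‖z‖ < r ∧ z.re * (cos θ * z.re + sin θ * z.im) < 0} = S ∪ -S := by
    ext z
    simp only [S, mem_ofPred_eq, mem_union, mem_neg, norm_neg, Complex.neg_re, Complex.neg_im,
      mul_neg_iff]
    constructor
    · rintro ⟨h, h1 | h1⟩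
      · exact Or.inl ⟨h, h1⟩
      · exact Or.inr ⟨h, by linarith, by linarith⟩
    · rintro (⟨h, h1⟩ | ⟨h, h1, h2⟩)
      · exact ⟨h, Or.inl h1⟩
      · exact ⟨h, Or.inr ⟨by linarith, by linarith⟩⟩
  rw [hunion, measure_union, Measure.measure_neg, hvol, Complex.volume_ball]
  · rw [← two_mul, ← mul_assoc, ← ENNReal.ofReal_ofNat, ← ENNReal.ofReal_mul (by norm_num),
      ← ENNReal.ofReal_mul (by positivity), ← ENNReal.ofReal_pow hr,
      show (NNReal.pi : ENNReal) = ENNReal.ofReal π by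
        rw [← NNReal.coe_real_pi, ENNReal.ofReal_coe_nnreal],
      ← ENNReal.ofReal_mul (by positivity), ← ENNReal.ofReal_mul (by positivity)]
    congr 1
    field_simp
  · rw [disjoint_left]
    rintro z ⟨-, h, -⟩ ⟨-, h', -⟩
    rw [Complex.neg_re] at h'
    linarith
  · exact hmeas.neg

/-- An orthonormal basis adapted to two nonzero vectors. -/
theorem exists_frame {x y : E3} (hx : x ≠ 0) (hy : y ≠ 0) :
    ∃ b : OrthonormalBasis (Fin 3) ℝ E3, x = ‖x‖ • b 0 ∧
      y = ‖y‖ • (cos (InnerProductGeometry.angle x y) • b 0 +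
        sin (InnerProductGeometry.angle x y) • b 1) := by
  have hunit : ∀ f : E3, f ≠ 0 → ‖‖f‖⁻¹ • f‖ = 1 := fun f hf => by
    rw [norm_smul, norm_inv, norm_norm, inv_mul_cancel₀ (norm_ne_zero_iff.2 hf)]
  obtain ⟨θ, hθ⟩ : ∃ θ, θ = InnerProductGeometry.angle x y := ⟨_, rfl⟩
  rw [← hθ]
  have hxn : 0 < ‖x‖ := norm_pos_iff.2 hx
  have hyn : 0 < ‖y‖ := norm_pos_iff.2 hy
  obtain ⟨e₀, h0, hxe, hin⟩ : ∃ e₀ : E3, ‖e₀‖ = 1 ∧ x = ‖x‖ • e₀ ∧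
      (inner ℝ e₀ y : ℝ) = ‖y‖ * cos θ := by
    refine ⟨‖x‖⁻¹ • x, hunit x hx, ?_, ?_⟩
    · rw [smul_smul, mul_inv_cancel₀ hxn.ne', one_smul]
    · have := InnerProductGeometry.cos_angle_mul_norm_mul_norm x y
      rw [inner_smul_left, ← this, ← hθ]
      simp only [conj_trivial]
      field_simp
  have hself : (inner ℝ e₀ e₀ : ℝ) = 1 := by rw [real_inner_self_eq_norm_sq, h0]; norm_num
  obtain ⟨y', hy'⟩ : ∃ y', y' = y - (‖y‖ * cos θ) • e₀ := ⟨_, rfl⟩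
  have hyy : y = (‖y‖ * cos θ) • e₀ + y' := by rw [hy']; abel
  have hperp : (inner ℝ e₀ y' : ℝ) = 0 := by
    rw [hy', inner_sub_right, inner_smul_right, hin, hself]; ring
  have hnorm : ‖y'‖ = ‖y‖ * sin θ := by
    have h1 : ‖y'‖ ^ 2 = (‖y‖ * sin θ) ^ 2 := by
      rw [← real_inner_self_eq_norm_sq, hy', inner_sub_left, inner_sub_right, inner_sub_right,
        inner_smul_left, inner_smul_right, inner_smul_left, inner_smul_right, hself,
        real_inner_comm e₀ y, hin, real_inner_self_eq_norm_sq]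
      simp only [conj_trivial]
      have := sin_sq_add_cos_sq θ
      linear_combination -‖y‖ ^ 2 * this
    have hs : 0 ≤ ‖y‖ * sin θ :=
      mul_nonneg hyn.le (hθ ▸ InnerProductGeometry.sin_angle_nonneg x y)
    exact (sq_eq_sq₀ (norm_nonneg _) hs).1 h1
  obtain ⟨e₁, h1, h01, hye⟩ : ∃ e₁ : E3, ‖e₁‖ = 1 ∧ inner ℝ e₀ e₁ = (0 : ℝ) ∧
      y' = (‖y‖ * sin θ) • e₁ := by
    by_cases hz : y' = 0
    · obtain ⟨f, hf, hfe, -⟩ := exists_ne_zero_orthogonal e₀ e₀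
      refine ⟨‖f‖⁻¹ • f, hunit f hf, ?_, ?_⟩
      · rw [inner_smul_right, real_inner_comm, hfe, mul_zero]
      · rw [← hnorm, hz, norm_zero, zero_smul]
    · refine ⟨‖y'‖⁻¹ • y', hunit _ hz, ?_, ?_⟩
      · rw [inner_smul_right, hperp, mul_zero]
      · rw [← hnorm, smul_smul, mul_inv_cancel₀ (norm_ne_zero_iff.2 hz), one_smul]
  obtain ⟨e₂, h2, h20, h21⟩ : ∃ e₂ : E3, ‖e₂‖ = 1 ∧ inner ℝ e₂ e₀ = (0 : ℝ) ∧
      inner ℝ e₂ e₁ = (0 : ℝ) := by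
    obtain ⟨f, hf, hf0, hf1⟩ := exists_ne_zero_orthogonal e₀ e₁
    exact ⟨‖f‖⁻¹ • f, hunit f hf, by rw [inner_smul_left, hf0, mul_zero],
      by rw [inner_smul_left, hf1, mul_zero]⟩
  have hon : Orthonormal ℝ ![e₀, e₁, e₂] := by
    have h10 := (real_inner_comm e₀ e₁).trans h01
    have h02 := (real_inner_comm e₂ e₀).trans h20
    have h12 := (real_inner_comm e₂ e₁).trans h21
    rw [orthonormal_iff_ite]
    intro i j
    fin_cases i <;> fin_cases j <;> simp [h0, h1, h2, h01, h20, h21, h10, h02, h12]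
  refine ⟨OrthonormalBasis.mk hon (by
    rw [hon.linearIndependent.span_eq_top_of_card_eq_finrank' (by simp)]), ?_, ?_⟩
  · simpa using hxe
  · simp only [OrthonormalBasis.coe_mk, Matrix.cons_val_zero, Matrix.cons_val_one]
    rw [smul_add, smul_smul, smul_smul, ← hye]
    exact hyy

/-- The isometry from `ℂ × ℝ`, as far as volumes are concerned, given by an orthonormal basis. -/
theorem exists_measurePreserving (b : OrthonormalBasis (Fin 3) ℝ E3) :
    ∃ T : ℂ × ℝ → E3, MeasurePreserving T ∧ ∀ z t, ‖T (z, t)‖ ^ 2 = ‖z‖ ^ 2 + t ^ 2 ∧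
      inner ℝ (b 0) (T (z, t)) = z.re ∧ inner ℝ (b 1) (T (z, t)) = z.im := by
  let e : ℂ × ℝ → ℝ × (Fin 2 → ℝ) := Prod.swap ∘ Prod.map Complex.measurableEquivPi id
  have he : MeasurePreserving e := (Measure.measurePreserving_swap).comp
    (Complex.volume_preserving_equiv_pi.prod (MeasurePreserving.id volume))
  let g := (MeasurableEquiv.piFinSuccAbove (fun _ : Fin 3 => ℝ) 2).symm
  have hg : MeasurePreserving g := (volume_preserving_piFinSuccAbove (fun _ : Fin 3 => ℝ) 2).symm _
  refine ⟨fun p => b.repr.symm (WithLp.toLp 2 (g (e p))), b.measurePreserving_repr_symm.comp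
    ((PiLp.volume_preserving_toLp (Fin 3)).comp (hg.comp he)), fun z t => ?_⟩
  have hval : g (e (z, t)) = ![z.re, z.im, t] := by
    ext i
    fin_cases i <;> rfl
  have hin : ∀ i, inner ℝ (b i) (b.repr.symm (WithLp.toLp 2 (g (e (z, t))))) =
      g (e (z, t)) i := by
    intro i
    rw [← b.repr_apply_apply, LinearIsometryEquiv.apply_symm_apply]
  refine ⟨?_, by rw [hin, hval]; rfl, by rw [hin, hval]; rfl⟩
  rw [LinearIsometryEquiv.norm_map, EuclideanSpace.norm_sq_eq, hval, Fin.sum_univ_three,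
    Complex.sq_norm, Complex.normSq_apply]
  simp [sq]

/-- The volume of a double lune, in terms of the angle between the normals of its sides. -/
theorem volume_lune {x y : E3} (hx : x ≠ 0) (hy : y ≠ 0) :
    volume {ω : E3 | ‖ω‖ < 1 ∧ inner ℝ ω x * inner ℝ ω y < (0 : ℝ)} =
      ENNReal.ofReal (InnerProductGeometry.angle x y / π) * volume (Metric.ball (0 : E3) 1) := by
  obtain ⟨b, hxb, hyb⟩ := exists_frame hx hy
  obtain ⟨T, hT, hTv⟩ := exists_measurePreserving b
  have hθ0 := InnerProductGeometry.angle_nonneg x y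
  have hθπ := InnerProductGeometry.angle_le_pi x y
  generalize InnerProductGeometry.angle x y = θ at *
  have hxn : 0 < ‖x‖ := norm_pos_iff.2 hx
  have hyn : 0 < ‖y‖ := norm_pos_iff.2 hy
  have hopen : IsOpen {ω : E3 | ‖ω‖ < 1 ∧ inner ℝ ω x * inner ℝ ω y < (0 : ℝ)} := by
    have h1 : IsOpen {ω : E3 | ‖ω‖ < 1} := isOpen_lt (by fun_prop) (by fun_prop)
    have h2 : IsOpen {ω : E3 | inner ℝ ω x * inner ℝ ω y < (0 : ℝ)} :=
      isOpen_lt (by fun_prop) (by fun_prop)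
    exact h1.and h2
  have hball : MeasurableSet (Metric.ball (0 : E3) 1) := measurableSet_ball
  have hlt : ∀ (z : ℂ) (t : ℝ), ‖T (z, t)‖ < 1 ↔ ‖z‖ < √(1 - t ^ 2) := by
    intro z t
    rw [Real.lt_sqrt (norm_nonneg _), ← sq_lt_one_iff₀ (norm_nonneg _), (hTv z t).1, lt_sub_iff_add_lt]
  have hprod : ∀ (z : ℂ) (t : ℝ), inner ℝ (T (z, t)) x * inner ℝ (T (z, t)) y < (0 : ℝ) ↔
      z.re * (cos θ * z.re + sin θ * z.im) < 0 := by
    intro z t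
    have e1 : (inner ℝ (T (z, t)) x : ℝ) = ‖x‖ * z.re := by
      conv_lhs => rw [hxb]
      rw [inner_smul_right, real_inner_comm, (hTv z t).2.1]
    have e2 : (inner ℝ (T (z, t)) y : ℝ) = ‖y‖ * (cos θ * z.re + sin θ * z.im) := by
      conv_lhs => rw [hyb]
      rw [inner_smul_right, inner_add_right, inner_smul_right, inner_smul_right,
        real_inner_comm, (hTv z t).2.1, real_inner_comm, (hTv z t).2.2]
    rw [e1, e2, show ‖x‖ * z.re * (‖y‖ * (cos θ * z.re + sin θ * z.im)) =
      (‖x‖ * ‖y‖) * (z.re * (cos θ * z.re + sin θ * z.im)) by ring]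
    constructor
    · intro h
      by_contra! hc
      exact absurd h (not_lt.2 (mul_nonneg (by positivity) hc))
    · exact fun h => mul_neg_of_pos_of_neg (by positivity) h
  rw [← hT.measure_preimage hopen.measurableSet.nullMeasurableSet,
    ← hT.measure_preimage hball.nullMeasurableSet,
    Measure.volume_eq_prod, Measure.prod_apply_symm (hT.measurable hopen.measurableSet),
    Measure.prod_apply_symm (hT.measurable hball), ← lintegral_const_mul]
  · congr 1
    ext t
    have h1 : (fun z : ℂ => (z, t)) ⁻¹' (T ⁻¹' Metric.ball 0 1) = Metric.ball 0 √(1 - t ^ 2) := by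
      ext z
      rw [mem_preimage, mem_preimage, mem_ball_zero_iff, mem_ball_zero_iff, hlt]
    rw [h1, ← volume_lune_normal (Real.sqrt_nonneg _) hθ0 hθπ]
    congr 1
    ext z
    rw [mem_preimage, mem_preimage, mem_ofPred_eq, mem_ofPred_eq, hlt, hprod]
  · exact measurable_measure_prodMk_right (hT.measurable hball)

end HexGlue

end

noncomputable section

namespace HexGlue

open Set MeasureTheory Real

/-! ### Planar cones and the angles of faces -/

theorem eq_zero_of_inner_eq_zero {a b c d : E3} (hli : LinearIndependent ℝ ![a, b, c])
    (ha : inner ℝ a d = (0 : ℝ)) (hb : inner ℝ b d = (0 : ℝ)) (hc : inner ℝ c d = (0 : ℝ)) :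
    d = 0 := by
  have htop := hli.span_eq_top_of_card_eq_finrank' (by simp)
  have hd : d ∈ (Submodule.span ℝ (range ![a, b, c]))ᗮ := by
    rw [Submodule.mem_orthogonal]
    intro w hw
    induction hw using Submodule.span_induction with
    | mem w hw => 
      obtain ⟨i, rfl⟩ := hw
      fin_cases i <;> assumption
    | zero => simp
    | add w w' _ _ h h' => rw [inner_add_left, h, h', add_zero]
    | smul c w _ h => rw [inner_smul_left, h, mul_zero]
  rw [htop] at hd
  simpa using hd

/-- A pointed planar cone generated by finitely many vectors is generated by two of them. -/
theorem exists_cone_generators {Z : Finset E3} (hZ : Z.Nonempty) {n h : E3} (hn : n ≠ 0)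
    (hnz : ∀ z ∈ Z, inner ℝ n z = (0 : ℝ)) (hh : ∀ z ∈ Z, inner ℝ h z < (0 : ℝ)) :
    ∃ x ∈ Z, ∃ y ∈ Z, ∀ z ∈ Z, ∃ s t : ℝ, 0 ≤ s ∧ 0 ≤ t ∧ z = s • x + t • y := by
  obtain ⟨k, hk, hkn, hkh⟩ := exists_ne_zero_orthogonal n h
  obtain ⟨z₀, hz₀⟩ := hZ
  have hli : LinearIndependent ℝ ![k, h, n] := by
    rw [Fintype.linearIndependent_iff]
    intro g hg
    simp only [Fin.sum_univ_three, Matrix.cons_val_zero, Matrix.cons_val_one,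
      Matrix.cons_val] at hg
    have h0 : g 0 = 0 := by
      have := congrArg (inner ℝ k) hg
      simp only [inner_add_right, inner_smul_right, hkn, hkh, inner_zero_right, mul_zero,
        add_zero] at this
      exact (mul_eq_zero.1 this).resolve_right (inner_self_ne_zero.2 hk)
    rw [h0, zero_smul, zero_add] at hg
    have h1 : g 1 = 0 := by
      have := congrArg (fun w => inner ℝ w z₀) hg
      simp only [inner_add_left, inner_smul_left, hnz z₀ hz₀, inner_zero_left, mul_zero,
        add_zero, conj_trivial] at this
      exact (mul_eq_zero.1 this).resolve_right (hh z₀ hz₀).ne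
    rw [h1, zero_smul, zero_add] at hg
    have h2 : g 2 = 0 := (smul_eq_zero.1 hg).resolve_right hn
    intro i
    fin_cases i <;> assumption
  have hzero : ∀ d : E3, inner ℝ k d = (0 : ℝ) → inner ℝ h d = (0 : ℝ) →
      inner ℝ n d = (0 : ℝ) → d = 0 := fun d => eq_zero_of_inner_eq_zero hli
  let ρ : E3 → ℝ := fun z => inner ℝ k z / (-inner ℝ h z)
  obtain ⟨x, hx, hmin⟩ := Z.exists_min_image ρ ⟨z₀, hz₀⟩
  obtain ⟨y, hy, hmax⟩ := Z.exists_max_image ρ ⟨z₀, hz₀⟩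
  refine ⟨x, hx, y, hy, fun z hz => ?_⟩
  have hpos : ∀ w ∈ Z, 0 < -(inner ℝ h w : ℝ) := fun w hw => by linarith [hh w hw]
  have hk' : ∀ w ∈ Z, (inner ℝ k w : ℝ) = ρ w * -inner ℝ h w := fun w hw => by
    simp only [ρ]; rw [div_mul_cancel₀ _ (hpos w hw).ne']
  obtain ⟨l, hl0, hl1, hl⟩ : ∃ l : ℝ, 0 ≤ l ∧ l ≤ 1 ∧ ρ z = (1 - l) * ρ x + l * ρ y := by
    have h1 := hmin z hz
    have h2 := hmax z hz
    rcases eq_or_lt_of_le (h1.trans h2) with h3 | h3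
    · exact ⟨0, le_rfl, zero_le_one, by linarith⟩
    · have hd : 0 < ρ y - ρ x := by linarith
      refine ⟨(ρ z - ρ x) / (ρ y - ρ x), div_nonneg (by linarith) hd.le,
        (div_le_one hd).2 (by linarith), ?_⟩
      field_simp
      ring
  have hx' := hpos x hx
  have hy' := hpos y hy
  have hz' := hpos z hz
  refine ⟨-inner ℝ h z * (1 - l) / -inner ℝ h x, -inner ℝ h z * l / -inner ℝ h y, ?_, ?_, ?_⟩
  · exact div_nonneg (mul_nonneg hz'.le (by linarith)) hx'.le
  · exact div_nonneg (mul_nonneg hz'.le hl0) hy'.le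
  rw [← sub_eq_zero]
  apply hzero
  · simp only [inner_sub_right, inner_add_right, inner_smul_right]
    rw [hk' x hx, hk' y hy, hk' z hz, hl]
    have h1 : (inner ℝ h x : ℝ) ≠ 0 := by linarith
    have h2 : (inner ℝ h y : ℝ) ≠ 0 := by linarith
    field_simp
    ring
  · simp only [inner_sub_right, inner_add_right, inner_smul_right]
    have h1 : (inner ℝ h x : ℝ) ≠ 0 := by linarith
    have h2 : (inner ℝ h y : ℝ) ≠ 0 := by linarith
    field_simp
    ring
  · simp only [inner_sub_right, inner_add_right, inner_smul_right]
    rw [hnz x hx, hnz y hy, hnz z hz]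
    ring

/-- `F` lies in the convex planar cone with apex `v` spanned by its points `x` and `y`. -/
structure IsPlaneCone (F : Set E3) (v x y : E3) : Prop where
  left_mem : x ∈ F
  right_mem : y ∈ F
  linearIndependent : LinearIndependent ℝ ![x - v, y - v]
  exists_eq : ∀ p ∈ F, ∃ s t : ℝ, 0 ≤ s ∧ 0 ≤ t ∧ p - v = s • (x - v) + t • (y - v)

theorem exists_normal {F : Set E3} (hd : dim F = 2) :
    ∃ n : E3, n ≠ 0 ∧ ∀ w ∈ vectorSpan ℝ F, inner ℝ n w = (0 : ℝ) := by
  have h := (vectorSpan ℝ F).finrank_add_finrank_orthogonal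
  rw [show Module.finrank ℝ (vectorSpan ℝ F) = 2 from hd] at h
  simp only [finrank_euclideanSpace, Fintype.card_fin] at h
  have hne : (vectorSpan ℝ F)ᗮ ≠ ⊥ := by
    intro hbot
    rw [hbot, finrank_bot] at h
    omega
  obtain ⟨n, hn, hn0⟩ := Submodule.exists_mem_ne_zero_of_ne_bot hne
  exact ⟨n, hn0, fun w hw => (Submodule.mem_orthogonal' _ _).1 hn w hw⟩

theorem exists_isPlaneCone {A : Set E3} (hA : A.Finite) {v h : E3} (hv : v ∈ A)
    (hh : ∀ p ∈ A, p ≠ v → inner ℝ h (p - v) < (0 : ℝ)) (hd : dim (convexHull ℝ A) = 2) :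
    ∃ x ∈ A, ∃ y ∈ A, IsPlaneCone (convexHull ℝ A) v x y := by
  classical
  obtain ⟨n, hn, hnw⟩ := exists_normal hd
  have hspan : vectorSpan ℝ (convexHull ℝ A) = Submodule.span ℝ ((fun p => p - v) '' A) := by
    rw [← direction_affineSpan, affineSpan_convexHull, direction_affineSpan,
      vectorSpan_eq_span_vsub_set_right ℝ hv]
    simp
  let Z : Finset E3 := (hA.toFinset.erase v).image fun p => p - v
  have hZm : ∀ z, z ∈ Z ↔ ∃ p ∈ A, p ≠ v ∧ p - v = z := by
    intro z
    simp only [Z, Finset.mem_image, Finset.mem_erase, Finite.mem_toFinset]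
    constructor
    · rintro ⟨p, ⟨h1, h2⟩, h3⟩; exact ⟨p, h2, h1, h3⟩
    · rintro ⟨p, h1, h2, h3⟩; exact ⟨p, ⟨h2, h1⟩, h3⟩
  have hZ : Z.Nonempty := by
    by_contra hZ
    rw [Finset.not_nonempty_iff_eq_empty] at hZ
    have h0 : vectorSpan ℝ (convexHull ℝ A) = ⊥ := by
      rw [hspan, Submodule.span_eq_bot]
      rintro _ ⟨p, hp, rfl⟩
      by_contra hne
      have : p - v ∈ Z := (hZm _).2 ⟨p, hp, fun h => hne (by simp [h]), rfl⟩
      rw [hZ] at this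
      simp at this
    have h2 : Module.finrank ℝ (vectorSpan ℝ (convexHull ℝ A)) = 2 := hd
    rw [h0, finrank_bot] at h2
    omega
  obtain ⟨x', hx', y', hy', hcone⟩ := exists_cone_generators hZ (n := n) (h := h) hn
    (fun z hz => by
      obtain ⟨p, hp, -, rfl⟩ := (hZm z).1 hz
      exact hnw _ (vsub_mem_vectorSpan ℝ (subset_convexHull ℝ A hp) (subset_convexHull ℝ A hv)))
    (fun z hz => by
      obtain ⟨p, hp, hpv, rfl⟩ := (hZm z).1 hz
      exact hh p hp hpv)
  obtain ⟨x, hx, hxv, rfl⟩ := (hZm _).1 hx'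
  obtain ⟨y, hy, hyv, rfl⟩ := (hZm _).1 hy'
  have hcone' : ∀ p ∈ A, ∃ s t : ℝ, 0 ≤ s ∧ 0 ≤ t ∧ p - v = s • (x - v) + t • (y - v) := by
    intro p hp
    by_cases hpv : p = v
    · exact ⟨0, 0, le_rfl, le_rfl, by simp [hpv]⟩
    · exact hcone _ ((hZm _).2 ⟨p, hp, hpv, rfl⟩)
  refine ⟨x, hx, y, hy, subset_convexHull ℝ A hx, subset_convexHull ℝ A hy, ?_, ?_⟩
  · rw [linearIndependent_iff_card_eq_finrank_span]
    have hle : vectorSpan ℝ (convexHull ℝ A) ≤ Submodule.span ℝ (range ![x - v, y - v]) := by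
      rw [hspan, Submodule.span_le]
      rintro _ ⟨p, hp, rfl⟩
      obtain ⟨s, t, -, -, h⟩ := hcone' p hp
      simp only [h]
      exact Submodule.add_mem _
        (Submodule.smul_mem _ _ (Submodule.subset_span ⟨0, rfl⟩))
        (Submodule.smul_mem _ _ (Submodule.subset_span ⟨1, rfl⟩))
    have h1 := Submodule.finrank_mono hle
    have h2 := finrank_range_le_card (R := ℝ) ![x - v, y - v]
    rw [show Module.finrank ℝ (vectorSpan ℝ (convexHull ℝ A)) = 2 from hd] at h1
    rw [Set.finrank] at *
    simp only [Fintype.card_fin] at *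
    omega
  · intro p hp
    let K : Set E3 := {p | ∃ s t : ℝ, 0 ≤ s ∧ 0 ≤ t ∧ p - v = s • (x - v) + t • (y - v)}
    have hK : Convex ℝ K := by
      rintro p ⟨s, t, hs, ht, hp⟩ q ⟨s', t', hs', ht', hq⟩ a b ha hb hab
      refine ⟨a * s + b * s', a * t + b * t', by positivity, by positivity, ?_⟩
      have : a • p + b • q - v = a • (p - v) + b • (q - v) := by
        have : v = (a + b) • v := by rw [hab, one_smul]
        nth_rewrite 1 [this]
        module
      rw [this, hp, hq]
      module
    exact convexHull_min (s := A) (t := K) hcone' hK hp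

namespace IsPlaneCone

variable {F : Set E3} {v x y : E3}

theorem left_ne (h : IsPlaneCone F v x y) : x - v ≠ 0 := h.linearIndependent.ne_zero 0

theorem right_ne (h : IsPlaneCone F v x y) : y - v ≠ 0 := h.linearIndependent.ne_zero 1

theorem inner_pos_or (h : IsPlaneCone F v x y) {p ω : E3} (hp : p ∈ F)
    (hpos : 0 < (inner ℝ ω (p - v) : ℝ)) :
    0 < (inner ℝ ω (x - v) : ℝ) ∨ 0 < (inner ℝ ω (y - v) : ℝ) := by
  obtain ⟨s, t, hs, ht, e⟩ := h.exists_eq p hp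
  rw [e, inner_add_right, inner_smul_right, inner_smul_right] at hpos
  by_contra! hc
  nlinarith [mul_nonneg hs (neg_nonneg.2 hc.1), mul_nonneg ht (neg_nonneg.2 hc.2)]

theorem inner_neg_or (h : IsPlaneCone F v x y) {p ω : E3} (hp : p ∈ F)
    (hneg : (inner ℝ ω (p - v) : ℝ) < 0) :
    (inner ℝ ω (x - v) : ℝ) < 0 ∨ (inner ℝ ω (y - v) : ℝ) < 0 := by
  have := h.inner_pos_or (ω := -ω) hp (by rw [inner_neg_left]; linarith)
  simpa using this

theorem inner_mul_inner_neg (h : IsPlaneCone F v x y) {p q ω : E3} (hp : p ∈ F) (hq : q ∈ F)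
    (hpos : 0 < (inner ℝ ω (p - v) : ℝ)) (hneg : (inner ℝ ω (q - v) : ℝ) < 0) :
    (inner ℝ ω (x - v) : ℝ) * inner ℝ ω (y - v) < 0 := by
  rcases h.inner_pos_or hp hpos with h1 | h1 <;> rcases h.inner_neg_or hq hneg with h2 | h2
  · linarith
  · exact mul_neg_of_pos_of_neg h1 h2
  · exact mul_neg_of_neg_of_pos h2 h1
  · linarith

theorem angle_le (h : IsPlaneCone F v x y) {p q : E3} (hp : p ∈ F) (hq : q ∈ F) (hpv : p ≠ v)
    (hqv : q ≠ v) : EuclideanGeometry.angle p v q ≤ EuclideanGeometry.angle x v y := by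
  have h1 := volume_lune (sub_ne_zero.2 hpv) (sub_ne_zero.2 hqv)
  have h2 := volume_lune h.left_ne h.right_ne
  have hmono : volume {ω : E3 | ‖ω‖ < 1 ∧ inner ℝ ω (p - v) * inner ℝ ω (q - v) < (0 : ℝ)} ≤
      volume {ω : E3 | ‖ω‖ < 1 ∧ inner ℝ ω (x - v) * inner ℝ ω (y - v) < (0 : ℝ)} := by
    refine measure_mono fun ω hω => ⟨hω.1, ?_⟩
    rcases mul_neg_iff.1 hω.2 with ⟨h3, h4⟩ | ⟨h3, h4⟩
    · exact h.inner_mul_inner_neg hp hq h3 h4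
    · exact h.inner_mul_inner_neg hq hp h4 h3
  rw [h1, h2, ENNReal.mul_le_mul_iff_left (Metric.measure_ball_pos _ _ one_pos).ne'
    measure_ball_lt_top.ne, ENNReal.ofReal_le_ofReal_iff
      (div_nonneg (InnerProductGeometry.angle_nonneg _ _) pi_pos.le),
    div_le_div_iff_of_pos_right pi_pos] at hmono
  exact hmono

theorem faceAngle_eq (h : IsPlaneCone F v x y) :
    faceAngle F v = InnerProductGeometry.angle (x - v) (y - v) := by
  refine IsGreatest.csSup_eq ⟨⟨x, h.left_mem, y, h.right_mem, sub_ne_zero.1 h.left_ne,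
    sub_ne_zero.1 h.right_ne, rfl⟩, ?_⟩
  rintro θ ⟨p, hp, q, hq, hpv, hqv, rfl⟩
  exact h.angle_le hp hq hpv hqv

theorem sin_angle_pos (h : IsPlaneCone F v x y) :
    0 < sin (InnerProductGeometry.angle (x - v) (y - v)) := by
  refine lt_of_le_of_ne (InnerProductGeometry.sin_angle_nonneg _ _) fun h0 => ?_
  have hli := h.linearIndependent
  have hx := h.left_ne
  obtain ⟨b, hxb, hyb⟩ := exists_frame h.left_ne h.right_ne
  rw [← h0, zero_smul, add_zero] at hyb
  rw [LinearIndependent.pair_iff] at hli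
  generalize cos (InnerProductGeometry.angle (x - v) (y - v)) = c at *
  have := hli (‖y - v‖ * c) (-‖x - v‖) (by
    linear_combination (norm := module) (‖y - v‖ * c) • hxb - ‖x - v‖ • hyb)
  exact hx (norm_eq_zero.1 (by linarith [this.2]))

theorem faceAngle_pos (h : IsPlaneCone F v x y) : 0 < faceAngle F v := by
  rw [h.faceAngle_eq]
  refine lt_of_le_of_ne (InnerProductGeometry.angle_nonneg _ _) fun h0 => ?_
  have := h.sin_angle_pos
  rw [← h0, sin_zero] at this
  exact this.false

theorem faceAngle_lt_pi (h : IsPlaneCone F v x y) : faceAngle F v < π := by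
  rw [h.faceAngle_eq]
  refine lt_of_le_of_ne (InnerProductGeometry.angle_le_pi _ _) fun h0 => ?_
  have := h.sin_angle_pos
  rw [h0, sin_pi] at this
  exact this.false

end IsPlaneCone

end HexGlue

end

noncomputable section

namespace HexGlue

open Set MeasureTheory Real

/-! ### The Gaussian curvature and the normal cone -/

theorem linearIndependent_cons {a b u : E3} (hli : LinearIndependent ℝ ![a, b]) (hu : u ≠ 0)
    (ha : inner ℝ u a = (0 : ℝ)) (hb : inner ℝ u b = (0 : ℝ)) :
    LinearIndependent ℝ ![u, a, b] := by
  rw [Fintype.linearIndependent_iff]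
  intro g hg
  simp only [Fin.sum_univ_three, Matrix.cons_val_zero, Matrix.cons_val_one,
    Matrix.cons_val] at hg
  have h0 : g 0 = 0 := by
    have := congrArg (inner ℝ u) hg
    simp only [inner_add_right, inner_smul_right, ha, hb, inner_zero_right, mul_zero,
      add_zero] at this
    exact (mul_eq_zero.1 this).resolve_right (inner_self_ne_zero.2 hu)
  rw [h0, zero_smul, zero_add] at hg
  obtain ⟨h1, h2⟩ := LinearIndependent.pair_iff.1 hli _ _ hg
  intro i
  fin_cases i <;> assumption

theorem unit_normal_eq {a b u w : E3} (hli : LinearIndependent ℝ ![a, b]) (hu : ‖u‖ = 1)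
    (hw : ‖w‖ = 1) (hua : inner ℝ u a = (0 : ℝ)) (hub : inner ℝ u b = (0 : ℝ))
    (hwa : inner ℝ w a = (0 : ℝ)) (hwb : inner ℝ w b = (0 : ℝ)) : w = u ∨ w = -u := by
  have hu0 : u ≠ 0 := by rintro rfl; simp at hu
  have hself : (inner ℝ u u : ℝ) = 1 := by rw [real_inner_self_eq_norm_sq, hu]; norm_num
  have hd : w - (inner ℝ u w : ℝ) • u = 0 := by
    refine eq_zero_of_inner_eq_zero (linearIndependent_cons hli hu0 hua hub) ?_ ?_ ?_
    · rw [inner_sub_right, inner_smul_right, hself]; ring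
    · rw [inner_sub_right, inner_smul_right, real_inner_comm w a, hwa, real_inner_comm u a, hua]; ring
    · rw [inner_sub_right, inner_smul_right, real_inner_comm w b, hwb, real_inner_comm u b, hub]; ring
  have hw' := sub_eq_zero.1 hd
  have hc : |(inner ℝ u w : ℝ)| = 1 := by
    rw [hw', norm_smul, hu, mul_one] at hw
    exact hw
  rcases abs_eq zero_le_one |>.1 hc with h | h <;> rw [h] at hw'
  · left; simpa using hw'
  · right; simpa using hw'

theorem inner_eq_of_mem_face {P : Set E3} {u x y : E3} (hx : x ∈ face P u) (hy : y ∈ face P u) :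
    (inner ℝ u x : ℝ) = inner ℝ u y := le_antisymm (hy.2 x hx.1) (hx.2 y hy.1)

theorem inner_sub_eq_zero_of_mem_face {P : Set E3} {u x y : E3} (hx : x ∈ face P u)
    (hy : y ∈ face P u) : (inner ℝ u (x - y) : ℝ) = 0 := by
  rw [inner_sub_right, inner_eq_of_mem_face hx hy, sub_self]

theorem inner_sub_le_zero {P : Set E3} {u x y : E3} (hx : x ∈ face P u)
    (hy : y ∈ P) : (inner ℝ u (y - x) : ℝ) ≤ 0 := by
  rw [inner_sub_right]; linarith [hx.2 y hy]

theorem mem_face_of_inner {P : Set E3} {u x y : E3} (hx : x ∈ face P u)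
    (hy : y ∈ P) (h : (inner ℝ u (y - x) : ℝ) = 0) : y ∈ face P u := by
  rw [inner_sub_right] at h
  exact ⟨hy, fun z hz => by linarith [hx.2 z hz]⟩

theorem dim_face_eq_two {P : Set E3} {u v p q : E3} (hu : u ≠ 0) (hv : v ∈ face P u)
    (hp : p ∈ face P u) (hq : q ∈ face P u) (hli : LinearIndependent ℝ ![p - v, q - v]) :
    dim (face P u) = 2 := by
  apply le_antisymm
  · have hle : vectorSpan ℝ (face P u) ≤ (ℝ ∙ u)ᗮ := by
      rw [vectorSpan_def, Submodule.span_le]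
      rintro _ ⟨x, hx, y, hy, rfl⟩
      rw [SetLike.mem_coe, Submodule.mem_orthogonal_singleton_iff_inner_right]
      exact inner_sub_eq_zero_of_mem_face hx hy
    have h1 := Submodule.finrank_mono hle
    have h2 := (ℝ ∙ u).finrank_add_finrank_orthogonal
    rw [finrank_span_singleton hu] at h2
    simp only [finrank_euclideanSpace, Fintype.card_fin] at h2
    unfold dim
    omega
  · have hle : Submodule.span ℝ (range ![p - v, q - v]) ≤ vectorSpan ℝ (face P u) := by
      rw [Submodule.span_le]
      rintro _ ⟨i, rfl⟩
      fin_cases i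
      · exact vsub_mem_vectorSpan ℝ hp hv
      · exact vsub_mem_vectorSpan ℝ hq hv
    have h1 := Submodule.finrank_mono hle
    rwa [finrank_span_eq_card hli, Fintype.card_fin] at h1

/-- The outward unit normals of the faces of `P` at `v`. -/
def normalsAt (P : Set E3) (v : E3) : Set E3 := {u | u ∈ faceNormals P ∧ v ∈ face P u}

/-- The plane through `v` orthogonal to `ω` passes through the interior of the face of `P` with
outward normal `u`. -/
def Crosses (V : Finset E3) (P : Set E3) (v ω u : E3) : Prop :=
  ∃ p ∈ V, ∃ q ∈ V, p ∈ face P u ∧ q ∈ face P u ∧ 0 < (inner ℝ ω (p - v) : ℝ) ∧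
    (inner ℝ ω (q - v) : ℝ) < 0

namespace IsVertexSet

variable {V : Finset E3} {P : Set E3}

theorem exists_isPlaneCone_face (hV : IsVertexSet V P) {v u : E3} (hv : v ∈ V)
    (hu : u ∈ normalsAt P v) : ∃ x ∈ V, ∃ y ∈ V, IsPlaneCone (face P u) v x y := by
  obtain ⟨h, hh⟩ := hV.exists_exposing hv
  have hd := hu.1.2
  rw [hV.face_eq u] at hd ⊢
  obtain ⟨x, hx, y, hy, hc⟩ := exists_isPlaneCone
    (A := {p ∈ (V : Set E3) | ∀ q ∈ V, inner ℝ u q ≤ inner ℝ u p})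
    (V.finite_toSet.subset fun p hp => hp.1) (v := v) (h := h)
    ⟨hv, (hV.mem_face_iff.1 hu.2).2⟩ (fun p hp hpv => hh p hp.1 hpv) hd
  exact ⟨x, hx.1, y, hy.1, hc⟩

theorem finite_normalsAt (hV : IsVertexSet V P) {v : E3} (hv : v ∈ V) :
    (normalsAt P v).Finite := by
  have hsub : normalsAt P v ⊆ ⋃ x ∈ V, ⋃ y ∈ V, {u | ‖u‖ = 1 ∧
      LinearIndependent ℝ ![x - v, y - v] ∧ inner ℝ u (x - v) = (0 : ℝ) ∧
      inner ℝ u (y - v) = (0 : ℝ)} := by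
    intro u hu
    obtain ⟨x, hx, y, hy, hc⟩ := hV.exists_isPlaneCone_face hv hu
    simp only [mem_iUnion]
    exact ⟨x, hx, y, hy, hu.1.1, hc.linearIndependent,
      inner_sub_eq_zero_of_mem_face hc.left_mem hu.2,
      inner_sub_eq_zero_of_mem_face hc.right_mem hu.2⟩
  refine Finite.subset (V.finite_toSet.biUnion fun x _ => V.finite_toSet.biUnion fun y _ => ?_) hsub
  rcases eq_empty_or_nonempty {u | ‖u‖ = 1 ∧ LinearIndependent ℝ ![x - v, y - v] ∧
      inner ℝ u (x - v) = (0 : ℝ) ∧ inner ℝ u (y - v) = (0 : ℝ)} with h | ⟨u, h1, h2, h3, h4⟩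
  · rw [h]; exact finite_empty
  · refine (toFinite {u, -u}).subset fun w hw => ?_
    simpa using unit_normal_eq h2 h1 hw.1 h3 h4 hw.2.2.1 hw.2.2.2

theorem linearIndependent_of_signs (hV : IsVertexSet V P) {v ω p q : E3} (hv : v ∈ V) (hp : p ∈ V)
    (hq : q ∈ V) (hpos : 0 < (inner ℝ ω (p - v) : ℝ)) (hneg : (inner ℝ ω (q - v) : ℝ) < 0) :
    LinearIndependent ℝ ![p - v, q - v] := by
  obtain ⟨h, hh⟩ := hV.exists_exposing hv
  have hpv := hh p hp (by rintro rfl; simp at hpos)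
  have hqv := hh q hq (by rintro rfl; simp at hneg)
  rw [LinearIndependent.pair_iff]
  intro s t hst
  have h1 := congrArg (inner ℝ ω) hst
  have h2 := congrArg (inner ℝ h) hst
  simp only [inner_add_right, inner_smul_right, inner_zero_right] at h1 h2
  have hD : 0 < (inner ℝ ω (p - v) : ℝ) * -inner ℝ h (q - v) +
      -inner ℝ ω (q - v) * -inner ℝ h (p - v) :=
    add_pos (mul_pos hpos (by linarith)) (mul_pos (by linarith) (by linarith))
  constructor
  · refine (mul_eq_zero.1 (?_ : s * ((inner ℝ ω (p - v) : ℝ) * -inner ℝ h (q - v) +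
      -inner ℝ ω (q - v) * -inner ℝ h (p - v)) = 0)).resolve_right hD.ne'
    linear_combination -inner ℝ h (q - v) * h1 + inner ℝ ω (q - v) * h2
  · refine (mul_eq_zero.1 (?_ : t * ((inner ℝ ω (p - v) : ℝ) * -inner ℝ h (q - v) +
      -inner ℝ ω (q - v) * -inner ℝ h (p - v)) = 0)).resolve_right hD.ne'
    linear_combination inner ℝ h (p - v) * h1 - inner ℝ ω (p - v) * h2

/-- A plane through a vertex `v` that separates the other vertices crosses exactly two of the
faces at `v`. -/
theorem ncard_crosses_of_dim_three (hV : IsVertexSet V P) (hd : dim P = 3) {v ω : E3} (hv : v ∈ V)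
    (hω : ∀ p ∈ V, p ≠ v → inner ℝ ω (p - v) ≠ (0 : ℝ))
    (hpos : ∃ p ∈ V, 0 < (inner ℝ ω (p - v) : ℝ)) (hneg : ∃ q ∈ V, (inner ℝ ω (q - v) : ℝ) < 0) :
    {u ∈ normalsAt P v | Crosses V P v ω u}.ncard = 2 := by
  classical
  obtain ⟨h, hh⟩ := hV.exists_exposing hv
  let A := V.filter fun p => 0 < (inner ℝ ω (p - v) : ℝ)
  let B := V.filter fun p => (inner ℝ ω (p - v) : ℝ) < 0
  have hA : ∀ p, p ∈ A ↔ p ∈ V ∧ 0 < (inner ℝ ω (p - v) : ℝ) := fun p => by simp [A]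
  have hB : ∀ p, p ∈ B ↔ p ∈ V ∧ (inner ℝ ω (p - v) : ℝ) < 0 := fun p => by simp [B]
  obtain ⟨p₀, hp₀⟩ : A.Nonempty := by
    obtain ⟨p, hp, h1⟩ := hpos; exact ⟨p, (hA p).2 ⟨hp, h1⟩⟩
  obtain ⟨q₀, hq₀⟩ : B.Nonempty := by
    obtain ⟨p, hp, h1⟩ := hneg; exact ⟨p, (hB p).2 ⟨hp, h1⟩⟩
  have hω0 : ω ≠ 0 := by
    rintro rfl
    simpa using ((hA _).1 hp₀).2
  let z : E3 × E3 → E3 := fun c =>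
    (inner ℝ ω (c.1 - v) : ℝ) • (c.2 - v) - (inner ℝ ω (c.2 - v) : ℝ) • (c.1 - v)
  have hz : ∀ f p q, (inner ℝ f (z (p, q)) : ℝ) = inner ℝ ω (p - v) * inner ℝ f (q - v) -
      inner ℝ ω (q - v) * inner ℝ f (p - v) := by
    intro f p q
    simp only [z, inner_sub_right f (_ • _), inner_smul_right]
  have hhA : ∀ p ∈ A, (inner ℝ h (p - v) : ℝ) < 0 := fun p hp =>
    hh p ((hA p).1 hp).1 (by rintro rfl; simpa using ((hA _).1 hp).2)
  have hhB : ∀ p ∈ B, (inner ℝ h (p - v) : ℝ) < 0 := fun p hp =>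
    hh p ((hB p).1 hp).1 (by rintro rfl; simpa using ((hB _).1 hp).2)
  let Z := (A ×ˢ B).image z
  have hZ : ∀ w, w ∈ Z ↔ ∃ p ∈ A, ∃ q ∈ B, z (p, q) = w := by
    intro w
    simp only [Z, Finset.mem_image, Finset.mem_product, Prod.exists]
    constructor
    · rintro ⟨p, q, ⟨h1, h2⟩, h3⟩; exact ⟨p, h1, q, h2, h3⟩
    · rintro ⟨p, h1, q, h2, h3⟩; exact ⟨p, q, ⟨h1, h2⟩, h3⟩
  obtain ⟨x, hx, y, hy, hcone⟩ := exists_cone_generators (Z := Z) (n := ω) (h := h)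
    ⟨z (p₀, q₀), (hZ _).2 ⟨p₀, hp₀, q₀, hq₀, rfl⟩⟩ hω0
    (fun w hw => by
      obtain ⟨p, hp, q, hq, rfl⟩ := (hZ w).1 hw
      rw [hz]; ring)
    (fun w hw => by
      obtain ⟨p, hp, q, hq, rfl⟩ := (hZ w).1 hw
      rw [hz]
      nlinarith [mul_pos ((hA p).1 hp).2 (neg_pos.2 (hhB q hq)),
        mul_pos (neg_pos.2 ((hB q).1 hq).2) (neg_pos.2 (hhA p hp))])
  -- a supporting plane of the section extends to a face of the polyhedron
  have hface : ∀ x ∈ Z, (∃ k : E3, k ≠ 0 ∧ inner ℝ k ω = (0 : ℝ) ∧ inner ℝ k x = (0 : ℝ) ∧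
      ∀ w ∈ Z, (inner ℝ k w : ℝ) ≤ 0) → ∃ u ∈ normalsAt P v, inner ℝ u x = (0 : ℝ) := by
    rintro x hx ⟨k, hk, hkω, hkx, hkZ⟩
    obtain ⟨p, hp, q, hq, rfl⟩ := (hZ _).1 hx
    have hp' := (hA p).1 hp
    have hq' := (hB q).1 hq
    let c : ℝ := -inner ℝ k (p - v) / inner ℝ ω (p - v)
    have hc : c * inner ℝ ω (p - v) = -inner ℝ k (p - v) := div_mul_cancel₀ _ hp'.2.ne'
    let u := k + c • ω
    have hu : ∀ w, (inner ℝ u w : ℝ) = inner ℝ k w + c * inner ℝ ω w := by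
      intro w; simp only [u, inner_add_left, inner_smul_left]; simp
    have hu0 : u ≠ 0 := by
      intro h0
      have := hu k
      rw [h0, inner_zero_left, real_inner_comm k ω, hkω, mul_zero, add_zero] at this
      exact hk (inner_self_eq_zero.1 this.symm)
    have hup : (inner ℝ u (p - v) : ℝ) = 0 := by rw [hu, hc]; ring
    rw [hz] at hkx
    have huq : (inner ℝ u (q - v) : ℝ) = 0 := by
      have : (inner ℝ ω (p - v) : ℝ) * inner ℝ u (q - v) = 0 := by
        rw [hu]; linear_combination hkx + inner ℝ ω (q - v) * hc
      exact (mul_eq_zero.1 this).resolve_left hp'.2.ne'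
    have hle : ∀ r ∈ V, (inner ℝ u (r - v) : ℝ) ≤ 0 := by
      intro r hr
      by_cases hrv : r = v
      · simp [hrv]
      rcases lt_or_gt_of_ne (hω r hr hrv) with h1 | h1
      · have := hkZ _ ((hZ _).2 ⟨p, hp, r, (hB r).2 ⟨hr, h1⟩, rfl⟩)
        rw [hz] at this
        have h2 : (inner ℝ ω (p - v) : ℝ) * inner ℝ u (r - v) ≤ 0 := by
          rw [hu]; linear_combination this + inner ℝ ω (r - v) * hc
        by_contra! hc'
        linarith [mul_pos hp'.2 hc']
      · have := hkZ _ ((hZ _).2 ⟨r, (hA r).2 ⟨hr, h1⟩, q, hq, rfl⟩)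
        rw [hz] at this
        have h2 : -(inner ℝ ω (q - v) : ℝ) * inner ℝ u (r - v) ≤ 0 := by
          rw [hu] at huq ⊢
          linear_combination this - inner ℝ ω (r - v) * huq
        by_contra! hc'
        linarith [mul_pos (neg_pos.2 hq'.2) hc']
    have hvf : v ∈ face P u := hV.mem_face_iff.2 ⟨hV.subset hv, fun r hr => by
      have := hle r hr
      rw [inner_sub_right] at this
      linarith⟩
    have hpf := mem_face_of_inner hvf (hV.subset hp'.1) hup
    have hqf := mem_face_of_inner hvf (hV.subset hq'.1) huq
    have hun : 0 < ‖u‖⁻¹ := inv_pos.2 (norm_pos_iff.2 hu0)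
    have hfe : face P (‖u‖⁻¹ • u) = face P u := by
      ext w
      simp only [face, mem_ofPred_eq, inner_smul_left, conj_trivial]
      refine and_congr_right fun _ => forall₂_congr fun y _ => ?_
      exact mul_le_mul_iff_right₀ hun
    refine ⟨‖u‖⁻¹ • u, ⟨⟨?_, ?_⟩, ?_⟩, ?_⟩
    · rw [norm_smul, norm_inv, norm_norm, inv_mul_cancel₀ (norm_ne_zero_iff.2 hu0)]
    · rw [hfe]
      exact dim_face_eq_two hu0 hvf hpf hqf
        (hV.linearIndependent_of_signs hv hp'.1 hq'.1 hp'.2 hq'.2)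
    · rw [hfe]; exact hvf
    · rw [inner_smul_left, hz, hup, huq]; simp
  have hmem : ∀ u ∈ normalsAt P v, ∀ p ∈ A, ∀ q ∈ B, inner ℝ u (z (p, q)) = (0 : ℝ) →
      inner ℝ u (p - v) = (0 : ℝ) ∧ inner ℝ u (q - v) = (0 : ℝ) := by
    intro u hu p hp q hq h0
    rw [hz] at h0
    have hp' := (hA p).1 hp
    have hq' := (hB q).1 hq
    have h1 := inner_sub_le_zero hu.2 (hV.subset hp'.1)
    have h2 := inner_sub_le_zero hu.2 (hV.subset hq'.1)
    have h3 := mul_nonneg hp'.2.le (neg_nonneg.2 h2)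
    have h4 := mul_nonneg (neg_nonneg.2 hq'.2.le) (neg_nonneg.2 h1)
    constructor
    · exact (mul_eq_zero.1 (show (inner ℝ ω (q - v) : ℝ) * inner ℝ u (p - v) = 0 by
        linarith)).resolve_left hq'.2.ne
    · exact (mul_eq_zero.1 (show (inner ℝ ω (p - v) : ℝ) * inner ℝ u (q - v) = 0 by
        linarith)).resolve_left hp'.2.ne'
  have hleZ : ∀ u ∈ normalsAt P v, ∀ w ∈ Z, (inner ℝ u w : ℝ) ≤ 0 := by
    intro u hu w hw
    obtain ⟨p, hp, q, hq, rfl⟩ := (hZ w).1 hw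
    have hp' := (hA p).1 hp
    have hq' := (hB q).1 hq
    rw [hz]
    linarith [mul_nonneg hp'.2.le (neg_nonneg.2 (inner_sub_le_zero hu.2 (hV.subset hq'.1))),
      mul_nonneg (neg_nonneg.2 hq'.2.le)
        (neg_nonneg.2 (inner_sub_le_zero hu.2 (hV.subset hp'.1)))]
  have huniq : ∀ u ∈ normalsAt P v, ∀ u' ∈ normalsAt P v, ∀ x ∈ Z, inner ℝ u x = (0 : ℝ) →
      inner ℝ u' x = (0 : ℝ) → u' = u := by
    intro u hu u' hu' x hx h1 h2
    obtain ⟨p, hp, q, hq, rfl⟩ := (hZ _).1 hx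
    obtain ⟨h3, h4⟩ := hmem u hu p hp q hq h1
    obtain ⟨h5, h6⟩ := hmem u' hu' p hp q hq h2
    have hp' := (hA p).1 hp
    have hq' := (hB q).1 hq
    rcases unit_normal_eq (hV.linearIndependent_of_signs hv hp'.1 hq'.1 hp'.2 hq'.2) hu.1.1 hu'.1.1
      h3 h4 h5 h6 with h | h
    · exact h
    · exfalso
      have hu0 : u ≠ 0 := by rintro rfl; simpa using hu.1.1
      obtain ⟨r, hr, hne⟩ := hV.exists_inner_ne hd hv hu0
      have h7 := inner_sub_le_zero hu.2 (hV.subset hr)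
      have h8 := inner_sub_le_zero hu'.2 (hV.subset hr)
      rw [h, inner_neg_left] at h8
      exact hne (by linarith)
  have hcr : ∀ u ∈ normalsAt P v, ∀ x ∈ Z, inner ℝ u x = (0 : ℝ) → Crosses V P v ω u := by
    intro u hu x hx h1
    obtain ⟨p, hp, q, hq, rfl⟩ := (hZ _).1 hx
    obtain ⟨h3, h4⟩ := hmem u hu p hp q hq h1
    have hp' := (hA p).1 hp
    have hq' := (hB q).1 hq
    exact ⟨p, hp'.1, q, hq'.1, mem_face_of_inner hu.2 (hV.subset hp'.1) h3,
      mem_face_of_inner hu.2 (hV.subset hq'.1) h4, hp'.2, hq'.2⟩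
  have hsupp : ∀ x y : E3, (∀ w ∈ Z, ∃ s t : ℝ, 0 ≤ s ∧ 0 ≤ t ∧ w = s • x + t • y) →
      ∃ k : E3, k ≠ 0 ∧ inner ℝ k ω = (0 : ℝ) ∧ inner ℝ k x = (0 : ℝ) ∧
      ∀ w ∈ Z, (inner ℝ k w : ℝ) ≤ 0 := by
    intro x y hxy
    obtain ⟨k, hk, hkω, hkx⟩ := exists_ne_zero_orthogonal ω x
    obtain ⟨k', hk', hkω', hkx', hky'⟩ : ∃ k : E3, k ≠ 0 ∧ inner ℝ k ω = (0 : ℝ) ∧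
        inner ℝ k x = (0 : ℝ) ∧ (inner ℝ k y : ℝ) ≤ 0 := by
      rcases le_total (inner ℝ k y : ℝ) 0 with h | h
      · exact ⟨k, hk, hkω, hkx, h⟩
      · exact ⟨-k, neg_ne_zero.2 hk, by simp [hkω], by simp [hkx], by simp [h]⟩
    refine ⟨k', hk', hkω', hkx', fun w hw => ?_⟩
    obtain ⟨s, t, -, ht, rfl⟩ := hxy w hw
    rw [inner_add_right, inner_smul_right, inner_smul_right, hkx', mul_zero, zero_add]
    exact mul_nonpos_of_nonneg_of_nonpos ht hky'
  obtain ⟨a, ha, hax⟩ := hface x hx (hsupp x y hcone)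
  obtain ⟨b, hb, hby⟩ := hface y hy (hsupp y x fun w hw => by
    obtain ⟨s, t, hs, ht, e⟩ := hcone w hw
    exact ⟨t, s, ht, hs, by rw [e, add_comm]⟩)
  have hab : a ≠ b := by
    rintro rfl
    have hall : ∀ w ∈ Z, inner ℝ a w = (0 : ℝ) := by
      intro w hw
      obtain ⟨s, t, -, -, rfl⟩ := hcone w hw
      rw [inner_add_right, inner_smul_right, inner_smul_right, hax, hby]; ring
    have ha0 : a ≠ 0 := by rintro rfl; simpa using ha.1.1
    obtain ⟨r, hr, hne⟩ := hV.exists_inner_ne hd hv ha0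
    rcases lt_or_gt_of_ne (hω r hr (by rintro rfl; simp at hne)) with h1 | h1
    · have hrB := (hB r).2 ⟨hr, h1⟩
      exact hne (hmem a ha p₀ hp₀ r hrB (hall _ ((hZ _).2 ⟨p₀, hp₀, r, hrB, rfl⟩))).2
    · have hrA := (hA r).2 ⟨hr, h1⟩
      exact hne (hmem a ha r hrA q₀ hq₀ (hall _ ((hZ _).2 ⟨r, hrA, q₀, hq₀, rfl⟩))).1
  have hset : {u ∈ normalsAt P v | Crosses V P v ω u} = {a, b} := by
    ext u
    simp only [mem_ofPred_eq, mem_insert_iff, mem_singleton_iff]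
    constructor
    · rintro ⟨hu, p, hp, q, hq, hpf, hqf, hp', hq'⟩
      have hpA := (hA p).2 ⟨hp, hp'⟩
      have hqB := (hB q).2 ⟨hq, hq'⟩
      have h0 : (inner ℝ u (z (p, q)) : ℝ) = 0 := by
        rw [hz, inner_sub_eq_zero_of_mem_face hpf hu.2, inner_sub_eq_zero_of_mem_face hqf hu.2]
        ring
      have hpq := (hZ _).2 ⟨p, hpA, q, hqB, rfl⟩
      obtain ⟨s, t, hs, ht, e⟩ := hcone _ hpq
      have hne : z (p, q) ≠ 0 := by
        intro h1
        have h2 := hz h p q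
        rw [h1, inner_zero_right] at h2
        linarith [mul_pos hp' (neg_pos.2 (hhB q hqB)), mul_pos (neg_pos.2 hq')
          (neg_pos.2 (hhA p hpA))]
      rw [e, inner_add_right, inner_smul_right, inner_smul_right] at h0
      have h1 := mul_nonneg hs (neg_nonneg.2 (hleZ u hu x hx))
      have h2 := mul_nonneg ht (neg_nonneg.2 (hleZ u hu y hy))
      by_cases hs0 : s = 0
      · have ht0 : t ≠ 0 := by
          rintro rfl
          rw [hs0] at e
          exact hne (by rw [e]; simp)
        right
        exact huniq b hb u hu y hy hby
          ((mul_eq_zero.1 (show t * (inner ℝ u y : ℝ) = 0 by linarith)).resolve_left ht0)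
      · left
        exact huniq a ha u hu x hx hax
          ((mul_eq_zero.1 (show s * (inner ℝ u x : ℝ) = 0 by linarith)).resolve_left hs0)
    · rintro (rfl | rfl)
      · exact ⟨ha, hcr _ ha x hx hax⟩
      · exact ⟨hb, hcr _ hb y hy hby⟩
  rw [hset, ncard_pair hab]

end IsVertexSet

end HexGlue

end

noncomputable section

namespace HexGlue

open Set MeasureTheory Real

theorem IsConvexPolyhedron.exists_vertexSet {P : Set E3} (hP : IsConvexPolyhedron P) :
    ∃ V : Finset E3, IsVertexSet V P := exists_isVertexSet hP.polytope

theorem face_eq_self_of_orthogonal {P : Set E3} {n : E3}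
    (hn : ∀ w ∈ vectorSpan ℝ P, inner ℝ n w = (0 : ℝ)) : face P n = P := by
  ext x
  refine ⟨fun h => h.1, fun hx => ⟨hx, fun y hy => ?_⟩⟩
  have := hn _ (vsub_mem_vectorSpan ℝ hy hx)
  rw [vsub_eq_sub, inner_sub_right] at this
  linarith

theorem vectorSpan_face_eq {P : Set E3} (hd : dim P = 2) {u : E3} (hu : u ∈ faceNormals P) :
    vectorSpan ℝ (face P u) = vectorSpan ℝ P :=
  Submodule.eq_of_le_of_finrank_eq (vectorSpan_mono ℝ fun _ hx => hx.1)
    ((show Module.finrank ℝ (vectorSpan ℝ (face P u)) = 2 from hu.2).trans hd.symm)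

/-- The two sheets of a doubly covered polygon. -/
theorem exists_faceNormals_eq {P : Set E3} (hd : dim P = 2) :
    ∃ n : E3, ‖n‖ = 1 ∧ faceNormals P = {n, -n} ∧ face P n = P ∧ face P (-n) = P := by
  obtain ⟨n₀, hn₀, hnw₀⟩ := exists_normal hd
  obtain ⟨n, hn, hnw⟩ : ∃ n : E3, ‖n‖ = 1 ∧ ∀ w ∈ vectorSpan ℝ P, inner ℝ n w = (0 : ℝ) :=
    ⟨‖n₀‖⁻¹ • n₀, by
      rw [norm_smul, norm_inv, norm_norm, inv_mul_cancel₀ (norm_ne_zero_iff.2 hn₀)],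
      fun w hw => by rw [inner_smul_left, hnw₀ w hw, mul_zero]⟩
  have h1 : face P n = P := face_eq_self_of_orthogonal hnw
  have h2 : face P (-n) = P := face_eq_self_of_orthogonal fun w hw => by
    rw [inner_neg_left, hnw w hw, neg_zero]
  refine ⟨n, hn, ?_, h1, h2⟩
  ext u
  simp only [mem_insert_iff, mem_singleton_iff]
  constructor
  · intro hu
    have hspan := vectorSpan_face_eq hd hu
    have huw : ∀ w ∈ vectorSpan ℝ P, inner ℝ u w = (0 : ℝ) := by
      intro w hw
      have hle : vectorSpan ℝ (face P u) ≤ (ℝ ∙ u)ᗮ := by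
        rw [vectorSpan_def, Submodule.span_le]
        rintro _ ⟨x, hx, y, hy, rfl⟩
        rw [SetLike.mem_coe, Submodule.mem_orthogonal_singleton_iff_inner_right]
        exact inner_sub_eq_zero_of_mem_face hx hy
      rw [hspan] at hle
      exact Submodule.mem_orthogonal_singleton_iff_inner_right.1 (hle hw)
    obtain ⟨b⟩ : Nonempty (Module.Basis (Fin 2) ℝ (vectorSpan ℝ P)) :=
      ⟨Module.finBasisOfFinrankEq ℝ _ hd⟩
    have hli : LinearIndependent ℝ ![(b 0 : E3), (b 1 : E3)] := by
      have h := b.linearIndependent.map' (vectorSpan ℝ P).subtype (Submodule.ker_subtype _)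
      have hfun : ![(b 0 : E3), (b 1 : E3)] = (vectorSpan ℝ P).subtype ∘ b := by
        ext i : 1
        fin_cases i <;> rfl
      rw [hfun]
      exact h
    exact unit_normal_eq hli hn hu.1 (hnw _ (b 0).2) (hnw _ (b 1).2) (huw _ (b 0).2)
      (huw _ (b 1).2)
  · rintro (rfl | rfl)
    · exact ⟨hn, by rw [h1, hd]⟩
    · exact ⟨by rw [norm_neg, hn], by rw [h2, hd]⟩

/-- The directions, in the unit ball, in which `v` is the unique extreme point among `V`. -/
def normalCone (V : Finset E3) (v : E3) : Set E3 :=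
  {ω | ‖ω‖ < 1 ∧ ∀ p ∈ V, p ≠ v → inner ℝ ω (p - v) < (0 : ℝ)}

theorem isOpen_normalCone (V : Finset E3) (v : E3) : IsOpen (normalCone V v) := by
  have h1 : IsOpen {ω : E3 | ‖ω‖ < 1} := isOpen_lt (by fun_prop) (by fun_prop)
  exact h1.and (isOpen_strict_max V v)

namespace IsVertexSet

variable {V : Finset E3} {P : Set E3}

theorem exists_ne (hV : IsVertexSet V P) (hP : IsConvexPolyhedron P) {v : E3} (hv : v ∈ V) :
    ∃ p ∈ V, p ≠ v := by
  by_contra! hcon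
  have h0 : vectorSpan ℝ P = ⊥ := by
    rw [hV.vectorSpan_eq hv, Submodule.span_eq_bot]
    rintro _ ⟨p, hp, rfl⟩
    simp [hcon p hp]
  have := hP.dim_eq
  unfold dim at this
  rw [h0, finrank_bot] at this
  omega

theorem ncard_crosses (hV : IsVertexSet V P) (hP : IsConvexPolyhedron P) {v ω : E3} (hv : v ∈ V)
    (hω : ∀ p ∈ V, p ≠ v → inner ℝ ω (p - v) ≠ (0 : ℝ))
    (hpos : ∃ p ∈ V, 0 < (inner ℝ ω (p - v) : ℝ)) (hneg : ∃ q ∈ V, (inner ℝ ω (q - v) : ℝ) < 0) :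
    {u ∈ normalsAt P v | Crosses V P v ω u}.ncard = 2 := by
  rcases hP.dim_eq with hd | hd
  · obtain ⟨n, hn, hN, h1, h2⟩ := exists_faceNormals_eq hd
    have hne : n ≠ -n := by
      intro h
      have h0 : n = 0 := by
        have : (2 : ℝ) • n = 0 := by rw [two_smul]; nth_rewrite 1 [h]; simp
        simpa using this
      simp [h0] at hn
    rw [← ncard_pair hne]
    congr 1
    ext u
    constructor
    · intro hu
      have := hu.1.1
      rwa [hN] at this
    · intro hu
      have huN : u ∈ faceNormals P := by rw [hN]; exact hu
      have hface : face P u = P := by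
        rcases hu with rfl | hu
        · exact h1
        · rw [mem_singleton_iff.1 hu, h2]
      obtain ⟨p, hp, hp'⟩ := hpos
      obtain ⟨q, hq, hq'⟩ := hneg
      refine ⟨⟨huN, by rw [hface]; exact hV.subset hv⟩, p, hp, q, hq, ?_, ?_, hp', hq'⟩ <;>
      rw [hface] <;> apply hV.subset <;> assumption
  · exact hV.ncard_crosses_of_dim_three hd hv hω hpos hneg

/-- The Gaussian curvature is the normalised solid angle of the normal cone. -/
theorem curvature_mul (hV : IsVertexSet V P) (hP : IsConvexPolyhedron P) {v : E3} (hv : v ∈ V) :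
    curvature P v * volume.real (Metric.ball (0 : E3) 1) =
      4 * π * volume.real (normalCone V v) := by
  classical
  have hfin := hV.finite_normalsAt hv
  have hch : ∀ u : E3, ∃ x y : E3, u ∈ normalsAt P v →
      x ∈ V ∧ y ∈ V ∧ IsPlaneCone (face P u) v x y := by
    intro u
    by_cases hu : u ∈ normalsAt P v
    · obtain ⟨x, hx, y, hy, h⟩ := hV.exists_isPlaneCone_face hv hu
      exact ⟨x, y, fun _ => ⟨hx, hy, h⟩⟩
    · exact ⟨0, 0, fun h => absurd h hu⟩
  choose x y hxy using hch
  let L : E3 → Set E3 := fun u =>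
    {ω | ‖ω‖ < 1 ∧ inner ℝ ω (x u - v) * inner ℝ ω (y u - v) < (0 : ℝ)}
  have hLm : ∀ u, MeasurableSet (L u) := by
    intro u
    have h1 : IsOpen {ω : E3 | ‖ω‖ < 1} := isOpen_lt (by fun_prop) (by fun_prop)
    have h2 : IsOpen {ω : E3 | inner ℝ ω (x u - v) * inner ℝ ω (y u - v) < (0 : ℝ)} :=
      isOpen_lt (by fun_prop) (by fun_prop)
    exact (h1.and h2).measurableSet
  have hLc : ∀ u ∈ normalsAt P v, ∀ ω, ω ∈ L u ↔ ‖ω‖ < 1 ∧ Crosses V P v ω u := by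
    intro u hu ω
    obtain ⟨hx, hy, hc⟩ := hxy u hu
    refine and_congr_right fun _ => ⟨fun h => ?_, ?_⟩
    · rcases mul_neg_iff.1 h with ⟨h3, h4⟩ | ⟨h3, h4⟩
      · exact ⟨_, hx, _, hy, hc.left_mem, hc.right_mem, h3, h4⟩
      · exact ⟨_, hy, _, hx, hc.right_mem, hc.left_mem, h4, h3⟩
    · rintro ⟨p, -, q, -, hp, hq, h1, h2⟩
      exact hc.inner_mul_inner_neg hp hq h1 h2
  have hNm : MeasurableSet (normalCone V v) := (isOpen_normalCone V v).measurableSet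
  obtain ⟨p₁, hp₁, hp₁v⟩ := hV.exists_ne hP hv
  have hae : ∀ᵐ ω : E3, (∑ u ∈ hfin.toFinset, (L u).indicator (1 : E3 → ENNReal) ω) +
      (2 * (normalCone V v).indicator 1 ω + 2 * (-normalCone V v).indicator 1 ω) =
      2 * (Metric.ball (0 : E3) 1).indicator 1 ω := by
    have hgen := ae_inner_ne_zero (T := (fun p => p - v) '' {p | p ∈ V ∧ p ≠ v})
      ((V.finite_toSet.subset fun p hp => hp.1).image _) (by
        rintro _ ⟨p, hp, rfl⟩
        exact sub_ne_zero.2 hp.2)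
    filter_upwards [hgen] with ω hω
    have hω : ∀ p ∈ V, p ≠ v → inner ℝ ω (p - v) ≠ (0 : ℝ) := fun p hp hpv =>
      hω _ ⟨p, ⟨hp, hpv⟩, rfl⟩
    have hsum : ∑ u ∈ hfin.toFinset, (L u).indicator (1 : E3 → ENNReal) ω =
        (({u ∈ normalsAt P v | ω ∈ L u}.ncard : ℕ) : ENNReal) := by
      have : {u ∈ normalsAt P v | ω ∈ L u} =
          ((hfin.toFinset.filter fun u => ω ∈ L u : Finset E3) : Set E3) := by
        ext u; simp
      rw [this, ncard_coe_finset, Finset.card_filter]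
      push_cast
      exact Finset.sum_congr rfl fun u _ => by simp [indicator_apply]
    rw [hsum]
    by_cases hn : ‖ω‖ < 1
    · have hball : ω ∈ Metric.ball (0 : E3) 1 := by simpa using hn
      have hcr : {u ∈ normalsAt P v | ω ∈ L u} = {u ∈ normalsAt P v | Crosses V P v ω u} := by
        ext u
        refine and_congr_right fun hu => ?_
        rw [hLc u hu ω]
        exact and_iff_right hn
      rw [hcr, indicator_of_mem hball]
      by_cases hpos : ∃ p ∈ V, 0 < (inner ℝ ω (p - v) : ℝ)
      · obtain ⟨p, hp, hp0⟩ := hpos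
        have h1 : ω ∉ normalCone V v := fun h => by
          linarith [h.2 p hp (by rintro rfl; simp at hp0)]
        by_cases hneg : ∃ q ∈ V, (inner ℝ ω (q - v) : ℝ) < 0
        · obtain ⟨q, hq, hq0⟩ := hneg
          have h2 : ω ∉ -normalCone V v := fun h => by
            have := h.2 q hq (by rintro rfl; simp at hq0)
            rw [inner_neg_left] at this
            linarith
          rw [hV.ncard_crosses hP hv hω ⟨p, hp, hp0⟩ ⟨q, hq, hq0⟩, indicator_of_notMem h1,
            indicator_of_notMem h2]
          simp
        · have h2 : ω ∈ -normalCone V v := ⟨by simpa using hn, fun q hq hqv => by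
            rw [inner_neg_left]
            push Not at hneg
            have := lt_of_le_of_ne (hneg q hq) (hω q hq hqv).symm
            linarith⟩
          have h3 : {u ∈ normalsAt P v | Crosses V P v ω u} = ∅ := by
            ext u
            simp only [mem_ofPred_eq, mem_empty_iff_false, iff_false, not_and]
            rintro - ⟨-, -, q, hq, -, -, -, hq0⟩
            exact hneg ⟨q, hq, hq0⟩
          rw [h3, indicator_of_notMem h1, indicator_of_mem h2]
          simp
      · have h1 : ω ∈ normalCone V v := ⟨hn, fun q hq hqv => by
          push Not at hpos
          exact lt_of_le_of_ne (hpos q hq) (hω q hq hqv)⟩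
        have h2 : ω ∉ -normalCone V v := fun h => by
          have h4 := h.2 p₁ hp₁ hp₁v
          have h5 := h1.2 p₁ hp₁ hp₁v
          rw [inner_neg_left] at h4
          linarith
        have h3 : {u ∈ normalsAt P v | Crosses V P v ω u} = ∅ := by
          ext u
          simp only [mem_ofPred_eq, mem_empty_iff_false, iff_false, not_and]
          rintro - ⟨q, hq, -, -, -, -, hq0, -⟩
          exact hpos ⟨q, hq, hq0⟩
        rw [h3, indicator_of_mem h1, indicator_of_notMem h2]
        simp
    · have hball : ω ∉ Metric.ball (0 : E3) 1 := by simpa using hn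
      have h1 : ω ∉ normalCone V v := fun h => hn h.1
      have h2 : ω ∉ -normalCone V v := fun h => hn (by simpa using h.1)
      have h3 : {u ∈ normalsAt P v | ω ∈ L u} = ∅ := by
        ext u
        simp only [mem_ofPred_eq, mem_empty_iff_false, iff_false, not_and]
        exact fun _ h => hn h.1
      rw [h3, indicator_of_notMem hball, indicator_of_notMem h1, indicator_of_notMem h2]
      simp
  have hint := lintegral_congr_ae hae
  have hmeas1 : ∀ s : Set E3, MeasurableSet s →
      Measurable (s.indicator (1 : E3 → ENNReal)) := fun s hs => measurable_one.indicator hs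
  rw [lintegral_add_right _ (show Measurable fun ω => 2 * (normalCone V v).indicator 1 ω +
      2 * (-normalCone V v).indicator 1 ω from
      ((hmeas1 _ hNm).const_mul 2).add ((hmeas1 _ hNm.neg).const_mul 2)),
    lintegral_finsetSum _ (fun u _ => hmeas1 _ (hLm u)),
    lintegral_add_right _ ((hmeas1 _ hNm.neg).const_mul 2),
    lintegral_const_mul _ (hmeas1 _ hNm), lintegral_const_mul _ (hmeas1 _ hNm.neg),
    lintegral_const_mul _ (hmeas1 _ measurableSet_ball), lintegral_indicator_one hNm,
    lintegral_indicator_one hNm.neg, lintegral_indicator_one measurableSet_ball,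
    Measure.measure_neg] at hint
  have hL : ∀ u ∈ hfin.toFinset, ∫⁻ ω, (L u).indicator (1 : E3 → ENNReal) ω =
      ENNReal.ofReal (faceAngle (face P u) v / π) * volume (Metric.ball (0 : E3) 1) := by
    intro u hu
    obtain ⟨hx, hy, hc⟩ := hxy u (hfin.mem_toFinset.1 hu)
    rw [lintegral_indicator_one (hLm u), volume_lune hc.left_ne hc.right_ne, hc.faceAngle_eq]
  rw [Finset.sum_congr rfl hL] at hint
  have hNlt : volume (normalCone V v) ≠ ⊤ :=
    ((measure_mono fun ω hω => by simpa using hω.1).trans_lt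
      (measure_ball_lt_top (x := (0 : E3)) (r := 1))).ne
  have hBlt : volume (Metric.ball (0 : E3) 1) ≠ ⊤ := measure_ball_lt_top.ne
  have hreal := congrArg ENNReal.toReal hint
  have hnn : ∀ u ∈ hfin.toFinset, 0 ≤ faceAngle (face P u) v / π := fun u hu =>
    div_nonneg ((hxy u (hfin.mem_toFinset.1 hu)).2.2.faceAngle_pos).le pi_pos.le
  rw [ENNReal.toReal_add (ENNReal.sum_ne_top.2 fun u _ => ENNReal.mul_ne_top
      ENNReal.ofReal_ne_top hBlt) (by finiteness),
    ENNReal.toReal_sum (fun u _ => ENNReal.mul_ne_top ENNReal.ofReal_ne_top hBlt),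
    ENNReal.toReal_add (by finiteness) (by finiteness)] at hreal
  simp only [ENNReal.toReal_mul, ENNReal.toReal_ofNat] at hreal
  rw [Finset.sum_congr rfl fun u hu => by rw [ENNReal.toReal_ofReal (hnn u hu)],
    ← Finset.sum_mul, ← Finset.sum_div] at hreal
  have hcurv : curvature P v = 2 * π - ∑ u ∈ hfin.toFinset, faceAngle (face P u) v := by
    rw [curvature, ← finsum_mem_eq_finite_toFinset_sum _ hfin]
    rfl
  rw [hcurv]
  simp only [Measure.real]
  field_simp at hreal
  linarith

theorem curvature_pos (hV : IsVertexSet V P) (hP : IsConvexPolyhedron P) {v : E3} (hv : v ∈ V) :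
    0 < curvature P v := by
  have h := hV.curvature_mul hP hv
  have hB : 0 < volume.real (Metric.ball (0 : E3) 1) :=
    ENNReal.toReal_pos (Metric.measure_ball_pos _ _ one_pos).ne' measure_ball_lt_top.ne
  have hN : 0 < volume.real (normalCone V v) := by
    obtain ⟨f, hf⟩ := hV.exists_exposing hv
    have hne : (normalCone V v).Nonempty := by
      refine ⟨(2 * (1 + ‖f‖))⁻¹ • f, ?_, fun p hp hpv => ?_⟩
      · rw [norm_smul, norm_inv, Real.norm_of_nonneg (by positivity), inv_mul_lt_one₀ (by positivity)]
        linarith [norm_nonneg f]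
      · rw [inner_smul_left]
        exact mul_neg_of_pos_of_neg (by simp; positivity) (hf p hp hpv)
    exact ENNReal.toReal_pos ((isOpen_normalCone V v).measure_pos volume hne).ne'
      ((measure_mono fun ω hω => by simpa using hω.1).trans_lt
        (measure_ball_lt_top (x := (0 : E3)) (r := 1))).ne
  have : 0 < curvature P v * volume.real (Metric.ball (0 : E3) 1) := by rw [h]; positivity
  exact pos_of_mul_pos_left this hB.le

/-- The theorem of Descartes: the total curvature is `4π`. -/
theorem sum_curvature (hV : IsVertexSet V P) (hP : IsConvexPolyhedron P) :
    ∑ v ∈ V, curvature P v = 4 * π := by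
  have hB : 0 < volume.real (Metric.ball (0 : E3) 1) :=
    ENNReal.toReal_pos (Metric.measure_ball_pos _ _ one_pos).ne' measure_ball_lt_top.ne
  have hVne : V.Nonempty := by
    rw [Finset.nonempty_iff_ne_empty]
    rintro rfl
    have h0 : P = ∅ := by simpa using hV.hull_eq
    have := hP.dim_eq
    unfold dim at this
    rw [h0, vectorSpan_empty, finrank_bot] at this
    omega
  have hunion : volume (⋃ v ∈ V, normalCone V v) = volume (Metric.ball (0 : E3) 1) := by
    apply measure_congr
    have hgen := ae_inner_ne_zero (T := (fun p : E3 × E3 => p.1 - p.2) '' {p | p.1 ∈ V ∧ p.2 ∈ V ∧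
      p.1 ≠ p.2}) (((V.finite_toSet.prod V.finite_toSet).subset fun p hp =>
        ⟨hp.1, hp.2.1⟩).image _) (by
        rintro _ ⟨p, hp, rfl⟩
        exact sub_ne_zero.2 hp.2.2)
    filter_upwards [hgen] with ω hω
    refine propext ⟨fun h => ?_, fun h => ?_⟩
    · obtain ⟨v, hv, h⟩ := mem_iUnion₂.1 h
      exact mem_ball_zero_iff.2 h.1
    · obtain ⟨v, hv, hmax⟩ := V.exists_max_image (fun p => (inner ℝ ω p : ℝ)) hVne
      refine mem_iUnion₂.2 ⟨v, hv, mem_ball_zero_iff.1 h, fun p hp hpv => ?_⟩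
      refine lt_of_le_of_ne ?_ (hω _ ⟨(p, v), ⟨hp, hv, hpv⟩, rfl⟩)
      rw [inner_sub_right]
      linarith [hmax p hp]
  have hsum : ∑ v ∈ V, volume.real (normalCone V v) = volume.real (Metric.ball (0 : E3) 1) := by
    rw [measure_biUnion_finset _ fun v _ => (isOpen_normalCone V v).measurableSet] at hunion
    · rw [Measure.real, ← hunion, ENNReal.toReal_sum]
      · rfl
      · intro v _
        exact ((measure_mono fun ω hω => by simpa using hω.1).trans_lt
          (measure_ball_lt_top (x := (0 : E3)) (r := 1))).ne
    · intro v hv w hw hvw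
      refine disjoint_left.2 fun ω h1 h2 => ?_
      have h3 := h1.2 w hw hvw.symm
      have h4 := h2.2 v hv hvw
      rw [inner_sub_right] at h3 h4
      linarith
  have : (∑ v ∈ V, curvature P v) * volume.real (Metric.ball (0 : E3) 1) =
      4 * π * volume.real (Metric.ball (0 : E3) 1) := by
    rw [Finset.sum_mul, Finset.sum_congr rfl fun v hv => hV.curvature_mul hP hv, ← Finset.mul_sum,
      hsum]
  exact mul_right_cancel₀ hB.ne' this

end IsVertexSet

end HexGlue

end

noncomputable section

namespace HexGlue

open Set MeasureTheory Real Measure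

/-! ### Convex sets in the plane near a corner -/

theorem volume_image_isometry {f : ℂ → ℂ} (hf : Isometry f) (s : Set ℂ) :
    volume (f '' s) = volume s := by
  have h := hf.euclideanHausdorffMeasure_image (d := 2) s
  have h2 : (μHE[2] : Measure ℂ) = volume := by
    have := InnerProductSpace.euclideanHausdorffMeasure_eq_volume (V := ℂ)
    rwa [Complex.finrank_real_complex] at this
  rwa [h2] at h

theorem mem_sector_of_cone {α s t : ℝ} (hα : 0 < α) (hα' : α < π) (hs : 0 ≤ s) (ht : 0 ≤ t) :
    0 ≤ ((s : ℂ) + t * Complex.exp (α * Complex.I)).arg ∧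
      ((s : ℂ) + t * Complex.exp (α * Complex.I)).arg ≤ α := by
  obtain ⟨z, hz⟩ : ∃ z, z = (s : ℂ) + t * Complex.exp (α * Complex.I) := ⟨_, rfl⟩
  rw [← hz]
  have hsin : 0 < sin α := sin_pos_of_pos_of_lt_pi hα hα'
  have hre : z.re = s + t * cos α := by
    rw [hz, Complex.exp_mul_I]
    simp [← Complex.ofReal_cos, ← Complex.ofReal_sin]
  have him : z.im = t * sin α := by
    rw [hz, Complex.exp_mul_I]
    simp [← Complex.ofReal_cos, ← Complex.ofReal_sin]
  have h0 : 0 ≤ z.arg := Complex.arg_nonneg_iff.2 (by rw [him]; positivity)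
  refine ⟨h0, ?_⟩
  by_contra! hc
  have hzn : 0 < ‖z‖ := by
    rw [norm_pos_iff]
    rintro h
    rw [h, Complex.arg_zero] at hc
    linarith
  have h1 : 0 < sin (z.arg - α) :=
    sin_pos_of_pos_of_lt_pi (by linarith) (by linarith [Complex.arg_le_pi z])
  have h2 : ‖z‖ * sin (z.arg - α) = -(s * sin α) := by
    rw [sin_sub, mul_sub, ← mul_assoc, ← mul_assoc, Complex.norm_mul_sin_arg,
      Complex.norm_mul_cos_arg, hre, him]
    ring
  have h3 := mul_pos hzn h1
  rw [h2] at h3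
  nlinarith [mul_nonneg hs hsin.le]

theorem exists_cone_of_sector {α : ℝ} (hα : 0 < α) (hα' : α < π) {z : ℂ} (h0 : 0 ≤ z.arg)
    (h1 : z.arg ≤ α) : ∃ s t : ℝ, 0 ≤ s ∧ 0 ≤ t ∧ s ≤ ‖z‖ / sin α ∧ t ≤ ‖z‖ / sin α ∧
      z = (s : ℂ) + t * Complex.exp (α * Complex.I) := by
  have hsin : 0 < sin α := sin_pos_of_pos_of_lt_pi hα hα'
  refine ⟨‖z‖ * sin (α - z.arg) / sin α, ‖z‖ * sin z.arg / sin α, ?_, ?_, ?_, ?_, ?_⟩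
  · exact div_nonneg (mul_nonneg (norm_nonneg _)
      (sin_nonneg_of_nonneg_of_le_pi (by linarith) (by linarith))) hsin.le
  · exact div_nonneg (mul_nonneg (norm_nonneg _)
      (sin_nonneg_of_nonneg_of_le_pi h0 (by linarith))) hsin.le
  · exact div_le_div_of_nonneg_right (mul_le_of_le_one_right (norm_nonneg _) (sin_le_one _)) hsin.le
  · exact div_le_div_of_nonneg_right (mul_le_of_le_one_right (norm_nonneg _) (sin_le_one _)) hsin.le
  · rw [Complex.exp_mul_I]
    apply Complex.ext
    · simp only [Complex.add_re, Complex.mul_re, Complex.ofReal_re, Complex.ofReal_im,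
        ← Complex.ofReal_cos, ← Complex.ofReal_sin, Complex.I_re, Complex.I_im, zero_mul, mul_zero,
        sub_zero, mul_one, add_zero]
      rw [← Complex.norm_mul_cos_arg z, sin_sub]
      field_simp
      ring
    · simp only [Complex.add_im, Complex.mul_im, Complex.ofReal_re, Complex.ofReal_im,
        ← Complex.ofReal_cos, ← Complex.ofReal_sin, Complex.I_re, Complex.I_im, zero_mul, mul_zero,
        add_zero, mul_one, zero_add, Complex.add_im]
      rw [← Complex.norm_mul_sin_arg z]
      field_simp

theorem volume_local_sector {K : Set ℂ} (hK : Convex ℝ K) {p q α : ℝ} (hp : 0 < p) (hq : 0 < q)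
    (hα : 0 < α) (hα' : α < π) (h0K : (0 : ℂ) ∈ K) (hpK : (p : ℂ) ∈ K)
    (hqK : (q : ℂ) * Complex.exp (α * Complex.I) ∈ K)
    (hcone : ∀ z ∈ K, ∃ s t : ℝ, 0 ≤ s ∧ 0 ≤ t ∧ z = (s : ℂ) + t * Complex.exp (α * Complex.I)) :
    ∃ r₀ > 0, ∀ r, 0 < r → r ≤ r₀ → volume (K ∩ Metric.ball 0 r) = ENNReal.ofReal (α * r ^ 2 / 2) := by
  have hsin : 0 < sin α := sin_pos_of_pos_of_lt_pi hα hα'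
  refine ⟨sin α / (p⁻¹ + q⁻¹), by positivity, fun r hr hr₀ => ?_⟩
  have hset : K ∩ Metric.ball 0 r = {z : ℂ | ‖z‖ < r ∧ 0 ≤ z.arg ∧ z.arg ≤ α} := by
    ext z
    rw [mem_inter_iff, mem_ball_zero_iff, mem_ofPred_eq, and_comm]
    refine and_congr_right fun hz => ⟨fun h => ?_, fun h => ?_⟩
    · obtain ⟨s, t, hs, ht, rfl⟩ := hcone z h
      exact mem_sector_of_cone hα hα' hs ht
    · obtain ⟨s, t, hs, ht, hs', ht', e⟩ := exists_cone_of_sector hα hα' h.1 h.2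
      have hle : s / p + t / q ≤ 1 := by
        have h1 : ‖z‖ / sin α ≤ (p⁻¹ + q⁻¹)⁻¹ := by
          rw [div_le_iff₀ hsin]
          calc ‖z‖ ≤ r := hz.le
            _ ≤ _ := hr₀
            _ = _ := by rw [div_eq_inv_mul]
        calc s / p + t / q ≤ (p⁻¹ + q⁻¹)⁻¹ / p + (p⁻¹ + q⁻¹)⁻¹ / q := by
              gcongr <;> linarith
          _ = 1 := by field_simp
      have := hK.sum_mem (t := Finset.univ) (w := ![1 - s / p - t / q, s / p, t / q])
        (z := ![0, (p : ℂ), (q : ℂ) * Complex.exp (α * Complex.I)]) (by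
          intro i _
          fin_cases i
          · simp; linarith
          · exact div_nonneg hs hp.le
          · exact div_nonneg ht hq.le) (by
          simp only [Fin.sum_univ_three, Matrix.cons_val_zero, Matrix.cons_val_one, Matrix.cons_val]
          ring) (by
          intro i _
          fin_cases i <;> assumption)
      rw [Fin.sum_univ_three] at this
      convert this using 1
      simp only [Matrix.cons_val_zero, Matrix.cons_val_one, Matrix.cons_val, smul_zero, zero_add,
        Complex.real_smul, Complex.ofReal_div]
      rw [e]
      have : (p : ℂ) ≠ 0 := by exact_mod_cast hp.ne'
      have : (q : ℂ) ≠ 0 := by exact_mod_cast hq.ne'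
      field_simp
  rw [hset, volume_sector hr.le (by linarith [pi_pos]) hα'.le,
    ← ENNReal.ofReal_mul (by positivity)]
  congr 1
  ring

/-! ### The regular hexagon -/

/-- The primitive sixth root of unity. -/
def ζ : ℂ := Complex.exp (π / 3 * Complex.I)

theorem ζ_eq : ζ = ⟨1 / 2, √3 / 2⟩ := by
  rw [ζ, show (π / 3 * Complex.I : ℂ) = ((π / 3 : ℝ) : ℂ) * Complex.I by push_cast; ring,
    Complex.exp_mul_I, ← Complex.ofReal_cos, ← Complex.ofReal_sin, cos_pi_div_three,
    sin_pi_div_three]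
  apply Complex.ext <;> simp

theorem ζ_re : ζ.re = 1 / 2 := by rw [ζ_eq]

theorem ζ_im : ζ.im = √3 / 2 := by rw [ζ_eq]

theorem ζ_sq : ζ ^ 2 = ζ - 1 := by
  have h3 : √3 * √3 = 3 := mul_self_sqrt (by norm_num)
  apply Complex.ext
  · rw [sq, Complex.mul_re, Complex.sub_re, ζ_re, ζ_im, Complex.one_re]; linarith
  · rw [sq, Complex.mul_im, Complex.sub_im, ζ_re, ζ_im, Complex.one_im]; ring

theorem ζ_pow_three : ζ ^ 3 = -1 := by linear_combination (ζ + 1) * ζ_sq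

theorem ζ_pow_six : ζ ^ 6 = 1 := by linear_combination (ζ ^ 3 - 1) * ζ_pow_three

theorem ζ_pow_four : ζ ^ 4 = -ζ := by linear_combination ζ * ζ_pow_three

theorem ζ_pow_five : ζ ^ 5 = 1 - ζ := by linear_combination ζ ^ 2 * ζ_pow_three - ζ_sq

theorem norm_ζ : ‖ζ‖ = 1 := by
  have : ‖ζ‖ ^ 6 = 1 := by rw [← norm_pow, ζ_pow_six, norm_one]
  exact (pow_eq_one_iff_of_nonneg (norm_nonneg _) (by norm_num)).1 this

theorem exp_eq_ζ_sq : Complex.exp ((2 * π / 3 : ℝ) * Complex.I) = ζ ^ 2 := by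
  rw [ζ, ← Complex.exp_nat_mul]
  congr 1
  push_cast
  ring

theorem corner_eq (a : ℝ) (k : Fin 6) : corner a k = a * ζ ^ (k : ℕ) := by
  rw [corner, ζ, ← Complex.exp_nat_mul, mul_assoc]

theorem ζ_pow_add_one (k : Fin 6) : ζ ^ ((k + 1 : Fin 6) : ℕ) = ζ ^ (k : ℕ) * ζ := by
  rw [Fin.val_add, ← pow_eq_pow_mod _ ζ_pow_six, pow_add]
  simp

theorem edgePoint_eq (a : ℝ) (k : Fin 6) (t : ℝ) :
    edgePoint a k t = ζ ^ (k : ℕ) * (a + t * a * ζ ^ 2) := by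
  rw [edgePoint, AffineMap.lineMap_apply, corner_eq, corner_eq, ζ_pow_add_one, ζ_sq]
  simp only [vsub_eq_sub, vadd_eq_add, Complex.real_smul]
  ring

theorem convex_hexagon (a : ℝ) : Convex ℝ (hexagon a) := convex_convexHull ℝ _

theorem isCompact_hexagon (a : ℝ) : IsCompact (hexagon a) :=
  (finite_range (corner a)).isCompact_convexHull (𝕜 := ℝ)

theorem corner_mem (a : ℝ) (k : Fin 6) : corner a k ∈ hexagon a :=
  subset_convexHull ℝ _ ⟨k, rfl⟩

theorem corner_eq_edgePoint (a : ℝ) (k : Fin 6) : corner a k = edgePoint a k 0 := by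
  simp [edgePoint]

theorem edgePoint_mem {a : ℝ} (k : Fin 6) {t : ℝ} (ht : t ∈ Icc (0 : ℝ) 1) :
    edgePoint a k t ∈ hexagon a :=
  (convex_hexagon a).segment_subset (corner_mem a k) (corner_mem a (k + 1))
    (by rw [segment_eq_image_lineMap]; exact ⟨t, ht, rfl⟩)

theorem ζ_pow_mul_mem {a : ℝ} {z : ℂ} (hz : z ∈ hexagon a) (k : ℕ) : ζ ^ k * z ∈ hexagon a := by
  induction k with
  | zero => simpa using hz
  | succ k ih =>
    have hsub : (LinearMap.mulLeft ℝ ζ) '' hexagon a ⊆ hexagon a := by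
      rw [hexagon, LinearMap.image_convexHull]
      apply convexHull_mono
      rintro _ ⟨_, ⟨j, rfl⟩, rfl⟩
      refine ⟨j + 1, ?_⟩
      rw [corner_eq, corner_eq, ζ_pow_add_one, LinearMap.mulLeft_apply]
      ring
    have := hsub ⟨_, ih, rfl⟩
    rw [LinearMap.mulLeft_apply, ← mul_assoc] at this
    rwa [pow_succ']

theorem ζ_pow_mul_mem_iff {a : ℝ} {z : ℂ} (k : ℕ) : ζ ^ k * z ∈ hexagon a ↔ z ∈ hexagon a := by
  refine ⟨fun h => ?_, fun h => ζ_pow_mul_mem h k⟩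
  have := ζ_pow_mul_mem h (5 * k)
  rwa [← mul_assoc, ← pow_add, show 5 * k + k = 6 * k by ring, pow_mul, ζ_pow_six, one_pow,
    one_mul] at this

theorem zero_mem_hexagon (a : ℝ) : (0 : ℂ) ∈ hexagon a := by
  have h := (convex_hexagon a).midpoint_mem (corner_mem a 0) (corner_mem a 3)
  have h3 : ζ ^ ((3 : Fin 6) : ℕ) = -1 := ζ_pow_three
  have h0 : midpoint ℝ (corner a 0) (corner a 3) = 0 := by
    rw [corner_eq, corner_eq, h3, midpoint_eq_smul_add]
    simp
  rwa [h0] at h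

/-- The linear functional that equals `1` on the line through the corners `1` and `ζ`. -/
def edgeForm (z : ℂ) : ℝ := z.re + z.im / √3

theorem edgeForm_add_mul (s t : ℝ) : edgeForm (s + t * ζ) = s + t := by
  simp only [edgeForm, Complex.add_re, Complex.add_im, Complex.mul_re, Complex.mul_im,
    Complex.ofReal_re, Complex.ofReal_im, ζ_re, ζ_im]
  field_simp
  ring

theorem edgeForm_le {a : ℝ} (ha : 0 < a) {z : ℂ} (hz : z ∈ hexagon a) : edgeForm z ≤ a := by
  have hconv : Convex ℝ {z : ℂ | edgeForm z ≤ a} := by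
    refine convex_halfSpace_le (f := edgeForm) ⟨fun x y => ?_, fun c x => ?_⟩ a
    · simp only [edgeForm, Complex.add_re, Complex.add_im]; ring
    · simp only [edgeForm, Complex.real_smul, Complex.mul_re, Complex.mul_im, Complex.ofReal_re,
        Complex.ofReal_im, smul_eq_mul]; ring
  refine convexHull_min ?_ hconv hz
  have hc : ∀ (j : Fin 6) (s t : ℝ), ζ ^ (j : ℕ) = (s : ℂ) + t * ζ → s + t ≤ 1 →
      corner a j ∈ {z : ℂ | edgeForm z ≤ a} := by
    intro j s t h1 h2
    rw [mem_ofPred_eq, corner_eq, h1]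
    have : (a : ℂ) * (s + t * ζ) = ((a * s : ℝ) : ℂ) + ((a * t : ℝ) : ℂ) * ζ := by push_cast; ring
    rw [this, edgeForm_add_mul]
    nlinarith
  rintro _ ⟨j, rfl⟩
  fin_cases j
  · exact hc 0 1 0 (by simp) (by norm_num)
  · exact hc 1 0 1 (by simp) (by norm_num)
  · exact hc 2 (-1) 1 ((show ζ ^ (((2 : Fin 6)) : ℕ) = _ from ζ_sq).trans (by push_cast; ring)) (by norm_num)
  · exact hc 3 (-1) 0 ((show ζ ^ (((3 : Fin 6)) : ℕ) = _ from ζ_pow_three).trans (by push_cast; ring)) (by norm_num)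
  · exact hc 4 0 (-1) ((show ζ ^ (((4 : Fin 6)) : ℕ) = _ from ζ_pow_four).trans (by push_cast; ring)) (by norm_num)
  · exact hc 5 1 (-1) ((show ζ ^ (((5 : Fin 6)) : ℕ) = _ from ζ_pow_five).trans (by push_cast; ring)) (by norm_num)

theorem add_mul_ζ_mem {a s t : ℝ} (ha : 0 < a) (hs : 0 ≤ s) (ht : 0 ≤ t) (hst : s + t ≤ a) :
    (s : ℂ) + t * ζ ∈ hexagon a := by
  have h := (convex_hexagon a).sum_mem (t := Finset.univ) (w := ![1 - s / a - t / a, s / a, t / a])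
    (z := ![0, corner a 0, corner a 1]) (by
      intro i _
      fin_cases i
      · simp only [Fin.zero_eta, Matrix.cons_val_zero]
        rw [sub_sub, ← add_div, sub_nonneg, div_le_one ha]
        exact hst
      · exact div_nonneg hs ha.le
      · exact div_nonneg ht ha.le) (by
      simp only [Fin.sum_univ_three, Matrix.cons_val_zero, Matrix.cons_val_one, Matrix.cons_val]
      ring) (by
      intro i _
      fin_cases i
      · exact zero_mem_hexagon a
      · exact corner_mem a 0
      · exact corner_mem a 1)
  rw [Fin.sum_univ_three] at h
  convert h using 1
  simp only [Matrix.cons_val_zero, Matrix.cons_val_one, Matrix.cons_val, smul_zero, zero_add,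
    Complex.real_smul, Complex.ofReal_div, corner_eq]
  have : (a : ℂ) ≠ 0 := by exact_mod_cast ha.ne'
  simp
  field_simp

/-- Every point of the plane lies in one of six sectors. -/
theorem exists_sector (z : ℂ) : ∃ (k : Fin 6) (s t : ℝ), 0 ≤ s ∧ 0 ≤ t ∧
    z = ζ ^ (k : ℕ) * (s + t * ζ) := by
  obtain ⟨x, y, hxy⟩ : ∃ x y : ℝ, z = x + y * ζ := by
    refine ⟨z.re - z.im / √3, 2 * z.im / √3, ?_⟩
    apply Complex.ext
    · simp only [Complex.add_re, Complex.mul_re, Complex.ofReal_re, Complex.ofReal_im, ζ_re, ζ_im]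
      ring
    · simp only [Complex.add_im, Complex.mul_im, Complex.ofReal_re, Complex.ofReal_im, ζ_re, ζ_im]
      field_simp
      ring
  rw [hxy]
  rcases le_or_gt 0 x with hx | hx <;> rcases le_or_gt 0 y with hy | hy
  · exact ⟨0, x, y, hx, hy, by simp⟩
  · rcases le_or_gt (x + y) 0 with h | h
    · refine ⟨4, -x - y, x, by linarith, hx, ?_⟩
      have : ((4 : Fin 6) : ℕ) = 4 := rfl
      rw [this]; push_cast
      linear_combination -(-x - y + x * ζ : ℂ) * ζ_pow_four + x * ζ_sq
    · refine ⟨5, -y, x + y, by linarith, h.le, ?_⟩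
      have : ((5 : Fin 6) : ℕ) = 5 := rfl
      rw [this]; push_cast
      linear_combination -(-y + (x + y) * ζ : ℂ) * ζ_pow_five + (x + y) * ζ_sq
  · rcases le_or_gt 0 (x + y) with h | h
    · refine ⟨1, x + y, -x, h, by linarith, ?_⟩
      have : ((1 : Fin 6) : ℕ) = 1 := rfl
      rw [this]; push_cast
      linear_combination (x : ℂ) * ζ_sq
    · refine ⟨2, y, -x - y, hy, by linarith, ?_⟩
      have : ((2 : Fin 6) : ℕ) = 2 := rfl
      rw [this]; push_cast
      linear_combination -(y : ℂ) * ζ_sq + (x + y) * ζ_pow_three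
  · refine ⟨3, -x, -y, by linarith, by linarith, ?_⟩
    have : ((3 : Fin 6) : ℕ) = 3 := rfl
    rw [this]; push_cast
    linear_combination (x + y * ζ : ℂ) * ζ_pow_three

theorem edgeForm_ζ_pow_mul {a : ℝ} (ha : 0 < a) {k : ℕ} {s t : ℝ}
    (h : ζ ^ k * (s + t * ζ) ∈ hexagon a) : s + t ≤ a := by
  rw [ζ_pow_mul_mem_iff] at h
  have := edgeForm_le ha h
  rwa [edgeForm_add_mul] at this

theorem zero_mem_interior_hexagon {a : ℝ} (ha : 0 < a) : (0 : ℂ) ∈ interior (hexagon a) := by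
  rw [mem_interior_iff_mem_nhds, Metric.mem_nhds_iff]
  refine ⟨a / 2, by positivity, fun z hz => ?_⟩
  obtain ⟨k, s, t, hs, ht, rfl⟩ := exists_sector z
  rw [ζ_pow_mul_mem_iff]
  refine add_mul_ζ_mem ha hs ht ?_
  rw [mem_ball_zero_iff, norm_mul, norm_pow, norm_ζ, one_pow, one_mul] at hz
  have h1 : edgeForm (s + t * ζ) ≤ ‖(s : ℂ) + t * ζ‖ + ‖(s : ℂ) + t * ζ‖ := by
    unfold edgeForm
    have h2 := Complex.abs_re_le_norm ((s : ℂ) + t * ζ)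
    have h3 := Complex.abs_im_le_norm ((s : ℂ) + t * ζ)
    have h4 : (1 : ℝ) ≤ √3 := Real.one_le_sqrt.2 (by norm_num)
    have h5 : ((s : ℂ) + t * ζ).im / √3 ≤ |((s : ℂ) + t * ζ).im| := by
      rw [div_le_iff₀ (by linarith)]
      have := abs_nonneg ((s : ℂ) + t * ζ).im
      nlinarith [le_abs_self ((s : ℂ) + t * ζ).im]
    linarith [le_abs_self ((s : ℂ) + t * ζ).re]
  rw [edgeForm_add_mul] at h1
  linarith

theorem mem_interior_or_edgePoint {a : ℝ} (ha : 0 < a) {z : ℂ} (hz : z ∈ hexagon a) :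
    z ∈ interior (hexagon a) ∨ ∃ (k : Fin 6) (t : ℝ), t ∈ Icc (0 : ℝ) 1 ∧ z = edgePoint a k t := by
  obtain ⟨k, s, t, hs, ht, rfl⟩ := exists_sector z
  rcases lt_or_eq_of_le (edgeForm_ζ_pow_mul ha hz) with h | h
  · left
    by_cases h0 : s + t = 0
    · have hs0 : s = 0 := by linarith
      have ht0 : t = 0 := by linarith
      simpa [hs0, ht0] using zero_mem_interior_hexagon ha
    have hpos : 0 < s + t := lt_of_le_of_ne (by positivity) (Ne.symm h0)
    have hmem : ζ ^ (k : ℕ) * (((a * s / (s + t) : ℝ) : ℂ) + ((a * t / (s + t) : ℝ) : ℂ) * ζ) ∈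
        hexagon a := by
      rw [ζ_pow_mul_mem_iff]
      refine add_mul_ζ_mem ha (by positivity) (by positivity) ?_
      rw [← add_div, ← mul_add, mul_div_cancel_right₀ _ h0]
    have := (convex_hexagon a).combo_interior_self_mem_interior (zero_mem_interior_hexagon ha) hmem
      (a := 1 - (s + t) / a) (b := (s + t) / a) (by rw [sub_pos, div_lt_one ha]; exact h)
      (by positivity) (by ring)
    convert this using 1
    have h1 : (a : ℂ) ≠ 0 := by exact_mod_cast ha.ne'
    have h2 : (s + t : ℂ) ≠ 0 := by exact_mod_cast h0
    simp only [smul_zero, zero_add, Complex.real_smul]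
    push_cast
    field_simp
  · right
    refine ⟨k, t / a, ⟨by positivity, (div_le_one ha).2 (by linarith)⟩, ?_⟩
    rw [edgePoint_eq, ζ_sq]
    have h1 : (a : ℂ) ≠ 0 := by exact_mod_cast ha.ne'
    have h2 : (s : ℂ) = a - t := by rw [← h]; push_cast; ring
    rw [h2]
    push_cast
    field_simp
    ring

theorem edgePoint_notMem_interior {a : ℝ} (ha : 0 < a) (k : Fin 6) (t : ℝ) :
    edgePoint a k t ∉ interior (hexagon a) := by
  intro h
  rw [mem_interior_iff_mem_nhds] at h
  have hcont : ContinuousAt (fun c : ℝ => (c : ℂ) * edgePoint a k t) 1 := by fun_prop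
  have h1 := hcont.preimage_mem_nhds (by simpa using h)
  rw [Metric.mem_nhds_iff] at h1
  obtain ⟨ε, hε, h1⟩ := h1
  have h2 : ((1 + ε / 2 : ℝ) : ℂ) * edgePoint a k t ∈ hexagon a :=
    @h1 (1 + ε / 2) (by simp [abs_of_pos hε, hε.lt])
  have h3 : ((1 + ε / 2 : ℝ) : ℂ) * edgePoint a k t = ζ ^ (k : ℕ) *
      (((1 + ε / 2) * (a - t * a) : ℝ) + (((1 + ε / 2) * (t * a) : ℝ) : ℂ) * ζ) := by
    rw [edgePoint_eq, ζ_sq]; push_cast; ring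
  rw [h3] at h2
  have := edgeForm_ζ_pow_mul ha h2
  nlinarith

end HexGlue

end

noncomputable section

namespace HexGlue

open Set MeasureTheory Real Measure

/-- The rigid motion that moves the real axis to the line of the `k`-th edge and the origin to the
image of `x`. -/
def edgeMotion (k : ℕ) (x : ℂ) (w : ℂ) : ℂ := ζ ^ k * (x + w * ζ ^ 2)

theorem isometry_edgeMotion (k : ℕ) (x : ℂ) : Isometry (edgeMotion k x) := by
  refine Isometry.of_dist_eq fun z w => ?_
  rw [dist_eq_norm, dist_eq_norm, edgeMotion, edgeMotion, ← mul_sub, norm_mul, norm_pow, norm_ζ,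
    add_sub_add_left_eq_sub, ← sub_mul, norm_mul, norm_pow, norm_ζ]
  simp

theorem volume_hexagon_inter_ball {a : ℝ} (k : ℕ) (x : ℂ) (r : ℝ) :
    volume (hexagon a ∩ Metric.ball (ζ ^ k * x) r) =
      volume ({w : ℂ | x + w * ζ ^ 2 ∈ hexagon a} ∩ Metric.ball 0 r) := by
  rw [← volume_image_isometry (isometry_edgeMotion k x)
    ({w : ℂ | x + w * ζ ^ 2 ∈ hexagon a} ∩ Metric.ball 0 r)]
  congr 1
  have h0 : edgeMotion k x 0 = ζ ^ k * x := by simp [edgeMotion]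
  have hζ : ζ ≠ 0 := by rw [← norm_ne_zero_iff, norm_ζ]; norm_num
  ext z
  constructor
  · rintro ⟨h1, h2⟩
    have hz : edgeMotion k x ((z / ζ ^ k - x) / ζ ^ 2) = z := by
      rw [edgeMotion]; field_simp; ring
    refine ⟨(z / ζ ^ k - x) / ζ ^ 2, ⟨?_, ?_⟩, hz⟩
    · rw [← hz, edgeMotion, ζ_pow_mul_mem_iff] at h1
      exact h1
    · rwa [Metric.mem_ball, ← (isometry_edgeMotion k x).dist_eq, h0, hz]
  · rintro ⟨w, ⟨h1, h2⟩, rfl⟩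
    refine ⟨?_, ?_⟩
    · rw [edgeMotion, ζ_pow_mul_mem_iff]; exact h1
    · rw [← h0, Metric.mem_ball, (isometry_edgeMotion k x).dist_eq]; exact h2

theorem convex_preimage_hexagon (a : ℝ) (x : ℂ) : Convex ℝ {w : ℂ | x + w * ζ ^ 2 ∈ hexagon a} := by
  intro p hp q hq b c hb hc hbc
  have := convex_hexagon a hp hq hb hc hbc
  rw [mem_ofPred_eq]
  convert this using 1
  have : (b : ℂ) + c = 1 := by exact_mod_cast hbc
  simp only [Complex.real_smul]
  linear_combination -x * this

theorem volume_corner {a : ℝ} (ha : 0 < a) (k : Fin 6) : ∃ r₀ > 0, ∀ r, 0 < r → r ≤ r₀ →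
    volume (hexagon a ∩ Metric.ball (corner a k) r) = ENNReal.ofReal (2 * π / 3 * r ^ 2 / 2) := by
  have hcor : ∀ j : Fin 6, ∀ z : ℂ, z = corner a j → z ∈ hexagon a := fun j z h =>
    h ▸ corner_mem a j
  have hC : Convex ℝ {z : ℂ | ∃ s t : ℝ, 0 ≤ s ∧ 0 ≤ t ∧ z = a + (s + t * ζ ^ 2) * ζ ^ 2} := by
    rintro p ⟨s, t, hs, ht, rfl⟩ q ⟨s', t', hs', ht', rfl⟩ b c hb hc hbc
    refine ⟨b * s + c * s', b * t + c * t', by positivity, by positivity, ?_⟩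
    have : (b : ℂ) + c = 1 := by exact_mod_cast hbc
    simp only [Complex.real_smul]
    push_cast
    linear_combination (a : ℂ) * this
  have hsub : hexagon a ⊆ {z : ℂ | ∃ s t : ℝ, 0 ≤ s ∧ 0 ≤ t ∧ z = a + (s + t * ζ ^ 2) * ζ ^ 2} := by
    refine convexHull_min ?_ hC
    have hc : ∀ (j : Fin 6) (s t : ℝ), 0 ≤ s → 0 ≤ t →
        ζ ^ (j : ℕ) = 1 + (s + t * ζ ^ 2) * ζ ^ 2 →
        corner a j ∈ {z : ℂ | ∃ s t : ℝ, 0 ≤ s ∧ 0 ≤ t ∧ z = a + (s + t * ζ ^ 2) * ζ ^ 2} := by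
      intro j s t hs ht h
      refine ⟨a * s, a * t, by positivity, by positivity, ?_⟩
      rw [corner_eq, h]; push_cast; ring
    have h4 : (ζ ^ 2) * ζ ^ 2 = -ζ := by rw [← pow_add, ζ_pow_four]
    rintro _ ⟨j, rfl⟩
    fin_cases j
    · exact hc 0 0 0 le_rfl le_rfl (by simp)
    · exact hc 1 1 0 (by norm_num) (by norm_num) ((show ζ ^ ((1 : Fin 6) : ℕ) = _ from
        pow_one ζ).trans (by push_cast; linear_combination -ζ_sq))
    · exact hc 2 2 1 (by norm_num) (by norm_num) ((show ζ ^ ((2 : Fin 6) : ℕ) = _ from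
        ζ_sq).trans (by push_cast; linear_combination -h4 - 2 * ζ_sq))
    · exact hc 3 2 2 (by norm_num) (by norm_num) ((show ζ ^ ((3 : Fin 6) : ℕ) = _ from
        ζ_pow_three).trans (by push_cast; linear_combination -2 * h4 - 2 * ζ_sq))
    · exact hc 4 1 2 (by norm_num) (by norm_num) ((show ζ ^ ((4 : Fin 6) : ℕ) = _ from
        ζ_pow_four).trans (by push_cast; linear_combination -2 * h4 - ζ_sq))
    · exact hc 5 0 1 (by norm_num) (by norm_num) ((show ζ ^ ((5 : Fin 6) : ℕ) = _ from
        ζ_pow_five).trans (by push_cast; linear_combination -h4))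
  obtain ⟨r₀, hr₀, h⟩ := volume_local_sector (convex_preimage_hexagon a a) (α := 2 * π / 3) ha ha
    (by positivity) (by linarith [pi_pos])
    (by
      rw [mem_ofPred_eq]
      exact hcor 0 _ (by rw [corner_eq]; simp))
    (by
      rw [mem_ofPred_eq]
      refine hcor 1 _ ?_
      rw [corner_eq, show ζ ^ ((1 : Fin 6) : ℕ) = _ from pow_one ζ]
      linear_combination (a : ℂ) * ζ_sq)
    (by
      rw [mem_ofPred_eq, exp_eq_ζ_sq]
      refine hcor 5 _ ?_
      rw [corner_eq, show ζ ^ ((5 : Fin 6) : ℕ) = _ from ζ_pow_five]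
      linear_combination (a : ℂ) * ζ_pow_four)
    (fun w hw => by
      obtain ⟨s, t, hs, ht, e⟩ := hsub hw
      refine ⟨s, t, hs, ht, ?_⟩
      have hζ : ζ ^ 2 ≠ 0 := by rw [← norm_ne_zero_iff, norm_pow, norm_ζ]; norm_num
      rw [exp_eq_ζ_sq]
      exact mul_right_cancel₀ hζ (add_left_cancel e))
  refine ⟨r₀, hr₀, fun r hr hr' => ?_⟩
  rw [← h r hr hr', ← volume_hexagon_inter_ball k, corner_eq, mul_comm]

theorem volume_edgePoint {a : ℝ} (ha : 0 < a) (k : Fin 6) {t : ℝ} (ht : t ∈ Ioo (0 : ℝ) 1) :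
    ∃ r₀ > 0, ∀ r, 0 < r → r ≤ r₀ →
    ENNReal.ofReal (π * r ^ 2 / 2) ≤ volume (hexagon a ∩ Metric.ball (edgePoint a k t) r) := by
  obtain ⟨δ, hδ, hδ1, hδ2⟩ : ∃ δ > 0, δ ≤ t * a ∧ δ ≤ (1 - t) * a :=
    ⟨min (t * a) ((1 - t) * a), lt_min (mul_pos ht.1 ha) (mul_pos (by linarith [ht.2]) ha),
      min_le_left _ _, min_le_right _ _⟩
  let x : ℂ := a + t * a * ζ ^ 2
  let K : Set ℂ := {w : ℂ | x + w * ζ ^ 2 ∈ hexagon a}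
  have hK : Convex ℝ K := convex_preimage_hexagon a x
  have hreal : ∀ s : ℝ, |s| ≤ δ → (s : ℂ) ∈ K := by
    intro s hs
    have h1 := abs_le.1 hs
    have h2 := edgePoint_mem (a := a) 0 (t := t + s / a) ⟨by
      rw [← sub_nonneg]
      have : t + s / a - 0 = (t * a + s) / a := by field_simp; ring
      rw [this]; exact div_nonneg (by linarith) ha.le, by
      rw [← sub_nonneg]
      have : 1 - (t + s / a) = ((1 - t) * a - s) / a := by field_simp; ring
      rw [this]; exact div_nonneg (by linarith) ha.le⟩
    rw [edgePoint_eq] at h2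
    change (a : ℂ) + t * a * ζ ^ 2 + s * ζ ^ 2 ∈ hexagon a
    have ha' : (a : ℂ) ≠ 0 := by exact_mod_cast ha.ne'
    convert h2 using 1
    simp
    field_simp
    ring
  let c : ℂ := a * ζ - t * a
  have hcK : c ∈ K := by
    change (a : ℂ) + t * a * ζ ^ 2 + (a * ζ - t * a) * ζ ^ 2 ∈ hexagon a
    have : (a : ℂ) + t * a * ζ ^ 2 + (a * ζ - t * a) * ζ ^ 2 = 0 := by
      linear_combination (a : ℂ) * ζ_pow_three
    rw [this]
    exact zero_mem_hexagon a
  have hcim : c.im = a * (√3 / 2) := by simp [c, ζ_im]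
  have hcpos : 0 < c.im := by rw [hcim]; positivity
  refine ⟨δ / (1 + |c.re| / c.im + δ / c.im), by positivity, fun r hr hr' => ?_⟩
  rw [edgePoint_eq, volume_hexagon_inter_ball]
  have hvol := volume_sector hr.le (α := 0) (β := π) (by linarith [pi_pos]) le_rfl
  rw [← ENNReal.ofReal_mul (by positivity), show r ^ 2 / 2 * (π - 0) = π * r ^ 2 / 2 by ring] at hvol
  rw [← hvol]
  refine measure_mono ?_
  rintro w ⟨hw, h0, -⟩
  refine ⟨?_, mem_ball_zero_iff.2 hw⟩
  have him : 0 ≤ w.im := Complex.arg_nonneg_iff.1 h0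
  have hwim : w.im ≤ r := (Complex.abs_im_le_norm w |> (le_abs_self _).trans).trans hw.le
  have hwre : |w.re| ≤ r := (Complex.abs_re_le_norm w).trans hw.le
  rw [le_div_iff₀ (by positivity)] at hr'
  obtain ⟨l, hl⟩ : ∃ l, l = w.im / c.im := ⟨_, rfl⟩
  have hl0 : 0 ≤ l := hl ▸ div_nonneg him hcpos.le
  have hlr : l ≤ r / c.im := hl ▸ div_le_div_of_nonneg_right hwim hcpos.le
  have hbound : |w.re - l * c.re| + l * δ ≤ δ := by
    have h1 : |w.re - l * c.re| ≤ |w.re| + l * |c.re| := by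
      refine (abs_sub _ _).trans_eq ?_
      rw [abs_mul, abs_of_nonneg hl0]
    have h2 : l * |c.re| ≤ r / c.im * |c.re| := by gcongr
    have h3 : l * δ ≤ r / c.im * δ := by gcongr
    have h4 : r * (1 + |c.re| / c.im + δ / c.im) = r + r / c.im * |c.re| + r / c.im * δ := by
      field_simp
    linarith
  have hl1 : l < 1 ∨ w.re - l * c.re = 0 := by
    by_contra! hc
    have := abs_pos.2 hc.2
    nlinarith [hc.1]
  have hl1' : l ≤ 1 := by
    have := abs_nonneg (w.re - l * c.re)
    nlinarith
  have hmem : (((w.re - l * c.re) / (1 - l) : ℝ) : ℂ) ∈ K := by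
    apply hreal
    rcases hl1 with h | h
    · rw [abs_div, abs_of_pos (by linarith : (0 : ℝ) < 1 - l), div_le_iff₀ (by linarith)]
      linarith
    · rw [h]; simp [hδ.le]
  have := hK hmem hcK (a := 1 - l) (b := l) (by linarith) hl0 (by ring)
  change w ∈ K
  convert this using 1
  apply Complex.ext
  · simp only [Complex.real_smul, Complex.add_re, Complex.mul_re, Complex.ofReal_re,
      Complex.ofReal_im, zero_mul, sub_zero]
    rcases hl1 with h | h
    · have : 1 - l ≠ 0 := by linarith
      field_simp
      ring
    · rw [h, zero_div, mul_zero, zero_add]; linarith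
  · simp only [Complex.real_smul, Complex.add_im, Complex.mul_im, Complex.ofReal_re,
      Complex.ofReal_im, zero_mul, add_zero, mul_zero]
    rw [hl]
    field_simp
    ring

theorem volume_interior {a : ℝ} {x : ℂ} (hx : x ∈ interior (hexagon a)) :
    ∃ r₀ > 0, ∀ r, 0 < r → r ≤ r₀ →
    ENNReal.ofReal (π * r ^ 2) ≤ volume (hexagon a ∩ Metric.ball x r) := by
  rw [mem_interior_iff_mem_nhds, Metric.mem_nhds_iff] at hx
  obtain ⟨r₀, hr₀, h⟩ := hx
  refine ⟨r₀, hr₀, fun r hr hr' => ?_⟩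
  rw [inter_eq_self_of_subset_right ((Metric.ball_subset_ball hr').trans h), Complex.volume_ball,
    mul_comm, ENNReal.ofReal_mul (by positivity), ENNReal.ofReal_pow hr.le,
    show (NNReal.pi : ENNReal) = ENNReal.ofReal π by
      rw [← NNReal.coe_real_pi, ENNReal.ofReal_coe_nnreal], mul_comm]

theorem volume_frontier_hexagon (a : ℝ) : volume (hexagon a \ interior (hexagon a)) = 0 := by
  have := (convex_hexagon a).addHaar_frontier (μ := volume)
  rwa [frontier, (isCompact_hexagon a).isClosed.closure_eq] at this

/-! ### The area of faces -/

theorem euclideanHausdorffMeasure_complex : (μHE[2] : Measure ℂ) = volume := by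
  have := InnerProductSpace.euclideanHausdorffMeasure_eq_volume (V := ℂ)
  rwa [Complex.finrank_real_complex] at this

theorem area_image_of_dist_eq {f : ℂ → E3} {C s : Set ℂ}
    (hf : ∀ x ∈ C, ∀ y ∈ C, dist (f x) (f y) = dist x y) (hs : s ⊆ C) :
    (μHE[2] : Measure E3) (f '' s) = volume s := by
  have h1 : Isometry (fun x : s => f x) := Isometry.of_dist_eq fun x y => hf x (hs x.2) y (hs y.2)
  have h2 := h1.euclideanHausdorffMeasure_image (d := 2) univ
  have h3 := (isometry_subtype_coe (s := s)).euclideanHausdorffMeasure_image (d := 2) univ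
  rw [image_univ, Subtype.range_coe, euclideanHausdorffMeasure_complex] at h3
  rw [h3, ← h2, image_univ, image_eq_range]

/-- A face can be unrolled isometrically into the plane, with its corner `v` at the origin. -/
theorem IsPlaneCone.exists_chart {F : Set E3} {v x y : E3} (h : IsPlaneCone F v x y)
    (hF : Convex ℝ F) (hv : v ∈ F) : ∃ φ : ℂ →ᵃⁱ[ℝ] E3, φ 0 = v ∧ F ⊆ range φ ∧
      ∃ r₀ > 0, ∀ r, 0 < r → r ≤ r₀ →
        volume (φ ⁻¹' F ∩ Metric.ball 0 r) = ENNReal.ofReal (faceAngle F v * r ^ 2 / 2) := by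
  have hsin := h.sin_angle_pos
  have hpos := h.faceAngle_pos
  have hlt := h.faceAngle_lt_pi
  rw [h.faceAngle_eq] at hpos hlt ⊢
  obtain ⟨b, hxb, hyb⟩ := exists_frame h.left_ne h.right_ne
  have hxn : 0 < ‖x - v‖ := norm_pos_iff.2 h.left_ne
  have hyn : 0 < ‖y - v‖ := norm_pos_iff.2 h.right_ne
  generalize InnerProductGeometry.angle (x - v) (y - v) = α at *
  let L : ℂ →ₗ[ℝ] E3 := (LinearMap.toSpanSingleton ℝ E3 (b 0)).comp Complex.reLm +
    (LinearMap.toSpanSingleton ℝ E3 (b 1)).comp Complex.imLm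
  have hL : ∀ z, L z = z.re • b 0 + z.im • b 1 := fun z => by simp [L]
  have hLn : ∀ z, ‖L z‖ = ‖z‖ := by
    intro z
    have h1 : ‖L z‖ ^ 2 = ‖z‖ ^ 2 := by
      rw [← real_inner_self_eq_norm_sq, hL, inner_add_left, inner_add_right, inner_add_right,
        inner_smul_left, inner_smul_left, inner_smul_left, inner_smul_left, inner_smul_right,
        inner_smul_right, inner_smul_right, inner_smul_right, b.inner_eq_ite, b.inner_eq_ite,
        b.inner_eq_ite, b.inner_eq_ite, Complex.sq_norm, Complex.normSq_apply]
      simp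
    exact (sq_eq_sq₀ (norm_nonneg _) (norm_nonneg _)).1 h1
  let φ : ℂ →ᵃⁱ[ℝ] E3 := ⟨(AffineMap.const ℝ ℂ v) + L.toAffineMap, fun z => by
    have : ((AffineMap.const ℝ ℂ v) + L.toAffineMap : ℂ →ᵃ[ℝ] E3).linear = L := by simp
    rw [this]; exact hLn z⟩
  have hφ : ∀ z, φ z = v + (z.re • b 0 + z.im • b 1) := fun z => by
    rw [← hL]; rfl
  have hexp : Complex.exp (α * Complex.I) = ⟨cos α, sin α⟩ := by
    rw [Complex.exp_mul_I]
    apply Complex.ext <;> simp [← Complex.ofReal_cos, ← Complex.ofReal_sin]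
  have hφx : φ (‖x - v‖ : ℂ) = x := by
    rw [hφ]
    simp only [Complex.ofReal_re, Complex.ofReal_im, zero_smul, add_zero]
    rw [← hxb]; abel
  have hφy : φ ((‖y - v‖ : ℂ) * Complex.exp (α * Complex.I)) = y := by
    rw [hφ, hexp]
    simp only [Complex.mul_re, Complex.mul_im, Complex.ofReal_re, Complex.ofReal_im, zero_mul,
      sub_zero, add_zero]
    rw [mul_smul, mul_smul, ← smul_add, ← hyb]; abel
  have hcone : ∀ s t : ℝ, φ (((s * ‖x - v‖ : ℝ) : ℂ) + ((t * ‖y - v‖ : ℝ) : ℂ) *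
      Complex.exp (α * Complex.I)) = v + (s • (x - v) + t • (y - v)) := by
    intro s t
    rw [hφ, hexp]
    nth_rewrite 3 [hxb]
    nth_rewrite 3 [hyb]
    simp only [Complex.add_re, Complex.add_im, Complex.mul_re, Complex.mul_im, Complex.ofReal_re,
      Complex.ofReal_im, zero_mul, sub_zero, add_zero, zero_add]
    module
  refine ⟨φ, by simp [hφ], fun p hp => ?_, ?_⟩
  · obtain ⟨s, t, -, -, e⟩ := h.exists_eq p hp
    exact ⟨_, (hcone s t).trans (by rw [← e]; abel)⟩
  · refine volume_local_sector (K := φ ⁻¹' F) (hF.affine_preimage φ.toAffineMap) hxn hyn hpos hlt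
      ?_ ?_ ?_ fun z hz => ?_
    · rw [mem_preimage, show φ 0 = v by simp [hφ]]; exact hv
    · rw [mem_preimage, hφx]; exact h.left_mem
    · rw [mem_preimage, hφy]; exact h.right_mem
    · obtain ⟨s, t, hs, ht, e⟩ := h.exists_eq _ hz
      refine ⟨s * ‖x - v‖, t * ‖y - v‖, by positivity, by positivity, φ.injective ?_⟩
      rw [hcone, ← e]; abel

theorem area_chart (φ : ℂ →ᵃⁱ[ℝ] E3) (s : Set ℂ) : (μHE[2] : Measure E3) (φ '' s) = volume s := by
  rw [φ.isometry.euclideanHausdorffMeasure_image, euclideanHausdorffMeasure_complex]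

end HexGlue

end

noncomputable section

namespace HexGlue

open Set MeasureTheory Real Measure Filter Topology

/-! ### Comparing areas around a vertex -/

theorem Gluing.Rel.eq_or_notMem_interior {n : ℕ} {G : Gluing n} {a : ℝ} (ha : 0 < a)
    {p q : Fin n × ℂ} (h : G.Rel a p q) :
    p = q ∨ (p.2 ∉ interior (hexagon a) ∧ q.2 ∉ interior (hexagon a)) := by
  induction h with
  | rel p q h =>
    obtain ⟨e, t, -, rfl, rfl⟩ := h
    exact Or.inr ⟨edgePoint_notMem_interior ha _ _, edgePoint_notMem_interior ha _ _⟩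
  | refl p => exact Or.inl rfl
  | symm p q _ ih => exact ih.imp Eq.symm And.symm
  | trans p q s _ _ ih1 ih2 =>
    rcases ih1 with rfl | h1
    · exact ih2
    · rcases ih2 with rfl | h2
      · exact Or.inr h1
      · exact Or.inr ⟨h1.1, h2.2⟩

theorem convex_face {V : Finset E3} {P : Set E3} (hV : IsVertexSet V P) (u : E3) :
    Convex ℝ (face P u) := by
  rw [hV.face_eq]; exact convex_convexHull ℝ _

theorem eventually_of_le {p : ℝ → Prop} (h : ∃ r₀ > 0, ∀ r, 0 < r → r ≤ r₀ → p r) :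
    ∀ᶠ r in 𝓝[>] (0 : ℝ), p r := by
  obtain ⟨r₀, hr₀, h⟩ := h
  filter_upwards [Ioc_mem_nhdsGT hr₀] with r hr using h r hr.1 hr.2

/-- All but a null set of the points of a face belong to no other face, and the area of the face
near a corner is given by its angle. -/
theorem IsVertexSet.exists_faceChart {V : Finset E3} {P : Set E3} (hV : IsVertexSet V P)
    {u v : E3} (hv : v ∈ V) (hu : u ∈ normalsAt P v) :
    ∃ D : Set E3, MeasurableSet D ∧ D ⊆ face P u ∧ (μHE[2] : Measure E3) (face P u \ D) = 0 ∧
      (∀ p ∈ D, ∀ m, (p, m) ∈ markedPoints P →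
        SamePoint P (p, m) (p, u) ∨ SamePoint P (p, u) (p, m) → m = u) ∧
      ∀ᶠ r in 𝓝[>] (0 : ℝ), (μHE[2] : Measure E3) (face P u ∩ Metric.ball v r) =
        ENNReal.ofReal (faceAngle (face P u) v * r ^ 2 / 2) := by
  obtain ⟨x, hx, y, hy, hc⟩ := hV.exists_isPlaneCone_face hv hu
  obtain ⟨φ, hφ0, hφ, hr⟩ := hc.exists_chart (convex_face hV u) hu.2
  have hconv : Convex ℝ (φ ⁻¹' face P u) := (convex_face hV u).affine_preimage φ.toAffineMap
  have himg : φ '' (φ ⁻¹' face P u) = face P u := image_preimage_eq_of_subset hφ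
  refine ⟨φ '' interior (φ ⁻¹' face P u), ?_, ?_, ?_, ?_, ?_⟩
  · exact isOpen_interior.measurableSet.image_of_continuousOn_injOn φ.continuous.continuousOn
      φ.injective.injOn
  · exact (image_mono interior_subset).trans himg.le
  · nth_rewrite 1 [← himg]
    rw [← image_sdiff φ.injective, area_chart]
    exact measure_mono_null (sdiff_subset_sdiff_left subset_closure) (hconv.addHaar_frontier volume)
  · rintro _ ⟨z, hz, rfl⟩ m hm hsame
    by_contra hmu
    have hzF : z ∈ φ ⁻¹' face P u := interior_subset hz
    rw [mem_preimage] at hzF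
    have hconst : ∀ q ∈ face P u, inner ℝ m (q - φ z) = (0 : ℝ) := by
      intro q hq
      obtain ⟨w, rfl⟩ := hφ hq
      refine le_antisymm (inner_sub_le_zero hm.2 hq.1) ?_
      rw [mem_interior_iff_mem_nhds] at hz
      have hcont : ContinuousAt (fun s : ℝ => AffineMap.lineMap z w s) 0 := by fun_prop
      have h1 := hcont.preimage_mem_nhds (by simpa using hz)
      obtain ⟨ε, hε, h1⟩ := Metric.mem_nhds_iff.1 h1
      have h2 : φ (AffineMap.lineMap z w (-(ε / 2))) ∈ face P u :=
        @h1 (-(ε / 2)) (by simp [abs_of_pos hε, hε.lt])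
      have h3 := inner_sub_le_zero hm.2 h2.1
      have h4 : φ (AffineMap.lineMap z w (-(ε / 2))) - φ z = (-(ε / 2)) • (φ w - φ z) := by
        rw [← φ.coe_toAffineMap, AffineMap.apply_lineMap, AffineMap.lineMap_apply]
        simp
      rw [h4, inner_smul_right] at h3
      nlinarith
    have hmv : ∀ q ∈ face P u, inner ℝ m (q - v) = (0 : ℝ) := by
      intro q hq
      have h1 := hconst q hq
      have h2 := hconst v hu.2
      rw [inner_sub_right] at h1 h2 ⊢
      linarith
    have hneg : m = -u := (unit_normal_eq hc.linearIndependent hu.1.1 hm.1.1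
      (inner_sub_eq_zero_of_mem_face hc.left_mem hu.2)
      (inner_sub_eq_zero_of_mem_face hc.right_mem hu.2) (hmv x hc.left_mem)
      (hmv y hc.right_mem)).resolve_left hmu
    have hface : face P m = face P u := by
      have hall : ∀ q ∈ P, inner ℝ u (q - φ z) = (0 : ℝ) := by
        intro q hq
        have h1 := inner_sub_le_zero hzF hq
        have h2 := inner_sub_le_zero hm.2 hq
        change inner ℝ m (q - φ z) ≤ 0 at h2
        rw [hneg, inner_neg_left] at h2
        linarith
      ext q
      constructor
      · exact fun hq => mem_face_of_inner hzF hq.1 (hall q hq.1)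
      · exact fun hq => mem_face_of_inner hm.2 hq.1 (by
          rw [show inner ℝ (φ z, m).2 (q - (φ z, m).1) = inner ℝ m (q - φ z) from rfl, hneg,
            inner_neg_left, hall q hq.1, neg_zero])
    have hfr : φ z ∉ intrinsicFrontier ℝ (face P u) := by
      rw [← himg, φ.intrinsicFrontier_image]
      rintro ⟨w, hw, hwz⟩
      rw [φ.injective hwz] at hw
      exact (intrinsicFrontier_subset_frontier hw).2 hz
    rcases hsame with h | h
    · rcases h.2 with h | h
      · exact hmu h
      · exact hfr (hface ▸ h)
    · rcases h.2 with h | h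
      · exact hmu h.symm
      · exact hfr h
  · refine (eventually_of_le hr).mono fun r hr => ?_
    rw [← hr, ← area_chart φ]
    congr 1
    ext p
    constructor
    · rintro ⟨h1, h2⟩
      obtain ⟨z, rfl⟩ := hφ h1
      refine ⟨z, ⟨h1, ?_⟩, rfl⟩
      rwa [Metric.mem_ball, ← φ.dist_map, hφ0]
    · rintro ⟨z, ⟨h1, h2⟩, rfl⟩
      refine ⟨h1, ?_⟩
      rwa [Metric.mem_ball, ← hφ0, φ.dist_map]

theorem measurableSet_inter_preimage {f : ℂ → E3} {C : Set ℂ} (hC : MeasurableSet C)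
    (hf : ContinuousOn f C) {M : Set E3} (hM : MeasurableSet M) : MeasurableSet (C ∩ f ⁻¹' M) := by
  have h1 : Measurable (C.domRestrict f) := (continuousOn_iff_continuous_domRestrict.1 hf).measurable
  have h2 := hC.subtype_image (h1 hM)
  convert h2 using 1
  ext x
  simp only [mem_inter_iff, mem_preimage, mem_image, Subtype.exists, exists_and_right,
    exists_eq_right, domRestrict_apply]
  exact ⟨fun h => ⟨h.1, h.2⟩, fun ⟨h, h'⟩ => ⟨h, h'⟩⟩

/-- The pieces of a folding, numbered. -/
structure Pieces {P : Set E3} {n : ℕ} {G : Gluing n} {a : ℝ} (F : Folding P G a) (m : ℕ) where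
  hex : Fin m → Fin n
  set : Fin m → Set ℂ
  normal : Fin m → E3
  isClosed : ∀ c, IsClosed (set c)
  subset : ∀ c, set c ⊆ hexagon a
  exists_mem : ∀ i, ∀ x ∈ hexagon a, ∃ c, hex c = i ∧ x ∈ set c
  mem_marked : ∀ c, ∀ x ∈ set c, ((F.fold (hex c) x).1, normal c) ∈ markedPoints P
  samePoint : ∀ c, ∀ x ∈ set c, SamePoint P (F.fold (hex c) x) ((F.fold (hex c) x).1, normal c)
  dist_eq : ∀ c, ∀ x ∈ set c, ∀ y ∈ set c,
    dist (F.fold (hex c) x).1 (F.fold (hex c) y).1 = dist x y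

theorem Folding.exists_pieces {P : Set E3} {n : ℕ} {G : Gluing n} {a : ℝ} (F : Folding P G a) :
    ∃ m, Nonempty (Pieces F m) := by
  choose 𝒞 hfin hun hC using F.pieces
  let T : Set (Fin n × Set ℂ) := {c | c.2 ∈ 𝒞 c.1}
  have hT : T.Finite := by
    refine (finite_iUnion fun i => (hfin i).image fun C => (i, C)).subset ?_
    rintro ⟨i, C⟩ h
    exact mem_iUnion.2 ⟨i, C, h, rfl⟩
  have := hT.fintype
  let e := Fintype.equivFin T
  choose u hu using fun (c : T) => (hC c.1.1 c.1.2 c.2).2.1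
  refine ⟨_, ⟨fun k => (e.symm k).1.1, fun k => (e.symm k).1.2, fun k => u (e.symm k), ?_, ?_, ?_,
    ?_, ?_, ?_⟩⟩
  · exact fun k => (hC _ _ (e.symm k).2).1
  · intro k
    rw [← hun (e.symm k).1.1]
    exact subset_sUnion_of_mem (e.symm k).2
  · intro i x hx
    rw [← hun i] at hx
    obtain ⟨C, hCm, hxC⟩ := hx
    refine ⟨e ⟨(i, C), hCm⟩, ?_, ?_⟩ <;> simp [hxC]
  · exact fun k x hx => (hu (e.symm k) x hx).1
  · exact fun k x hx => (hu (e.symm k) x hx).2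
  · exact fun k => (hC _ _ (e.symm k).2).2.2

variable {P : Set E3} {n : ℕ} {G : Gluing n} {a : ℝ} {F : Folding P G a} {m : ℕ}

/-- The points of the hexagons that are placed at `v`. -/
def Folding.fiber (F : Folding P G a) (v : E3) : Set (Fin n × ℂ) :=
  {p | p.2 ∈ hexagon a ∧ (F.fold p.1 p.2).1 = v}

theorem Pieces.eq_of_eq (Q : Pieces F m) {c : Fin m} {x y : ℂ} (hx : x ∈ Q.set c)
    (hy : y ∈ Q.set c) (h : (F.fold (Q.hex c) x).1 = (F.fold (Q.hex c) y).1) : x = y := by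
  have := Q.dist_eq c x hx y hy
  rw [h, dist_self] at this
  exact dist_eq_zero.1 this.symm

theorem Pieces.continuousOn (Q : Pieces F m) (c : Fin m) :
    ContinuousOn (fun x => (F.fold (Q.hex c) x).1) (Q.set c) := by
  rw [continuousOn_iff_continuous_domRestrict]
  exact (Isometry.of_dist_eq fun x y : Q.set c => Q.dist_eq c x x.2 y y.2).continuous

theorem Pieces.finite_fiber (Q : Pieces F m) (v : E3) : (F.fiber v).Finite := by
  have hsub : F.fiber v ⊆ ⋃ c : Fin m, (fun x => (Q.hex c, x)) ''
      {x ∈ Q.set c | (F.fold (Q.hex c) x).1 = v} := by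
    rintro ⟨i, x⟩ ⟨hx, hv⟩
    obtain ⟨c, rfl, hc⟩ := Q.exists_mem i x hx
    exact mem_iUnion.2 ⟨c, x, ⟨hc, hv⟩, rfl⟩
  refine (finite_iUnion fun c => Finite.image _ (Set.Subsingleton.finite ?_)).subset hsub
  rintro x ⟨hx, hxv⟩ y ⟨hy, hyv⟩
  exact Q.eq_of_eq hx hy (hxv.trans hyv.symm)

/-- Near `v` the folding maps balls around the points of the fiber of `v` onto the ball
around `v`. -/
theorem Pieces.eventually_preimage_ball (Q : Pieces F m) (v : E3) :
    ∀ᶠ r in 𝓝[>] (0 : ℝ),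
      (∀ c, ∀ y ∈ Q.set c, dist (F.fold (Q.hex c) y).1 v < r →
        ∃ x ∈ Q.set c, (F.fold (Q.hex c) x).1 = v ∧ dist y x < r) ∧
      (∀ p ∈ F.fiber v, ∀ y ∈ hexagon a, dist y p.2 < r → dist (F.fold p.1 y).1 v < r) ∧
      ∀ p ∈ F.fiber v, ∀ q ∈ F.fiber v, p.1 = q.1 → p ≠ q →
        Disjoint (Metric.ball p.2 r) (Metric.ball q.2 r) := by
  have hfin := Q.finite_fiber v
  have hpos : ∀ᶠ r in 𝓝[>] (0 : ℝ), 0 < r := self_mem_nhdsWithin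
  have hlt : ∀ s > 0, ∀ᶠ r in 𝓝[>] (0 : ℝ), r < s := fun s hs =>
    mem_nhdsWithin_of_mem_nhds (Iio_mem_nhds hs)
  have h1 : ∀ c, ∀ᶠ r in 𝓝[>] (0 : ℝ), ∀ y ∈ Q.set c, dist (F.fold (Q.hex c) y).1 v < r →
        ∃ x ∈ Q.set c, (F.fold (Q.hex c) x).1 = v ∧ dist y x < r := by
    intro c
    by_cases hex : ∃ x ∈ Q.set c, (F.fold (Q.hex c) x).1 = v
    · obtain ⟨x, hx, hxv⟩ := hex
      refine Eventually.of_forall fun r y hy hyr => ⟨x, hx, hxv, ?_⟩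
      rwa [← Q.dist_eq c y hy x hx, hxv]
    · have hcpt : IsCompact (Q.set c) := (isCompact_hexagon a).of_isClosed_subset (Q.isClosed c)
        (Q.subset c)
      have himg := (hcpt.image_of_continuousOn (Q.continuousOn c)).isClosed
      have hv : v ∈ ((fun x => (F.fold (Q.hex c) x).1) '' Q.set c)ᶜ := by
        rintro ⟨x, hx, hxv⟩; exact hex ⟨x, hx, hxv⟩
      obtain ⟨s, hs, hball⟩ := Metric.isOpen_iff.1 himg.isOpen_compl v hv
      filter_upwards [hlt s hs] with r hr y hy hyr
      exact absurd ⟨y, hy, rfl⟩ (hball (Metric.mem_ball.2 (hyr.trans hr)))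
  have h2 : ∀ p ∈ F.fiber v, ∀ c, ∀ᶠ r in 𝓝[>] (0 : ℝ), Q.hex c = p.1 → ∀ y ∈ Q.set c,
      dist y p.2 < r → dist (F.fold p.1 y).1 v < r := by
    intro p hp c
    by_cases hpc : p.2 ∈ Q.set c
    · refine Eventually.of_forall fun r hc y hy hyr => ?_
      rw [← hp.2, ← hc, Q.dist_eq c y hy _ hpc]
      exact hyr
    · obtain ⟨s, hs, hball⟩ := Metric.isOpen_iff.1 (Q.isClosed c).isOpen_compl p.2 hpc
      filter_upwards [hlt s hs] with r hr _ y hy hyr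
      exact absurd hy (hball (Metric.mem_ball.2 (hyr.trans hr)))
  have h3 : ∀ p ∈ F.fiber v, ∀ q ∈ F.fiber v, ∀ᶠ r in 𝓝[>] (0 : ℝ), p.1 = q.1 → p ≠ q →
        Disjoint (Metric.ball p.2 r) (Metric.ball q.2 r) := by
    intro p _ q _
    by_cases hpq : p.2 = q.2
    · exact Eventually.of_forall fun r h1 h2 => absurd (Prod.ext h1 hpq) h2
    · filter_upwards [hlt (dist p.2 q.2 / 2) (half_pos (dist_pos.2 hpq))] with r hr _ _
      exact Metric.ball_disjoint_ball (by linarith)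
  have h2' := (eventually_all_finite hfin).2 fun p hp => eventually_all.2 (h2 p hp)
  have h3' := (eventually_all_finite hfin).2 fun p hp =>
    (eventually_all_finite hfin).2 (h3 p hp)
  filter_upwards [eventually_all.2 h1, h2', h3'] with r h1 h2 h3
  refine ⟨h1, fun p hp y hy hyr => ?_, h3⟩
  obtain ⟨c, hc, hyc⟩ := Q.exists_mem p.1 y hy
  exact h2 p hp c hc y hyc hyr

end HexGlue

end

noncomputable section

namespace HexGlue

open Set MeasureTheory Real Measure Filter Topology

variable {P : Set E3} {n : ℕ} {G : Gluing n} {a : ℝ} {F : Folding P G a} {m : ℕ}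

/-- The points of the `c`-th piece, and of no earlier one of the same hexagon, that lie in the
interior of the hexagon and are placed in `M`. -/
def Pieces.part (Q : Pieces F m) (M : Set E3) (c : Fin m) : Set ℂ :=
  ((Q.set c ∩ (fun x => (F.fold (Q.hex c) x).1) ⁻¹' M) ∩ interior (hexagon a)) \
    ⋃ c' ∈ {c' | c' < c ∧ Q.hex c' = Q.hex c}, Q.set c'

namespace Pieces

variable (Q : Pieces F m) {M M' : Set E3} {c c' : Fin m}

theorem part_subset : Q.part M c ⊆ Q.set c := fun _ h => h.1.1.1

theorem measurableSet_part (hM : MeasurableSet M) : MeasurableSet (Q.part M c) := by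
  refine ((measurableSet_inter_preimage (Q.isClosed c).measurableSet (Q.continuousOn c) hM).inter
    isOpen_interior.measurableSet).diff ?_
  exact (Set.toFinite _).measurableSet_biUnion fun c' _ => (Q.isClosed c').measurableSet

theorem area_image_part :
    (μHE[2] : Measure E3) ((fun x => (F.fold (Q.hex c) x).1) '' Q.part M c) =
      volume (Q.part M c) :=
  area_image_of_dist_eq (Q.dist_eq c) Q.part_subset

theorem measurableSet_image_part (hM : MeasurableSet M) :
    MeasurableSet ((fun x => (F.fold (Q.hex c) x).1) '' Q.part M c) :=
  (Q.measurableSet_part hM).image_of_continuousOn_injOn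
    ((Q.continuousOn c).mono Q.part_subset)
    fun _ hx _ hy h => Q.eq_of_eq (Q.part_subset hx) (Q.part_subset hy) h

theorem eq_of_mem_part {x : ℂ} (hc : x ∈ Q.part M c) (hc' : x ∈ Q.part M' c')
    (h : Q.hex c = Q.hex c') : c = c' := by
  rcases lt_trichotomy c c' with hlt | he | hlt
  · exact absurd (mem_biUnion (show c ∈ {d | d < c' ∧ Q.hex d = Q.hex c'} from ⟨hlt, h⟩)
      (Q.part_subset hc)) hc'.2
  · exact he
  · exact absurd (mem_biUnion (show c' ∈ {d | d < c ∧ Q.hex d = Q.hex c} from ⟨hlt, h.symm⟩)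
      (Q.part_subset hc')) hc.2

/-- The first piece that contains a given point. -/
theorem exists_first {i : Fin n} {x : ℂ} (hx : x ∈ hexagon a) : ∃ c, Q.hex c = i ∧ x ∈ Q.set c ∧
    x ∉ ⋃ c' ∈ {c' | c' < c ∧ Q.hex c' = Q.hex c}, Q.set c' := by
  classical
  obtain ⟨c₀, h1, h2⟩ := Q.exists_mem i x hx
  let S := Finset.univ.filter fun c => Q.hex c = i ∧ x ∈ Q.set c
  have hS : ∀ c, c ∈ S ↔ Q.hex c = i ∧ x ∈ Q.set c := fun c => by simp [S]
  obtain ⟨c, hc, hmin⟩ := S.exists_min_image id ⟨c₀, (hS _).2 ⟨h1, h2⟩⟩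
  obtain ⟨h3, h4⟩ := (hS c).1 hc
  refine ⟨c, h3, h4, fun h => ?_⟩
  obtain ⟨c', ⟨h5, h6⟩, h7⟩ := mem_iUnion₂.1 h
  exact absurd (hmin c' ((hS _).2 ⟨h6.trans h3, h7⟩)) (not_le.2 h5)

/-- The angles at a vertex are determined by the areas of the hexagons near the points placed
there. -/
theorem eventually_sum_eq (ha : 0 < a) {V : Finset E3} (hV : IsVertexSet V P) {v : E3}
    (hv : v ∈ V) : ∀ᶠ r in 𝓝[>] (0 : ℝ),
      ∑ u ∈ (hV.finite_normalsAt hv).toFinset,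
        ENNReal.ofReal (faceAngle (face P u) v * r ^ 2 / 2) =
      ∑ p ∈ (Q.finite_fiber v).toFinset, volume (hexagon a ∩ Metric.ball p.2 r) := by
  classical
  have hJ := hV.finite_normalsAt hv
  have hch : ∀ u : E3, ∃ D : Set E3, MeasurableSet D ∧ (u ∈ normalsAt P v → D ⊆ face P u ∧
      (μHE[2] : Measure E3) (face P u \ D) = 0 ∧
      (∀ p ∈ D, ∀ m, (p, m) ∈ markedPoints P →
        SamePoint P (p, m) (p, u) ∨ SamePoint P (p, u) (p, m) → m = u) ∧
      ∀ᶠ r in 𝓝[>] (0 : ℝ), (μHE[2] : Measure E3) (face P u ∩ Metric.ball v r) =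
        ENNReal.ofReal (faceAngle (face P u) v * r ^ 2 / 2)) ∧ (u ∉ normalsAt P v → D = ∅) := by
    intro u
    by_cases hu : u ∈ normalsAt P v
    · obtain ⟨D, h1, h2⟩ := hV.exists_faceChart hv hu
      exact ⟨D, h1, fun _ => h2, fun h => absurd hu h⟩
    · exact ⟨∅, MeasurableSet.empty, fun h => absurd h hu, fun _ => rfl⟩
  choose D hDm hD hDempty using hch
  have hareas := (eventually_all_finite hJ).2 fun u hu => (hD u hu).2.2.2
  filter_upwards [hareas, Q.eventually_preimage_ball v] with r hr ⟨hb1, hb2, hb3⟩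
  let ψ : Fin m → ℂ → E3 := fun c x => (F.fold (Q.hex c) x).1
  let Y : Fin m → Set ℂ := fun c => Q.part (D (Q.normal c) ∩ Metric.ball v r) c
  have hMm : ∀ c, MeasurableSet (D (Q.normal c) ∩ Metric.ball v r) := fun c =>
    (hDm _).inter measurableSet_ball
  have hnormal : ∀ c, ∀ x ∈ Q.set c, dist (ψ c x) v < r → Q.normal c ∈ normalsAt P v := by
    intro c x hx hxr
    obtain ⟨x', hx', hxv, -⟩ := hb1 c x hx hxr
    have := Q.mem_marked c x' hx'
    rw [hxv] at this
    exact this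
  have hYnormal : ∀ c, ∀ x ∈ Y c, Q.normal c ∈ normalsAt P v := fun c x hx =>
    hnormal c x (Q.part_subset hx) hx.1.1.2.2
  have hmark : ∀ c, ∀ x ∈ Q.set c, ψ c x ∈ D (Q.normal c) →
      F.fold (Q.hex c) x = (ψ c x, Q.normal c) := by
    intro c x hx hxD
    have hu : Q.normal c ∈ normalsAt P v := by
      by_contra hu
      rw [hDempty _ hu] at hxD
      exact hxD
    have := (hD _ hu).2.2.1 _ hxD (F.fold (Q.hex c) x).2
      (F.fold_mem _ x (Q.subset c hx)) (Or.inl (Q.samePoint c x hx))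
    exact Prod.ext rfl this
  -- the area of a face near the vertex is covered by the parts placed in it
  have hface : ∀ u ∈ hJ.toFinset, ENNReal.ofReal (faceAngle (face P u) v * r ^ 2 / 2) =
      ∑ c with Q.normal c = u, volume (Y c) := by
    intro u hu
    rw [Finite.mem_toFinset] at hu
    have hunion : (μHE[2] : Measure E3) (⋃ c ∈ Finset.univ.filter (fun c => Q.normal c = u),
        ψ c '' Y c) = ∑ c with Q.normal c = u, volume (Y c) := by
      rw [measure_biUnion_finset]
      · exact Finset.sum_congr rfl fun c _ => Q.area_image_part
      · intro c hc c' hc' hne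
        rw [Finset.coe_filter] at hc hc'
        refine disjoint_left.2 ?_
        rintro _ ⟨x, hx, rfl⟩ ⟨x', hx', hxx⟩
        have h1 := hmark c x (Q.part_subset hx) hx.1.1.2.1
        have h2 := hmark c' x' (Q.part_subset hx') hx'.1.1.2.1
        have hfold : F.fold (Q.hex c) x = F.fold (Q.hex c') x' := by
          rw [h1, h2, hxx, hc.2, hc'.2]
        have hrel := (F.glued_iff (Q.hex c) (Q.hex c') x (Q.subset c (Q.part_subset hx)) x'
          (Q.subset c' (Q.part_subset hx'))).1 (by rw [hfold]; exact ⟨rfl, Or.inl rfl⟩)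
        have heq : (Q.hex c, x) = (Q.hex c', x') :=
          (hrel.eq_or_notMem_interior ha).resolve_right fun h => h.1 hx.1.2
        obtain ⟨h3, rfl⟩ := Prod.mk.inj heq
        exact hne (Q.eq_of_mem_part hx hx' h3)
      · exact fun c _ => Q.measurableSet_image_part (hMm c)
    rw [← hunion, ← hr u hu]
    apply le_antisymm
    · have hcover : face P u ∩ Metric.ball v r ⊆
          (⋃ c ∈ Finset.univ.filter (fun c => Q.normal c = u), ψ c '' Y c) ∪
          ((face P u \ D u) ∪ ⋃ c, ψ c '' (Q.set c ∩ (hexagon a \ interior (hexagon a)))) := by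
        rintro p ⟨hp, hpr⟩
        by_cases hpD : p ∈ D u
        · obtain ⟨i, x, hx, hsame⟩ := F.covers (p, u) ⟨hu.1, hp⟩
          have h1 : (F.fold i x).1 = p := hsame.1
          obtain ⟨c, rfl, hxc, hfirst⟩ := Q.exists_first (i := i) hx
          have hmem := F.fold_mem (Q.hex c) x hx
          have h2 : (F.fold (Q.hex c) x).2 = u := by
            refine (hD u hu).2.2.1 p hpD _ ?_ (Or.inl ?_)
            · rw [← h1]; exact hmem
            · rw [← h1] at hsame ⊢; exact hsame
          have h3 : Q.normal c = u := by
            have hs := Q.samePoint c x hxc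
            have hm := Q.mem_marked c x hxc
            refine (hD u hu).2.2.1 p hpD _ (by rw [← h1]; exact hm) (Or.inr ?_)
            rw [← h1, ← h2]
            exact hs
          by_cases hint : x ∈ interior (hexagon a)
          · left
            refine mem_iUnion₂.2 ⟨c, by simpa using h3, x, ⟨⟨⟨hxc, ?_⟩, hint⟩, hfirst⟩, h1⟩
            rw [mem_preimage, h1, h3]
            exact ⟨hpD, hpr⟩
          · right; right
            exact mem_iUnion.2 ⟨c, x, ⟨hxc, hx, hint⟩, h1⟩
        · exact Or.inr (Or.inl ⟨hp, hpD⟩)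
      refine (measure_mono hcover).trans ((measure_union_le _ _).trans ?_)
      have hnull : (μHE[2] : Measure E3) ((face P u \ D u) ∪
          ⋃ c, ψ c '' (Q.set c ∩ (hexagon a \ interior (hexagon a)))) = 0 := by
        refine measure_union_null (hD u hu).2.1 (measure_iUnion_null fun c => ?_)
        rw [area_image_of_dist_eq (Q.dist_eq c) inter_subset_left]
        exact measure_mono_null inter_subset_right (volume_frontier_hexagon a)
      rw [hnull, add_zero]
    · refine measure_mono (iUnion₂_subset fun c hc => ?_)
      rintro _ ⟨x, hx, rfl⟩
      have hc : Q.normal c = u := by simpa using hc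
      have := hx.1.1.2
      rw [mem_preimage, hc] at this
      exact ⟨(hD u hu).1 this.1, this.2⟩
  -- the parts of a hexagon cover the balls around the points placed at the vertex
  have hhex : ∀ i, ∑ c with Q.hex c = i, volume (Y c) =
      ∑ p ∈ (Q.finite_fiber v).toFinset with p.1 = i, volume (hexagon a ∩ Metric.ball p.2 r) := by
    intro i
    have hW : ⋃ p ∈ (Q.finite_fiber v).toFinset.filter (fun p => p.1 = i),
        (hexagon a ∩ Metric.ball p.2 r) = {y ∈ hexagon a | dist (F.fold i y).1 v < r} := by
      ext y
      simp only [mem_iUnion, Finset.mem_filter, Finite.mem_toFinset, mem_inter_iff,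
        Metric.mem_ball, mem_ofPred_eq, exists_prop]
      constructor
      · rintro ⟨p, ⟨hp, rfl⟩, hy, hyr⟩
        exact ⟨hy, hb2 p hp y hy hyr⟩
      · rintro ⟨hy, hyr⟩
        obtain ⟨c, rfl, hyc⟩ := Q.exists_mem i y hy
        obtain ⟨x, hx, hxv, hxr⟩ := hb1 c y hyc hyr
        exact ⟨(Q.hex c, x), ⟨⟨Q.subset c hx, hxv⟩, rfl⟩, hy, hxr⟩
    have h1 : volume (⋃ p ∈ (Q.finite_fiber v).toFinset.filter (fun p => p.1 = i),
        (hexagon a ∩ Metric.ball p.2 r)) = ∑ p ∈ (Q.finite_fiber v).toFinset with p.1 = i,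
          volume (hexagon a ∩ Metric.ball p.2 r) := by
      rw [measure_biUnion_finset]
      · intro p hp q hq hne
        simp only [Finset.coe_filter, Finite.mem_toFinset, mem_ofPred_eq] at hp hq
        exact (hb3 p hp.1 q hq.1 (hp.2.trans hq.2.symm) hne).mono inter_subset_right
          inter_subset_right
      · exact fun p _ => (isCompact_hexagon a).isClosed.measurableSet.inter measurableSet_ball
    have h2 : volume (⋃ c ∈ Finset.univ.filter (fun c => Q.hex c = i), Y c) =
        ∑ c with Q.hex c = i, volume (Y c) := by
      rw [measure_biUnion_finset]
      · intro c hc c' hc' hne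
        simp only [Finset.coe_filter, Finset.mem_univ, true_and, mem_ofPred_eq] at hc hc'
        exact disjoint_left.2 fun x hx hx' => hne (Q.eq_of_mem_part hx hx' (hc.trans hc'.symm))
      · exact fun c _ => Q.measurableSet_part (hMm c)
    rw [← h1, ← h2, hW]
    apply le_antisymm
    · refine measure_mono (iUnion₂_subset fun c hc x hx => ?_)
      have hc : Q.hex c = i := by simpa using hc
      have := hx.1.1.2.2
      rw [hc] at this
      exact ⟨Q.subset c (Q.part_subset hx), this⟩
    · have hcover : {y ∈ hexagon a | dist (F.fold i y).1 v < r} ⊆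
          (⋃ c ∈ Finset.univ.filter (fun c => Q.hex c = i), Y c) ∪
          ((hexagon a \ interior (hexagon a)) ∪ ⋃ c ∈ {c | Q.normal c ∈ normalsAt P v},
            Q.set c ∩ ψ c ⁻¹' (face P (Q.normal c) \ D (Q.normal c))) := by
        rintro y ⟨hy, hyr⟩
        by_cases hint : y ∈ interior (hexagon a)
        · obtain ⟨c, rfl, hyc, hfirst⟩ := Q.exists_first (i := i) hy
          by_cases hyD : ψ c y ∈ D (Q.normal c)
          · left
            exact mem_iUnion₂.2 ⟨c, by simp, ⟨⟨hyc, hyD, hyr⟩, hint⟩, hfirst⟩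
          · right; right
            exact mem_iUnion₂.2 ⟨c, hnormal c y hyc hyr, hyc, (Q.mem_marked c y hyc).2, hyD⟩
        · exact Or.inr (Or.inl ⟨hy, hint⟩)
      refine (measure_mono hcover).trans ((measure_union_le _ _).trans ?_)
      have hnull : volume ((hexagon a \ interior (hexagon a)) ∪
          ⋃ c ∈ {c | Q.normal c ∈ normalsAt P v},
            Q.set c ∩ ψ c ⁻¹' (face P (Q.normal c) \ D (Q.normal c))) = 0 := by
        refine measure_union_null (volume_frontier_hexagon a)
          ((measure_biUnion_null_iff (to_countable _)).2 fun c hc => ?_)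
        rw [← area_image_of_dist_eq (Q.dist_eq c) inter_subset_left]
        refine measure_mono_null ?_ (hD _ hc).2.1
        rintro _ ⟨x, hx, rfl⟩
        exact hx.2
      rw [hnull, add_zero]
  rw [Finset.sum_congr rfl hface]
  have hleft : ∑ u ∈ hJ.toFinset, ∑ c with Q.normal c = u, volume (Y c) = ∑ c, volume (Y c) := by
    have h1 : ∀ c, c ∉ Finset.univ.filter (fun c => Q.normal c ∈ hJ.toFinset) →
        volume (Y c) = 0 := by
      intro c hc
      have hempty : Y c = ∅ := by
        rw [eq_empty_iff_forall_notMem]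
        exact fun x hx => hc (by simpa using hYnormal c x hx)
      rw [hempty, measure_empty]
    rw [← Finset.sum_subset (Finset.filter_subset _ _) fun c _ hc => h1 c hc,
      ← Finset.sum_fiberwise_of_maps_to (t := hJ.toFinset) (g := Q.normal)
        (fun c hc => (Finset.mem_filter.1 hc).2)]
    refine Finset.sum_congr rfl fun u hu => ?_
    rw [Finset.filter_filter]
    refine Finset.sum_congr (Finset.filter_congr fun c _ => ?_) fun _ _ => rfl
    exact ⟨fun h => ⟨h ▸ hu, h⟩, fun h => h.2⟩
  rw [hleft, ← Finset.sum_fiberwise (s := Finset.univ) (g := Q.hex),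
    Finset.sum_congr rfl fun i _ => hhex i, Finset.sum_fiberwise]

end Pieces

end HexGlue

end

noncomputable section

namespace HexGlue

open Set MeasureTheory Real Measure Filter Topology

theorem IsVertexSet.exists_third {V : Finset E3} {P : Set E3} (hV : IsVertexSet V P)
    (hP : IsConvexPolyhedron P) {v : E3} (hv : v ∈ V) (p : E3) : ∃ q ∈ V, q ≠ v ∧ q ≠ p := by
  by_contra! hcon
  have hle : vectorSpan ℝ P ≤ ℝ ∙ (p - v) := by
    rw [hV.vectorSpan_eq hv, Submodule.span_le]
    rintro _ ⟨q, hq, rfl⟩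
    by_cases hqv : q = v
    · simp [hqv]
    · rw [hcon q hq hqv]; exact Submodule.mem_span_singleton_self _
  have h1 := Submodule.finrank_mono hle
  have h2 : Module.finrank ℝ (ℝ ∙ (p - v)) ≤ 1 := by
    have h := finrank_span_finset_le_card (R := ℝ) ({p - v} : Finset E3)
    rw [Finset.coe_singleton] at h
    exact h
  have h3 := hP.dim_eq
  unfold dim at h3
  omega

theorem IsVertexSet.nonempty_normalsAt {V : Finset E3} {P : Set E3} (hV : IsVertexSet V P)
    (hP : IsConvexPolyhedron P) {v : E3} (hv : v ∈ V) : (normalsAt P v).Nonempty := by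
  obtain ⟨p, hp, hpv⟩ := hV.exists_ne hP hv
  obtain ⟨q, hq, hqv, hqp⟩ := hV.exists_third hP hv p
  have ha : 0 < ‖p - v‖ := norm_pos_iff.2 (sub_ne_zero.2 hpv)
  have hb : 0 < ‖q - v‖ := norm_pos_iff.2 (sub_ne_zero.2 hqv)
  have hlt : (inner ℝ (p - v) (q - v) : ℝ) < ‖p - v‖ * ‖q - v‖ := by
    rw [inner_lt_norm_mul_iff_real]
    intro h
    refine hV.not_collinear hv hp hq hpv hqv hqp.symm (‖q - v‖ / ‖p - v‖) ?_
    rw [div_eq_inv_mul, mul_smul, h, smul_smul, inv_mul_cancel₀ ha.ne', one_smul]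
  let U : Set E3 := {ω | 0 < (inner ℝ ω (p - v) : ℝ) ∧ (inner ℝ ω (q - v) : ℝ) < 0}
  have hU : IsOpen U := by
    have h1 : IsOpen {ω : E3 | 0 < (inner ℝ ω (p - v) : ℝ)} := isOpen_lt (by fun_prop) (by fun_prop)
    have h2 : IsOpen {ω : E3 | (inner ℝ ω (q - v) : ℝ) < 0} := isOpen_lt (by fun_prop) (by fun_prop)
    exact h1.and h2
  have hUne : U.Nonempty := by
    refine ⟨‖q - v‖ • (p - v) - ‖p - v‖ • (q - v), ?_, ?_⟩
    · rw [inner_sub_left, inner_smul_left, inner_smul_left, real_inner_self_eq_norm_sq,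
        real_inner_comm]
      simp only [conj_trivial]
      nlinarith
    · rw [inner_sub_left, inner_smul_left, inner_smul_left, real_inner_self_eq_norm_sq]
      simp only [conj_trivial]
      nlinarith
  obtain ⟨ω, hωU, hω⟩ := exists_generic hU hUne
    (T := (fun p => p - v) '' {p | p ∈ V ∧ p ≠ v})
    ((V.finite_toSet.subset fun p hp => hp.1).image _) (by
      rintro _ ⟨p, hp, rfl⟩
      exact sub_ne_zero.2 hp.2)
  have hcard := hV.ncard_crosses hP hv (fun p hp hpv => hω _ ⟨p, ⟨hp, hpv⟩, rfl⟩)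
    ⟨p, hp, hωU.1⟩ ⟨q, hq, hωU.2⟩
  obtain ⟨u, hu⟩ := nonempty_of_ncard_ne_zero (by rw [hcard]; norm_num :
    {u ∈ normalsAt P v | Crosses V P v ω u}.ncard ≠ 0)
  exact ⟨u, hu.1⟩

theorem IsVertexSet.curvature_eq {V : Finset E3} {P : Set E3} (hV : IsVertexSet V P) {v : E3}
    (hv : v ∈ V) : curvature P v =
      2 * π - ∑ u ∈ (hV.finite_normalsAt hv).toFinset, faceAngle (face P u) v := by
  rw [curvature, ← finsum_mem_eq_finite_toFinset_sum _ (hV.finite_normalsAt hv)]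
  rfl

theorem edgeForm_pow {j : ℕ} (hj : j < 5) {t : ℝ} (ht : t ∈ Ioo (0 : ℝ) 1) :
    edgeForm (ζ ^ (j + 1) * (1 + t * ζ ^ 2)) < 1 := by
  have key : ∀ x y : ℝ, ζ ^ (j + 1) * (1 + t * ζ ^ 2) = (x : ℂ) + y * ζ → x + y < 1 →
      edgeForm (ζ ^ (j + 1) * (1 + t * ζ ^ 2)) < 1 := by
    intro x y h1 h2
    rw [h1, edgeForm_add_mul]; exact h2
  obtain ⟨h0, h1⟩ := ht
  have h2 := ζ_sq
  have h3 := ζ_pow_three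
  have h4 := ζ_pow_four
  have h5 := ζ_pow_five
  have h6 := ζ_pow_six
  interval_cases j
  · refine key (-t) 1 ?_ (by linarith)
    push_cast
    linear_combination (t : ℂ) * h3
  · refine key (-1) (1 - t) ?_ (by linarith)
    push_cast
    linear_combination h2 + t * h4
  · refine key (-1 + t) (-t) ?_ (by linarith)
    push_cast
    linear_combination h3 + t * h5
  · refine key t (-1) ?_ (by linarith)
    push_cast
    linear_combination h4 + t * h6
  · refine key 1 (-1 + t) ?_ (by linarith)
    push_cast
    linear_combination h5 + t * ζ * h6

theorem edgePoint_ne_of_lt {a : ℝ} (ha : 0 < a) {k k' : Fin 6} (hk : k < k') {t t' : ℝ}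
    (ht' : t' ∈ Ioo (0 : ℝ) 1) : edgePoint a k t ≠ edgePoint a k' t' := by
  intro h
  obtain ⟨j, hj⟩ := Nat.exists_eq_add_of_lt hk
  have hζ : ζ ^ (k : ℕ) ≠ 0 := pow_ne_zero _ (by rw [← norm_ne_zero_iff, norm_ζ]; norm_num)
  have ha' : (a : ℂ) ≠ 0 := by exact_mod_cast ha.ne'
  rw [edgePoint_eq, edgePoint_eq, hj, add_assoc, pow_add, mul_assoc (ζ ^ (k : ℕ))] at h
  have h1 : (1 : ℂ) + t * ζ ^ 2 = ζ ^ (j + 1) * (1 + t' * ζ ^ 2) := by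
    have := mul_left_cancel₀ hζ h
    refine mul_left_cancel₀ ha' ?_
    linear_combination this
  have h2 := edgeForm_pow (j := j) (by have := k'.2; omega) ht'
  rw [← h1, show (1 : ℂ) + t * ζ ^ 2 = ((1 - t : ℝ) : ℂ) + t * ζ by
    rw [ζ_sq]; push_cast; ring, edgeForm_add_mul] at h2
  linarith

theorem edgePoint_ne {a : ℝ} (ha : 0 < a) {k k' : Fin 6} (hk : k ≠ k') {t t' : ℝ}
    (ht : t ∈ Ioo (0 : ℝ) 1) (ht' : t' ∈ Ioo (0 : ℝ) 1) : edgePoint a k t ≠ edgePoint a k' t' := by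
  rcases lt_or_gt_of_ne hk with h | h
  · exact edgePoint_ne_of_lt ha h ht'
  · exact (edgePoint_ne_of_lt ha h ht).symm

theorem corner_injective {a : ℝ} (ha : 0 < a) : Function.Injective (corner a) := by
  intro j k h
  have ha' : (a : ℂ) ≠ 0 := by exact_mod_cast ha.ne'
  have hprim : IsPrimitiveRoot ζ 6 := by
    have := Complex.isPrimitiveRoot_exp 6 (by norm_num)
    convert this using 1
    rw [ζ]
    congr 1
    push_cast
    ring
  rw [corner_eq, corner_eq] at h
  exact Fin.ext (hprim.pow_inj j.2 k.2 (mul_left_cancel₀ ha' h))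

variable {P : Set E3} {n : ℕ} {G : Gluing n} {a : ℝ}

/-- Near a vertex of a polyhedron glued from hexagons, the surface consists of one or two corners
of hexagons. -/
theorem Folding.corner_and_curvature (F : Folding P G a) (hP : IsConvexPolyhedron P) (ha : 0 < a)
    {V : Finset E3} (hV : IsVertexSet V P) {v : E3} (hv : v ∈ V) :
    (F.cornerCount v = 1 ∧ curvature P v = 4 * π / 3) ∨
      (F.cornerCount v = 2 ∧ curvature P v = 2 * π / 3) := by
  classical
  obtain ⟨m, ⟨Q⟩⟩ := F.exists_pieces
  have hsum := Q.eventually_sum_eq ha hV hv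
  have hcurv := hV.curvature_eq hv
  have hpos := hV.curvature_pos hP hv
  have hfib := Q.finite_fiber v
  set S := ∑ u ∈ (hV.finite_normalsAt hv).toFinset, faceAngle (face P u) v with hS
  have hnn : ∀ u ∈ (hV.finite_normalsAt hv).toFinset, 0 ≤ faceAngle (face P u) v := by
    intro u hu
    obtain ⟨x, -, y, -, hc⟩ := hV.exists_isPlaneCone_face hv ((Finite.mem_toFinset _).1 hu)
    exact hc.faceAngle_pos.le
  have hS0 : 0 ≤ S := Finset.sum_nonneg hnn
  have hS2 : S < 2 * π := by linarith
  have hsum' : ∀ᶠ r in 𝓝[>] (0 : ℝ), 0 < r ∧ ENNReal.ofReal (S * r ^ 2 / 2) =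
      ∑ p ∈ hfib.toFinset, volume (hexagon a ∩ Metric.ball p.2 r) := by
    filter_upwards [hsum, self_mem_nhdsWithin] with r hr hr0
    refine ⟨hr0, ?_⟩
    rw [← hr, ← ENNReal.ofReal_sum_of_nonneg fun u hu => div_nonneg (mul_nonneg (hnn u hu)
      (sq_nonneg _)) (by norm_num), hS, ← Finset.sum_div, ← Finset.sum_mul]
  have hfull : ¬ ∀ᶠ r in 𝓝[>] (0 : ℝ), ENNReal.ofReal (π * r ^ 2) ≤
      ∑ p ∈ hfib.toFinset, volume (hexagon a ∩ Metric.ball p.2 r) := by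
    intro h
    obtain ⟨r, ⟨hr0, hr⟩, hle⟩ := (hsum'.and h).exists
    rw [← hr, ENNReal.ofReal_le_ofReal_iff (by positivity)] at hle
    have : 0 < r ^ 2 := by positivity
    nlinarith
  have hcorner : ∀ p ∈ F.fiber v, ∃ k, p.2 = corner a k := by
    intro p hp
    rcases mem_interior_or_edgePoint ha hp.1 with hint | ⟨k, t, ht, hpt⟩
    · exfalso
      refine hfull ((eventually_of_le (volume_interior hint)).mono fun r hr => hr.trans ?_)
      exact Finset.single_le_sum (f := fun p : Fin n × ℂ => volume (hexagon a ∩ Metric.ball p.2 r))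
        (fun _ _ => zero_le) (hfib.mem_toFinset.2 hp)
    rcases eq_or_lt_of_le ht.1 with h0 | h0
    · exact ⟨k, by rw [hpt, ← h0, corner_eq_edgePoint]⟩
    rcases eq_or_lt_of_le ht.2 with h1 | h1
    · refine ⟨k + 1, by rw [hpt, h1, edgePoint]; simp⟩
    exfalso
    let e : Fin n × Fin 6 := (p.1, k)
    let t' : ℝ := if G.flip e then 1 - t else t
    have ht' : t' ∈ Ioo (0 : ℝ) 1 := by
      simp only [t']
      split_ifs
      · exact ⟨by linarith, by linarith⟩
      · exact ⟨h0, h1⟩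
    let q : Fin n × ℂ := ((G.mate e).1, edgePoint a (G.mate e).2 t')
    have hqmem : q.2 ∈ hexagon a := edgePoint_mem _ ⟨ht'.1.le, ht'.2.le⟩
    have hrel : G.Rel a (p.1, p.2) (q.1, q.2) :=
      Relation.EqvGen.rel _ _ ⟨e, t, ht, by rw [hpt], rfl⟩
    have hq : q ∈ F.fiber v :=
      ⟨hqmem, ((F.glued_iff p.1 q.1 p.2 hp.1 q.2 hqmem).2 hrel).1.symm.trans hp.2⟩
    have hpq : p ≠ q := by
      intro h
      have h3 : p.1 = (G.mate e).1 := congrArg Prod.fst h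
      have h4 : edgePoint a k t = edgePoint a (G.mate e).2 t' := by
        rw [← hpt]; exact congrArg Prod.snd h
      by_cases h5 : k = (G.mate e).2
      · exact G.mate_ne e (Prod.ext h3.symm h5.symm)
      · exact edgePoint_ne ha h5 ⟨h0, h1⟩ ht' h4
    refine hfull (((eventually_of_le (volume_edgePoint ha k ⟨h0, h1⟩)).and
      (eventually_of_le (volume_edgePoint ha (G.mate e).2 ht'))).mono ?_)
    rintro r ⟨hr1, hr2⟩
    have hsub : ({p, q} : Finset (Fin n × ℂ)) ⊆ hfib.toFinset := by
      intro x hx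
      rw [Finset.mem_insert, Finset.mem_singleton] at hx
      rw [Finite.mem_toFinset]
      rcases hx with rfl | rfl <;> assumption
    refine le_trans ?_ (Finset.sum_le_sum_of_subset hsub)
    rw [Finset.sum_pair hpq, show π * r ^ 2 = π * r ^ 2 / 2 + π * r ^ 2 / 2 by ring,
      ENNReal.ofReal_add (by positivity) (by positivity), hpt]
    exact add_le_add hr1 hr2
  have hcount : F.cornerCount v = hfib.toFinset.card := by
    let f : {c : Fin n × Fin 6 // (F.fold c.1 (corner a c.2)).1 = v} → F.fiber v := fun c =>
      ⟨(c.1.1, corner a c.1.2), corner_mem a _, c.2⟩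
    have hf : Function.Bijective f := by
      constructor
      · rintro ⟨⟨i, k⟩, h1⟩ ⟨⟨j, l⟩, h2⟩ h
        have h3 : (i, corner a k) = (j, corner a l) := congrArg Subtype.val h
        obtain ⟨rfl, h4⟩ := Prod.mk.inj h3
        obtain rfl := corner_injective ha h4
        rfl
      · rintro ⟨⟨i, x⟩, hx⟩
        obtain ⟨k, hk⟩ := hcorner _ hx
        have hk : x = corner a k := hk
        subst hk
        exact ⟨⟨(i, k), hx.2⟩, rfl⟩
    rw [Folding.cornerCount, Nat.card_congr (Equiv.ofBijective f hf), Nat.card_coe_set_eq,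
      ncard_eq_toFinset_card _ hfib]
  have hSk : S = 2 * π / 3 * F.cornerCount v := by
    have hloc : ∀ p ∈ F.fiber v, ∀ᶠ r in 𝓝[>] (0 : ℝ), volume (hexagon a ∩ Metric.ball p.2 r) =
        ENNReal.ofReal (2 * π / 3 * r ^ 2 / 2) := by
      intro p hp
      obtain ⟨k, hk⟩ := hcorner p hp
      rw [hk]
      exact eventually_of_le (volume_corner ha k)
    obtain ⟨r, ⟨hr0, hr⟩, hr'⟩ := (hsum'.and ((eventually_all_finite hfib).2 hloc)).exists
    rw [Finset.sum_congr rfl fun p hp => hr' p (hfib.mem_toFinset.1 hp), Finset.sum_const,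
      ← hcount, nsmul_eq_mul, ← ENNReal.ofReal_natCast, ← ENNReal.ofReal_mul (by positivity),
      ENNReal.ofReal_eq_ofReal_iff (by positivity) (by positivity)] at hr
    have : 0 < r ^ 2 := by positivity
    refine mul_right_cancel₀ this.ne' ?_
    linarith
  have hne : F.cornerCount v ≠ 0 := by
    obtain ⟨u, hu⟩ := hV.nonempty_normalsAt hP hv
    obtain ⟨i, x, hx, hsame⟩ := F.covers (v, u) ⟨hu.1, hu.2⟩
    rw [hcount]
    exact (Finset.card_pos.2 ⟨(i, x), hfib.mem_toFinset.2 ⟨hx, hsame.1⟩⟩).ne'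
  have hlt : F.cornerCount v < 3 := by
    by_contra! h
    have : (3 : ℝ) ≤ F.cornerCount v := by exact_mod_cast h
    nlinarith [pi_pos]
  obtain h | h : F.cornerCount v = 1 ∨ F.cornerCount v = 2 := by omega
  · left
    refine ⟨h, ?_⟩
    rw [hcurv, hSk, h]
    push_cast
    ring
  · right
    refine ⟨h, ?_⟩
    rw [hcurv, hSk, h]
    push_cast
    ring

theorem card_vertices_le {V : Finset E3} (hP : IsConvexPolyhedron P) (hV : IsVertexSet V P)
    (h : ∀ v ∈ V, 2 * π / 3 ≤ curvature P v) : V.card ≤ 6 := by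
  have h1 := hV.sum_curvature hP
  have h2 := Finset.card_nsmul_le_sum V _ _ h
  rw [h1, nsmul_eq_mul] at h2
  have h3 : (V.card : ℝ) ≤ 6 := by
    have := pi_pos
    by_contra! hc
    nlinarith
  exact_mod_cast h3

end HexGlue

end

noncomputable section

namespace HexGlue

open Set Real

/-! ### Doubly covered polygons -/

theorem exists_cyclic_labelling {W : Type*} [Finite W] {G : SimpleGraph W} (hG : G.Connected)
    (h2 : ∀ v, (G.neighborSet v).ncard = 2) :
    ∃ n, ∃ e : Fin (n + 1) ≃ W, ∀ i, G.Adj (e i) (e (i + 1)) := by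
  have hcyc : G.IsCycles := fun v _ => h2 v
  obtain ⟨v⟩ := hG.nonempty
  have hne : (G.neighborSet v).Nonempty := nonempty_of_ncard_ne_zero (by rw [h2]; norm_num)
  obtain ⟨p, hp, hsupp⟩ := hcyc.exists_cycle_toSubgraph_verts_eq_connectedComponentSupp
    (c := G.connectedComponentMk v) (by simp) hne
  have hmem : ∀ w, w ∈ p.support := by
    intro w
    rw [← p.mem_verts_toSubgraph, hsupp, SimpleGraph.ConnectedComponent.mem_supp_iff,
      SimpleGraph.ConnectedComponent.eq]
    exact hG.preconnected w v
  have hlen : 3 ≤ p.length := hp.three_le_length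
  obtain ⟨n, hn⟩ : ∃ n, p.length = n + 1 := ⟨p.length - 1, by omega⟩
  let f : Fin (n + 1) → W := fun i => p.getVert i
  have hf : Function.Bijective f := by
    constructor
    · intro i j hij
      exact Fin.ext (hp.getVert_injOn' (by rw [mem_ofPred_eq]; omega)
        (by rw [mem_ofPred_eq]; omega) hij)
    · intro w
      obtain ⟨k, hk, hkl⟩ := SimpleGraph.Walk.mem_support_iff_exists_getVert.1 (hmem w)
      by_cases h : k = n + 1
      · refine ⟨0, ?_⟩
        have : p.getVert k = v := by rw [h, ← hn, p.getVert_length]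
        rw [← hk, this]
        simp [f]
      · exact ⟨⟨k, by omega⟩, hk⟩
  refine ⟨n, Equiv.ofBijective f hf, fun i => ?_⟩
  have hadj := p.adj_getVert_succ (i := i) (by omega)
  have hsucc : f (i + 1) = p.getVert (i + 1) := by
    by_cases h : i = Fin.last n
    · rw [h, Fin.last_add_one]
      have : ((Fin.last n : Fin (n + 1)) : ℕ) + 1 = p.length := by rw [hn]; simp
      rw [this, p.getVert_length]
      simp [f]
    · change p.getVert ((i + 1 : Fin (n + 1)) : ℕ) = _
      rw [Fin.val_add_one_of_lt (Fin.lt_last_iff_ne_last.2 h)]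
  change G.Adj (f i) (f (i + 1))
  rw [hsucc]
  exact hadj

variable {V : Finset E3} {P : Set E3}

theorem IsVertexSet.connected_skeleton (hV : IsVertexSet V P) (hP : IsConvexPolyhedron P) :
    (skeleton P).Connected := by
  classical
  have : Finite (vertices P) := by rw [← hV.coe_eq]; exact V.finite_toSet
  rw [SimpleGraph.connected_iff]
  constructor
  · intro v w
    obtain ⟨f, hf⟩ := hV.exists_exposing (hV.mem_iff.2 w.2)
    obtain ⟨z, hz, hmax⟩ := (Set.toFinite {z | (skeleton P).Reachable v z}).exists_maximalFor
      (fun z : vertices P => (inner ℝ f (z : E3) : ℝ)) _ ⟨v, SimpleGraph.Reachable.refl v⟩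
    by_cases hzw : z = w
    · exact hzw ▸ hz
    have h1 := hf z (hV.mem_iff.2 z.2) fun h => hzw (Subtype.ext h)
    obtain ⟨z', hadj, h2⟩ := hV.exists_adj_lt z (f := f) (hV.mem_iff.2 w.2) (by
      rw [inner_sub_right] at h1 ⊢; linarith)
    have h3 := hmax (show z' ∈ {z | (skeleton P).Reachable v z} from
      hz.trans hadj.reachable) (by
        rw [inner_sub_right] at h2
        change (inner ℝ f (z : E3) : ℝ) ≤ inner ℝ f (z' : E3)
        linarith)
    rw [inner_sub_right] at h2
    change (inner ℝ f (z' : E3) : ℝ) ≤ inner ℝ f (z : E3) at h3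
    linarith
  · obtain ⟨n, hn⟩ : P.Nonempty := by
      rw [nonempty_iff_ne_empty]
      rintro rfl
      have := hP.dim_eq
      unfold dim at this
      rw [vectorSpan_empty, finrank_bot] at this
      omega
    obtain ⟨v, hv⟩ := hV.nonempty ⟨n, hn⟩
    exact ⟨v, hV.mem_iff.1 hv⟩

theorem exists_inner_eq {a b : E3} (hli : LinearIndependent ℝ ![a, b]) :
    ∃ k : E3, inner ℝ k a = (0 : ℝ) ∧ (inner ℝ k b : ℝ) < 0 := by
  have ha : a ≠ 0 := hli.ne_zero 0
  have haa : (inner ℝ a a : ℝ) ≠ 0 := inner_self_ne_zero.2 ha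
  obtain ⟨c, hc⟩ : ∃ c : ℝ, c = inner ℝ a b / inner ℝ a a := ⟨_, rfl⟩
  have hca : (inner ℝ (b - c • a) a : ℝ) = 0 := by
    rw [inner_sub_left, inner_smul_left, hc, real_inner_comm]
    simp only [conj_trivial]
    field_simp
    ring
  have hne : b - c • a ≠ 0 := by
    intro h
    have := LinearIndependent.pair_iff.1 hli (-c) 1 (by rw [← h]; module)
    exact one_ne_zero this.2
  refine ⟨-(b - c • a), by rw [inner_neg_left, hca, neg_zero], ?_⟩
  have h1 : (inner ℝ (b - c • a) b : ℝ) = inner ℝ (b - c • a) (b - c • a) := by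
    rw [inner_sub_right (b - c • a) b, inner_smul_right, hca]; ring
  rw [inner_neg_left, h1, neg_lt_zero]
  exact real_inner_self_pos.2 hne

theorem IsVertexSet.exists_isPlaneCone (hV : IsVertexSet V P) (hd : dim P = 2) {v : E3}
    (hv : v ∈ V) : ∃ x ∈ V, ∃ y ∈ V, IsPlaneCone P v x y := by
  obtain ⟨h, hh⟩ := hV.exists_exposing hv
  have hd' := hd
  rw [hV.hull_eq] at hd' ⊢
  exact HexGlue.exists_isPlaneCone V.finite_toSet hv hh hd'

theorem IsVertexSet.adj_of_isPlaneCone (hV : IsVertexSet V P) {v x y : vertices P}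
    (hc : IsPlaneCone P v x y) : (skeleton P).Adj v x := by
  have hv := hV.mem_iff.2 v.2
  have hx := hV.mem_iff.2 x.2
  have hxv : (x : E3) ≠ v := sub_ne_zero.1 hc.left_ne
  rw [hV.adj_iff]
  obtain ⟨k, hka, hkb⟩ := exists_inner_eq hc.linearIndependent
  refine ⟨hxv.symm, k, by rw [inner_sub_right] at hka; linarith, fun p hp hpv hpx => ?_⟩
  obtain ⟨s, t, hs, ht, e⟩ := hc.exists_eq p (hV.subset hp)
  have ht0 : t ≠ 0 := by
    rintro rfl
    rw [zero_smul, add_zero] at e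
    exact hV.not_collinear hv hx hp hxv hpv (Ne.symm hpx) s e
  have h1 := congrArg (inner ℝ k) e
  rw [inner_add_right, inner_smul_right, inner_smul_right, hka, mul_zero, zero_add,
    inner_sub_right] at h1
  have := mul_neg_of_pos_of_neg (lt_of_le_of_ne ht (Ne.symm ht0)) hkb
  linarith

theorem IsPlaneCone.symm {F : Set E3} {v x y : E3} (h : IsPlaneCone F v x y) :
    IsPlaneCone F v y x := by
  refine ⟨h.right_mem, h.left_mem, ?_, fun p hp => ?_⟩
  · rw [LinearIndependent.pair_iff]
    intro s t hst
    have := LinearIndependent.pair_iff.1 h.linearIndependent t s (by rw [add_comm]; exact hst)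
    exact ⟨this.2, this.1⟩
  · obtain ⟨s, t, hs, ht, e⟩ := h.exists_eq p hp
    exact ⟨t, s, ht, hs, by rw [e, add_comm]⟩

theorem IsVertexSet.eq_or_eq_of_adj (hV : IsVertexSet V P) {v w x y : vertices P}
    (hc : IsPlaneCone P v x y) (hadj : (skeleton P).Adj v w) : w = x ∨ w = y := by
  by_contra! hne
  obtain ⟨hvw, u, hu, hlt⟩ := hV.adj_iff.1 hadj
  have hv := hV.mem_iff.2 v.2
  have hxv : (x : E3) ≠ v := sub_ne_zero.1 hc.left_ne
  have hyv : (y : E3) ≠ v := sub_ne_zero.1 hc.right_ne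
  have hx := hlt x (hV.mem_iff.2 x.2) hxv fun h => hne.1 (Subtype.ext h.symm)
  have hy := hlt y (hV.mem_iff.2 y.2) hyv fun h => hne.2 (Subtype.ext h.symm)
  obtain ⟨s, t, hs, ht, e⟩ := hc.exists_eq w w.2.1
  have h1 := congrArg (inner ℝ u) e
  rw [inner_add_right, inner_smul_right, inner_smul_right, inner_sub_right, inner_sub_right,
    inner_sub_right, hu, sub_self] at h1
  have h2 := mul_nonneg hs (sub_nonneg.2 hx.le)
  have h3 := mul_nonneg ht (sub_nonneg.2 hy.le)
  have hs0 : s = 0 := by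
    have : s * (inner ℝ u (v : E3) - inner ℝ u (x : E3)) = 0 := by linarith
    exact (mul_eq_zero.1 this).resolve_right (by linarith)
  have ht0 : t = 0 := by
    have : t * (inner ℝ u (v : E3) - inner ℝ u (y : E3)) = 0 := by linarith
    exact (mul_eq_zero.1 this).resolve_right (by linarith)
  rw [hs0, ht0, zero_smul, zero_smul, add_zero] at e
  exact hvw (sub_eq_zero.1 e).symm

theorem IsVertexSet.ncard_neighborSet (hV : IsVertexSet V P) (hd : dim P = 2) (v : vertices P) :
    ((skeleton P).neighborSet v).ncard = 2 := by
  obtain ⟨x, hx, y, hy, hc⟩ := hV.exists_isPlaneCone hd (hV.mem_iff.2 v.2)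
  lift x to vertices P using hV.mem_iff.1 hx
  lift y to vertices P using hV.mem_iff.1 hy
  have hxy : x ≠ y := by
    rintro rfl
    have := LinearIndependent.pair_iff.1 hc.linearIndependent 1 (-1) (by module)
    exact one_ne_zero this.1
  have hset : (skeleton P).neighborSet v = {x, y} := by
    ext w
    rw [SimpleGraph.mem_neighborSet, mem_insert_iff, mem_singleton_iff]
    constructor
    · exact hV.eq_or_eq_of_adj hc
    · rintro (rfl | rfl)
      · exact hV.adj_of_isPlaneCone hc
      · exact hV.adj_of_isPlaneCone hc.symm
  rw [hset, ncard_pair hxy]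

theorem IsVertexSet.curvature_eq_of_flat (hV : IsVertexSet V P) (hd : dim P = 2) {v : E3}
    (hv : v ∈ V) : curvature P v = 2 * π - 2 * faceAngle P v := by
  obtain ⟨n, hn, hN, h1, h2⟩ := exists_faceNormals_eq hd
  have hne : n ≠ -n := by
    intro h
    have h0 : n = 0 := by
      have : (2 : ℝ) • n = 0 := by rw [two_smul]; nth_rewrite 1 [h]; simp
      simpa using this
    simp [h0] at hn
  have hset : (hV.finite_normalsAt hv).toFinset = {n, -n} := by
    ext u
    rw [Finite.mem_toFinset, Finset.mem_insert, Finset.mem_singleton]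
    constructor
    · intro hu
      have := hu.1
      rwa [hN] at this
    · intro hu
      refine ⟨by rw [hN]; exact hu, ?_⟩
      rcases hu with rfl | rfl
      · rw [h1]; exact hV.subset hv
      · rw [h2]; exact hV.subset hv
  rw [hV.curvature_eq hv, hset, Finset.sum_pair hne, h1, h2]
  ring

/-- Rotating a cyclic labelling of the vertices so that their angles are listed by `L`. -/
theorem isFlatWithAngles_of_labelling (hd : dim P = 2) {n : ℕ} {L : List ℝ}
    (hL : L.length = n + 1) (e : Fin (n + 1) ≃ vertices P)
    (hadj : ∀ i, (skeleton P).Adj (e i) (e (i + 1))) (s : Fin (n + 1))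
    (hang : ∀ i : Fin (n + 1), faceAngle P (e (i + s)) = L.get (i.cast hL.symm)) :
    IsFlatWithAngles P L := by
  obtain ⟨x, l, rfl⟩ : ∃ x l, L = x :: l := List.exists_cons_of_length_eq_add_one hL
  obtain rfl : l.length = n := by simpa using hL
  refine ⟨hd, (Equiv.addRight s).trans e, fun i => ?_, fun i => hang i⟩
  have h : finRotate (x :: l).length i = (show Fin (l.length + 1) from i) + 1 :=
    finRotate_apply (n := l.length + 1) i
  rw [h]
  change (skeleton P).Adj (e (i + s)) (e ((show Fin (l.length + 1) from i) + 1 + s))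
  rw [add_right_comm]
  exact hadj _

end HexGlue

end

noncomputable section

namespace HexGlue

open Set Real

variable {V : Finset E3} {P : Set E3}

theorem exists_flat_type (hP : IsConvexPolyhedron P) (hd : dim P = 2) (hV : IsVertexSet V P)
    (h : ∀ v ∈ V, curvature P v = 4 * π / 3 ∨ curvature P v = 2 * π / 3) :
    ∃ k, IsFlatWithAngles P (flatAngles k) := by
  classical
  have : Finite (vertices P) := by rw [← hV.coe_eq]; exact V.finite_toSet
  obtain ⟨n, e, hadj⟩ := exists_cyclic_labelling (hV.connected_skeleton hP)
    (hV.ncard_neighborSet hd)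
  have hmem : ∀ i, (e i : E3) ∈ V := fun i => hV.mem_iff.2 (e i).2
  obtain ⟨b, hb⟩ : ∃ b : Fin (n + 1) → Bool, ∀ i,
      curvature P (e i) = if b i then 4 * π / 3 else 2 * π / 3 := by
    refine ⟨fun i => decide (curvature P (e i) = 4 * π / 3), fun i => ?_⟩
    rcases h _ (hmem i) with h1 | h1
    · simp [h1]
    · have : ¬(2 * π / 3 = 4 * π / 3) := by linarith [pi_pos]
      simp only [h1, this, decide_false, Bool.false_eq_true, if_false]
  have hang : ∀ i, faceAngle P (e i) = if b i then π / 3 else 2 * π / 3 := by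
    intro i
    have h1 := hV.curvature_eq_of_flat hd (hmem i)
    rw [hb i] at h1
    split_ifs at h1 ⊢ <;> linarith
  have hsum : ∑ i, (if b i then 2 else 1 : ℕ) = 6 := by
    have hVe : V = Finset.univ.map ⟨fun i => (e i : E3),
        Subtype.val_injective.comp e.injective⟩ := by
      ext v
      simp only [Finset.mem_map, Finset.mem_univ, true_and, Function.Embedding.coeFn_mk]
      constructor
      · exact fun hv => ⟨e.symm ⟨v, hV.mem_iff.1 hv⟩, by simp⟩
      · rintro ⟨i, rfl⟩; exact hmem i
    have h1 := hV.sum_curvature hP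
    rw [hVe, Finset.sum_map] at h1
    simp only [Function.Embedding.coeFn_mk] at h1
    have h2 : ∑ i, curvature P (e i) = (2 * π / 3) * ((∑ i, (if b i then 2 else 1 : ℕ) : ℕ) : ℝ) := by
      push_cast
      rw [Finset.mul_sum]
      refine Finset.sum_congr rfl fun i _ => ?_
      rw [hb i]
      split_ifs <;> ring
    rw [h2] at h1
    have h3 : ((∑ i, (if b i then 2 else 1 : ℕ) : ℕ) : ℝ) = 6 := by
      have := pi_pos
      refine mul_left_cancel₀ (show 2 * π / 3 ≠ 0 by positivity) ?_
      linarith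
    exact_mod_cast h3
  have hfin : ∀ (k : Fin 5) (hk : (flatAngles k).length = n + 1) (s : Fin (n + 1)),
      (∀ i : Fin (n + 1), (flatAngles k).get (i.cast hk.symm) =
        if b (i + s) then π / 3 else 2 * π / 3) → ∃ k, IsFlatWithAngles P (flatAngles k) :=
    fun k hk s hs => ⟨k, isFlatWithAngles_of_labelling hd hk e hadj s fun i => by
      rw [hang, hs]⟩
  clear hang hb
  have hn : n + 1 ≤ 6 := by
    calc n + 1 = ∑ _i : Fin (n + 1), 1 := by simp
      _ ≤ ∑ i, (if b i then 2 else 1 : ℕ) := Finset.sum_le_sum fun i _ => by split_ifs <;> norm_num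
      _ = 6 := hsum
  have hn' : 6 ≤ 2 * (n + 1) := by
    calc 6 = ∑ i, (if b i then 2 else 1 : ℕ) := hsum.symm
      _ ≤ ∑ _i : Fin (n + 1), 2 := Finset.sum_le_sum fun i _ => by split_ifs <;> norm_num
      _ = 2 * (n + 1) := by simp; ring
  obtain rfl | rfl | rfl | rfl : n = 2 ∨ n = 3 ∨ n = 4 ∨ n = 5 := by omega
  · have hpat : ∀ b : Fin 3 → Bool, ∑ i, (if b i then 2 else 1 : ℕ) = 6 →
        ∃ s, ∀ i, b (i + s) = ![true, true, true] i := by decide +kernel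
    obtain ⟨s, hs⟩ := hpat b hsum
    refine hfin 0 rfl s fun i => ?_
    rw [hs]
    fin_cases i <;> simp [flatAngles]
  · have hpat : ∀ b : Fin 4 → Bool, ∑ i, (if b i then 2 else 1 : ℕ) = 6 →
        (∃ s, ∀ i, b (i + s) = ![true, false, true, false] i) ∨
        ∃ s, ∀ i, b (i + s) = ![true, true, false, false] i := by decide +kernel
    obtain ⟨s, hs⟩ | ⟨s, hs⟩ := hpat b hsum
    · refine hfin 1 rfl s fun i => ?_
      rw [hs]
      fin_cases i <;> simp [flatAngles]
    · refine hfin 2 rfl s fun i => ?_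
      rw [hs]
      fin_cases i <;> simp [flatAngles]
  · have hpat : ∀ b : Fin 5 → Bool, ∑ i, (if b i then 2 else 1 : ℕ) = 6 →
        ∃ s, ∀ i, b (i + s) = ![true, false, false, false, false] i := by decide +kernel
    obtain ⟨s, hs⟩ := hpat b hsum
    refine hfin 3 rfl s fun i => ?_
    rw [hs]
    fin_cases i <;> simp [flatAngles]
  · have hpat : ∀ b : Fin 6 → Bool, ∑ i, (if b i then 2 else 1 : ℕ) = 6 →
        ∃ s, ∀ i, b (i + s) = ![false, false, false, false, false, false] i := by decide +kernel
    obtain ⟨s, hs⟩ := hpat b hsum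
    refine hfin 4 rfl s fun i => ?_
    rw [hs]
    fin_cases i <;> simp [flatAngles]

theorem not_parallelogram_and_trapezoid (hV : IsVertexSet V P)
    (h1 : IsFlatWithAngles P (flatAngles 1)) (h2 : IsFlatWithAngles P (flatAngles 2)) : False := by
  obtain ⟨hd, v, hv, hva⟩ := h1
  obtain ⟨-, w, hw, hwa⟩ := h2
  have hlen1 : (flatAngles 1).length = 4 := rfl
  have hlen2 : (flatAngles 2).length = 4 := rfl
  change Fin 4 ≃ vertices P at v
  change Fin 4 ≃ vertices P at w
  have hne : π / 3 ≠ 2 * π / 3 := by linarith [pi_pos]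
  have hsmall : ∀ i : Fin 4, faceAngle P (v i) = π / 3 → i = 0 ∨ i = 2 := by
    intro i hi
    have h3 : faceAngle P (v 1) = 2 * π / 3 := hva (1 : Fin 4)
    have h4 : faceAngle P (v 3) = 2 * π / 3 := hva (3 : Fin 4)
    fin_cases i
    · exact Or.inl rfl
    · exact absurd (hi.symm.trans h3) hne
    · exact Or.inr rfl
    · exact absurd (hi.symm.trans h4) hne
  have hw0 : faceAngle P (w 0) = π / 3 := hwa (0 : Fin 4)
  have hw1 : faceAngle P (w 1) = π / 3 := hwa (1 : Fin 4)
  have hadjw : (skeleton P).Adj (w 0) (w 1) := hw (0 : Fin 4)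
  obtain ⟨i, hi⟩ := v.surjective (w 0)
  obtain ⟨j, hj⟩ := v.surjective (w 1)
  rw [← hi] at hw0 hadjw
  rw [← hj] at hw1 hadjw
  have h02 : (skeleton P).Adj (v 0) (v 2) := by
    rcases hsmall i hw0 with rfl | rfl <;> rcases hsmall j hw1 with rfl | rfl
    · exact absurd rfl hadjw.ne
    · exact hadjw
    · exact hadjw.symm
    · exact absurd rfl hadjw.ne
  have h01 : (skeleton P).Adj (v 0) (v 1) := hv (0 : Fin 4)
  have h03 : (skeleton P).Adj (v 0) (v 3) := (hv (3 : Fin 4)).symm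
  have : Finite (vertices P) := by rw [← hV.coe_eq]; exact V.finite_toSet
  have hsub : v '' {1, 2, 3} ⊆ (skeleton P).neighborSet (v 0) := by
    rintro _ ⟨i, hi, rfl⟩
    rcases hi with rfl | rfl | rfl <;> assumption
  have hcard := ncard_le_ncard hsub (Set.toFinite _)
  rw [ncard_image_of_injective _ v.injective, hV.ncard_neighborSet hd] at hcard
  have h3 : ({1, 2, 3} : Set (Fin 4)).ncard = 3 := by
    rw [ncard_eq_toFinset_card']; rfl
  omega

theorem HasType.unique (hV : IsVertexSet V P) {t t' : Fin 5 ⊕ Fin 10} (h : HasType P t)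
    (h' : HasType P t') : t = t' := by
  rcases t with k | k <;> rcases t' with k' | k'
  · have hcard : ∀ k, HasType P (Sum.inl k) → (flatAngles k).length = Nat.card (vertices P) := by
      rintro k ⟨-, v, -⟩
      rw [← Nat.card_congr v, Nat.card_eq_fintype_card, Fintype.card_fin]
    have hlen := (hcard k h).trans (hcard k' h').symm
    have h12 : ¬ (HasType P (Sum.inl 1) ∧ HasType P (Sum.inl 2)) := fun h =>
      not_parallelogram_and_trapezoid hV h.1 h.2
    have hk : k = k' ∨ (k = 1 ∧ k' = 2) ∨ (k = 2 ∧ k' = 1) := by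
      fin_cases k <;> fin_cases k' <;> simp [flatAngles] at hlen ⊢
    rcases hk with rfl | ⟨rfl, rfl⟩ | ⟨rfl, rfl⟩
    · rfl
    · exact absurd ⟨h, h'⟩ h12
    · exact absurd ⟨h', h⟩ h12
  · have h1 : dim P = 2 := h.1
    have h2 : dim P = 3 := h'.1
    omega
  · have h1 : dim P = 3 := h.1
    have h2 : dim P = 2 := h'.1
    omega
  · obtain ⟨-, ⟨φ⟩⟩ := h
    obtain ⟨-, ⟨ψ⟩⟩ := h'
    rw [polyGraph_injective (φ.symm.trans ψ)]

theorem Folding.corners_card_and_type {n : ℕ} {G : Gluing n} {a : ℝ} (F : Folding P G a)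
    (hP : IsConvexPolyhedron P) (ha : 0 < a) :
    (∀ v ∈ vertices P, (F.cornerCount v = 1 ∧ curvature P v = 4 * π / 3) ∨
      (F.cornerCount v = 2 ∧ curvature P v = 2 * π / 3)) ∧
    (vertices P).encard ≤ 6 ∧ ∃! t : Fin 5 ⊕ Fin 10, HasType P t := by
  obtain ⟨V, hV⟩ := hP.exists_vertexSet
  have h1 : ∀ v ∈ V, (F.cornerCount v = 1 ∧ curvature P v = 4 * π / 3) ∨
      (F.cornerCount v = 2 ∧ curvature P v = 2 * π / 3) := fun v hv =>
    F.corner_and_curvature hP ha hV hv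
  have h2 : V.card ≤ 6 := card_vertices_le hP hV fun v hv => by
    rcases h1 v hv with h | h <;> linarith [h.2, pi_pos]
  refine ⟨fun v hv => h1 v (hV.mem_iff.2 hv), ?_, ?_⟩
  · rw [← hV.coe_eq, encard_coe_eq_coe_finsetCard]
    exact_mod_cast h2
  · obtain ⟨t, ht⟩ : ∃ t, HasType P t := by
      rcases hP.dim_eq with hd | hd
      · obtain ⟨k, hk⟩ := exists_flat_type hP hd hV fun v hv => (h1 v hv).imp And.right And.right
        exact ⟨Sum.inl k, hk⟩
      · have : Finite (vertices P) := by rw [← hV.coe_eq]; exact V.finite_toSet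
        obtain ⟨k, hk⟩ := (hV.admissible hd).exists_iso (by rw [hV.card_eq]; exact h2)
        exact ⟨Sum.inr k, hd, hk⟩
    exact ⟨t, ht, fun t' ht' => ht'.unique hV ht⟩

end HexGlue

end

theorem mainTheorem2 :
    (∀ (P : Set HexGlue.E3), HexGlue.IsConvexPolyhedron P →
      ∀ (n : ℕ) (G : HexGlue.Gluing n) (a : ℝ), 0 < a → ∀ F : HexGlue.Folding P G a,
        (∀ v ∈ HexGlue.vertices P,
          (F.cornerCount v = 1 ∧ HexGlue.curvature P v = 4 * Real.pi / 3) ∨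
          (F.cornerCount v = 2 ∧ HexGlue.curvature P v = 2 * Real.pi / 3)) ∧
        (HexGlue.vertices P).encard ≤ 6 ∧
        ∃! t : Fin 5 ⊕ Fin 10, HexGlue.HasType P t) ∧
    (∀ j k : Fin 10, Nonempty (HexGlue.polyGraph j ≃g HexGlue.polyGraph k) → j = k) ∧
    (∀ m : ℕ, m ≤ 6 → ∀ G : SimpleGraph (Fin m),
      ((HexGlue.IsThreeConnected G ∧ HexGlue.IsPlanar G) ↔
        ∃ k, Nonempty (G ≃g HexGlue.polyGraph k)) ∧
      (HexGlue.IsPolyhedral G ↔ ∃ k, Nonempty (G ≃g HexGlue.polyGraph k))) := by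
  exact ⟨fun _ hP _ _ _ ha F => F.corners_card_and_type hP ha,
    fun _ _ ⟨φ⟩ => HexGlue.polyGraph_injective φ,
    fun _ hm G => ⟨HexGlue.threeConnected_planar_iff hm G, HexGlue.polyhedral_iff hm G⟩⟩
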